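/- **Setting.** Let $k$ be a $\mathfrak p$-adic field (non-archimedean local field) of odd residual characteristic, $\mathfrak o$ its ring of integers, $\pi$ a prime element, $q$ the cardinality of the residue field, and $|\cdot|$ the absolute value with $|\pi|=q^{-1}$. Let $D$ be the division quaternion algebra over $k$, written $D=k\oplus k\varepsilon\oplus k\Pi\oplus k\varepsilon\Pi$ with $\varepsilon^2\in\mathfrak o^\times$ a non-square in $k$, $\Pi^2=\pi$, $\Pi\varepsilon=-\varepsilon\Pi$, with its canonical involution $*$, reduced norm $N_{rd}$ and maximal order $\mathcal O=\mathfrak o\oplus\mathfrak o\varepsilon\oplus\mathfrak o\Pi\oplus\mathfrak o\varepsilon\Pi$. Put $G=GL_2(D)$, $K=GL_2(\mathcal O)$, $X=\{A\in G: A^*=A\}$ where $(a_{ij})^*=(a_{ji}^*)$, with action $g\cdot A=gAg^*$. Let $dx$ be the $G$-invariant measure $|N_{rd}(x)|^{-3/2}dx_{11}\,dx_{22}\,dx_{12}$ on $X$ ($x_{11},x_{22}\in k$, $x_{12}\in D$, additive Haar measures), normalized so that the orbit $K\cdot 1_2$ has volume $1$. Let $\mathcal S(K\backslash X)$ be the space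 of left $K$-invariant compactly supported functions $X\to\mathbb C$. **Spherical transform.** For $x\in X$ let $|d_i(x)|=|N_{rd}(x^{(i)})|^{1/2}$, where $x^{(i)}$ is the upper left $i\times i$ block ($i=1,2$). For $z\in\mathbb C^2$ put $s_1=-z_1+z_2-2$, $s_2=-z_2+1$ and, with $d\kappa$ the Haar probability measure on $K$, $$\omega(x;z)=\int_K |d_1(\kappa\cdot x)|^{s_1}|d_2(\kappa\cdot x)|^{s_2}\,d\kappa\qquad(\mathrm{Re}\, s_1\ge 0),$$ where the integrand is $0$ where $d_1(\kappa\cdot x)d_2(\kappa\cdot x)=0$. For each $x$ the function $(q^{z_2}-q^{z_1+1})\,\omega(x;z)$ has a unique holomorphic continuation $\Psi(x;z)$ to $z\in\mathbb C^2$. For $\varphi\in\mathcal S(K\backslash X)$ put $$F(\varphi)(z)=\int_X\varphi(x)\Psi(x^{-1};z)\,dx ,$$ regarded as a function of $x=\frac{z_1+z_2}{2}$ and $y=\frac{z_2-z_1}{2}$. **Inner product.** Let $T=\{x=\sqrt{-1}\,t: 0\le t\le 2\pi/\log q\}$, and let $U$ be any continuous path in the $y$-plane, differentiable except at finitely many points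 and with integrable derivative, that runs from some $y_0$ to $y_0+2\pi\sqrt{-1}/\log q$ and is such that the closed path $Y=q^{y}$ avoids $\pm q^{\pm1/2},\pm q^{\pm1}$, has winding number $1$ about $\pm q^{1/2}$ and $\pm q^{-1}$, and winding number $0$ about $\pm q^{-1/2}$ and $\pm q$. (Such a path is obtained from the unit circle $|Y|=1$ by pushing it so that $\pm q^{1/2}$ come to lie inside and $\pm q^{-1/2}$ outside.) Put $$w(y)=\frac{1-q^{2y}}{(1-q^{2y+1})(1-q^{2y-2})}\cdot\frac{1-q^{-2y}}{(1-q^{-2y+1})(1-q^{-2y-2})},\qquad \langle f,g\rangle=\int_T dx\int_U f\,\overline g\,w(y)\,dy ,$$ for $f,g\in\mathbb C[q^{x},q^{-x},q^{y}+q^{-y}]$, where $dx$ and $dy$ are the constant multiples of the line elements for which $\int_{T\times U}dx\,dy=\dfrac{(1+q^{-2})^2}{2(1-q^{-1})}$, and $\overline g$ is the Laurent polynomial $\overline g(x,y)=\overline{g(-\bar x,-\bar y)}$, i.e. the holomorphic extension of the complex conjugate of $g$ from purely imaginary $x,y$. **Theorem 5.7 (Plancherel formula).** For all $\varphi,\psi\in\mathcal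 S(K\backslash X)$ the function $\varphi\,\overline\psi$ is integrable on $X$, the integrals defining $F(\varphi)$ and $F(\psi)$ converge absolutely, and $$\int_X\varphi(x)\overline{\psi(x)}\,dx=\langle F(\varphi),F(\psi)\rangle .$$ -/

import Mathlib

open MeasureTheory Topology
open scoped Quaternion NormedField Valued Real ComplexConjugate

namespace QuatHerm

/-! ### Quaternion algebras as topological rings -/

section TopologicalQuaternion

variable {R : Type*} [TopologicalSpace R] {a b c : R}

/-- The topology on a quaternion algebra given by its four coordinates. -/
instance : TopologicalSpace ℍ[R,a,b,c] :=
  TopologicalSpace.induced (QuaternionAlgebra.equivProd a b c) inferInstance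

/-- The coordinates form a homeomorphism with the fourfold product. -/
def coordHomeo : ℍ[R,a,b,c] ≃ₜ R × R × R × R :=
  (QuaternionAlgebra.equivProd a b c).toHomeomorphOfIsInducing ⟨rfl⟩

instance [T2Space R] : T2Space ℍ[R,a,b,c] :=
  (coordHomeo (a := a) (b := b) (c := c)).isEmbedding.t2Space

instance [CompactSpace R] : CompactSpace ℍ[R,a,b,c] :=
  (coordHomeo (a := a) (b := b) (c := c)).symm.compactSpace

theorem continuous_quat {α : Type*} [TopologicalSpace α] {f : α → ℍ[R,a,b,c]} :
    Continuous f ↔ Continuous (fun t => (f t).re) ∧ Continuous (fun t => (f t).imI) ∧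
      Continuous (fun t => (f t).imJ) ∧ Continuous (fun t => (f t).imK) := by
  rw [← (coordHomeo (a := a) (b := b) (c := c)).comp_continuous_iff]
  constructor
  · intro h
    exact ⟨continuous_fst.comp h, (continuous_fst.comp continuous_snd).comp h,
      (continuous_fst.comp (continuous_snd.comp continuous_snd)).comp h,
      (continuous_snd.comp (continuous_snd.comp continuous_snd)).comp h⟩
  · rintro ⟨h1, h2, h3, h4⟩
    exact h1.prodMk (h2.prodMk (h3.prodMk h4))

instance [CommRing R] [IsTopologicalRing R] : IsTopologicalRing ℍ[R,a,b,c] := by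
  obtain ⟨h1, h2, h3, h4⟩ := continuous_quat.1 (continuous_id (X := ℍ[R,a,b,c]))
  simp only [id] at h1 h2 h3 h4
  refine { continuous_add := ?_, continuous_mul := ?_, continuous_neg := ?_ } <;>
  · rw [continuous_quat]
    simp only [QuaternionAlgebra.re_add, QuaternionAlgebra.imI_add, QuaternionAlgebra.imJ_add,
      QuaternionAlgebra.imK_add, QuaternionAlgebra.re_mul, QuaternionAlgebra.imI_mul,
      QuaternionAlgebra.imJ_mul, QuaternionAlgebra.imK_mul, QuaternionAlgebra.re_neg,
      QuaternionAlgebra.imI_neg, QuaternionAlgebra.imJ_neg, QuaternionAlgebra.imK_neg]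
    refine ⟨?_, ?_, ?_, ?_⟩ <;> fun_prop

end TopologicalQuaternion

noncomputable section

variable {k : Type*} [NontriviallyNormedField k] [IsUltrametricDist k]

/-! ### The division algebra, its maximal order, the groups and the space of hermitian forms -/

variable (k) in
/-- The cardinality `q` of the residue field of `k`. -/
def resCard : ℕ := Nat.card 𝓀[k]

/-- The quaternion algebra `D = k + kε + kΠ + kεΠ` with `ε² = u`, `Π² = ϖ`, `Πε = -εΠ`. Its
involution `star` is `a + bε + cΠ + dεΠ ↦ a - bε - cΠ - dεΠ`. -/
abbrev Quat (u ϖ : 𝒪[k]) : Type _ := ℍ[k,(u : k),(ϖ : k)]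

/-- The maximal order of `D`, with `𝒪[k]`-basis `1, ε, Π, εΠ`. -/
abbrev MaxOrder (u ϖ : 𝒪[k]) : Type _ := ℍ[𝒪[k],u,ϖ]

/-- The inclusion of the maximal order in `D`. -/
def orderIncl (u ϖ : 𝒪[k]) : MaxOrder u ϖ →+* Quat u ϖ where
  toFun α := ⟨α.re, α.imI, α.imJ, α.imK⟩
  map_one' := by ext <;> simp
  map_zero' := by ext <;> simp
  map_mul' α β := by ext <;> simp
  map_add' α β := by ext <;> simp

/-- The group `G = GL₂(D)`. -/
abbrev GLD (u ϖ : 𝒪[k]) : Type _ := (Matrix (Fin 2) (Fin 2) (Quat u ϖ))ˣ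

/-- The group `K = GL₂` of the maximal order. -/
def GLO (u ϖ : 𝒪[k]) : Type _ := (Matrix (Fin 2) (Fin 2) (MaxOrder u ϖ))ˣ

namespace GLO

variable (u ϖ : 𝒪[k])

instance : Group (GLO u ϖ) := inferInstanceAs (Group (Matrix (Fin 2) (Fin 2) (MaxOrder u ϖ))ˣ)

instance : TopologicalSpace (GLO u ϖ) :=
  inferInstanceAs (TopologicalSpace (Matrix (Fin 2) (Fin 2) (MaxOrder u ϖ))ˣ)

instance : IsTopologicalGroup (GLO u ϖ) :=
  inferInstanceAs (IsTopologicalGroup (Matrix (Fin 2) (Fin 2) (MaxOrder u ϖ))ˣ)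

instance [ProperSpace k] : CompactSpace 𝒪[k] := by
  refine isCompact_iff_compactSpace.1 ?_
  have h : (𝒪[k] : Set k) = Metric.closedBall 0 1 := by
    ext x
    simp only [SetLike.mem_coe, mem_closedBall_zero_iff]
    exact Valued.integer.mem_iff
  rw [h]
  exact isCompact_closedBall 0 1

instance [ProperSpace k] : CompactSpace (GLO u ϖ) :=
  haveI : CompactSpace (Matrix (Fin 2) (Fin 2) (MaxOrder u ϖ)) :=
    inferInstanceAs (CompactSpace (Fin 2 → Fin 2 → MaxOrder u ϖ))
  inferInstanceAs (CompactSpace (Matrix (Fin 2) (Fin 2) (MaxOrder u ϖ))ˣ)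

instance : MeasurableSpace (GLO u ϖ) := borel _

instance : BorelSpace (GLO u ϖ) := ⟨rfl⟩

/-- The inclusion of `K` in `G`. -/
def incl : GLO u ϖ →* GLD u ϖ := Units.map (orderIncl u ϖ).mapMatrix.toMonoidHom

/-- The normalized Haar measure on `K`, of total mass `1`. -/
def haar [ProperSpace k] : Measure (GLO u ϖ) := Measure.haarMeasure ⊤

end GLO

/-- The space `X = {A ∈ G | A^* = A}` of quaternion hermitian forms of size two; here `star A` is
the conjugate transpose of `A`. -/
def HermSpace (u ϖ : 𝒪[k]) : Type _ := {A : GLD u ϖ // star A = A}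

namespace HermSpace

variable {u ϖ : 𝒪[k]}

instance : TopologicalSpace (HermSpace u ϖ) :=
  inferInstanceAs (TopologicalSpace {A : GLD u ϖ // star A = A})

instance : MeasurableSpace (HermSpace u ϖ) := borel _

instance : BorelSpace (HermSpace u ϖ) := ⟨rfl⟩

/-- The underlying matrix of a hermitian form. -/
def mat (x : HermSpace u ϖ) : Matrix (Fin 2) (Fin 2) (Quat u ϖ) := (x.1 : GLD u ϖ).val

/-- The identity matrix as an element of `X`. -/
instance : One (HermSpace u ϖ) := ⟨⟨1, star_one _⟩⟩

/-- The inverse matrix as an element of `X`. -/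
instance : Inv (HermSpace u ϖ) := ⟨fun x => ⟨x.1⁻¹, by rw [star_inv, x.2]⟩⟩

/-- The action `g · A = g A g^*` of `G` on `X`. -/
def act (g : GLD u ϖ) (x : HermSpace u ϖ) : HermSpace u ϖ :=
  ⟨g * x.1 * star g, by rw [star_mul, star_mul, star_star, x.2, mul_assoc]⟩

/-- The action of `K` on `X`. -/
def actK (κ : GLO u ϖ) (x : HermSpace u ϖ) : HermSpace u ϖ := act (GLO.incl u ϖ κ) x

/-- The orbit `K · x`. -/
def orbitK (x : HermSpace u ϖ) : Set (HermSpace u ϖ) := Set.range fun κ : GLO u ϖ => actK κ x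

end HermSpace

/-! ### Reduced norm and relative invariants -/

/-- The splitting `φ : D → M₂(k')`, `k' = k(ε)`, determined by `α (1 Π) = (1 Π) φ(α)`. For
`α = a + bε + cΠ + dΠε` it is the matrix with rows `(a + bε, (c - dε)ϖ)` and `(c + dε, a - bε)`.
As `Πε = -εΠ`, one has `d = -α.imK`. -/
def splitting {u ϖ : 𝒪[k]} (α : Quat u ϖ) :
    Matrix (Fin 2) (Fin 2) (QuadraticAlgebra k (u : k) 0) :=
  !![⟨α.re, α.imI⟩, ⟨ϖ * α.imJ, ϖ * α.imK⟩; ⟨α.imJ, -α.imK⟩, ⟨α.re, -α.imI⟩]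

/-- The reduced norm on `M_m(D)`: the determinant of the image in `M_{2m}(k')`, which lies
in `k`. -/
def nrd {u ϖ : 𝒪[k]} {m : ℕ} (A : Matrix (Fin m) (Fin m) (Quat u ϖ)) : k :=
  (Matrix.det (Matrix.of fun p r : Fin m × Fin 2 =>
    splitting (A p.1 r.1) p.2 r.2)).re

/-- `|d_i(x)|`, where `d_i(x)² = Nrd(x^{(i)})` and `x^{(i)}` is the upper left `i × i` block
(the index `i : Fin 2` stands for the block of size `i + 1`). -/
def absInv {u ϖ : 𝒪[k]} (x : HermSpace u ϖ) (i : Fin 2) : ℝ :=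
  Real.sqrt ‖nrd (x.mat.submatrix (Fin.castLE i.isLt) (Fin.castLE i.isLt))‖

open Classical in
/-- `|d(x)|^s = ∏ |d_i(x)|^{s_i}` if all `d_i(x)` are nonzero, and `0` otherwise. -/
def absInvPow {u ϖ : 𝒪[k]} (x : HermSpace u ϖ) (s : Fin 2 → ℂ) : ℂ :=
  if ∀ i, absInv x i ≠ 0 then ∏ i, (absInv x i : ℂ) ^ s i else 0

/-! ### Spherical functions -/

/-- The change of variables `s₁ = -z₁ + z₂ - 2`, `s₂ = -z₂ + 1`. -/
def sVar (z : Fin 2 → ℂ) : Fin 2 → ℂ := ![-z 0 + z 1 - 2, -z 1 + 1]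

section Spherical

variable [ProperSpace k] {u ϖ : 𝒪[k]}

/-- The integral `∫_K |d(κ · x)|^s dκ` defining the spherical function `ω(x; s)`; it converges
for `Re s₁ ≥ 0`. -/
def omegaInt (x : HermSpace u ϖ) (s : Fin 2 → ℂ) : ℂ :=
  ∫ κ, absInvPow (HermSpace.actK κ x) s ∂(GLO.haar u ϖ)

/-- The factor `q^{z₂} - q^{z₁+1}`. -/
def normFactor (q : ℕ) (z : Fin 2 → ℂ) : ℂ := (q : ℂ) ^ z 1 - (q : ℂ) ^ (z 0 + 1)

/-- `f` is the analytic continuation to `ℂ²` of `(q^{z₂} - q^{z₁+1}) ω(x; z)`, where `ω(x; z)` is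
given by the integral in the domain `Re s₁ ≥ 0`. There is at most one such `f`. -/
def IsNormalizedSpherical (x : HermSpace u ϖ) (f : (Fin 2 → ℂ) → ℂ) : Prop :=
  Differentiable ℂ f ∧ ∀ z : Fin 2 → ℂ, 0 ≤ (sVar z 0).re →
    f z = normFactor (resCard k) z * omegaInt x (sVar z)

/-- The normalized spherical function `Ψ(x; z)`. -/
def Psi (x : HermSpace u ϖ) : (Fin 2 → ℂ) → ℂ := Classical.epsilon (IsNormalizedSpherical x)

end Spherical

/-! ### The invariant measure, the Schwartz space and the spherical transform -/

/-- The Schwartz space: left `K`-invariant compactly supported functions on `X`. -/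
def IsSchwartz {u ϖ : 𝒪[k]} (φ : HermSpace u ϖ → ℂ) : Prop :=
  (∀ (κ : GLO u ϖ) (x : HermSpace u ϖ), φ (HermSpace.actK κ x) = φ x) ∧ HasCompactSupport φ

/-- The coordinates `(x₁₁, x₂₂, x₁₂) ∈ k × k × D` of a hermitian form, with `D` written in
coordinates. -/
def hermCoord {u ϖ : 𝒪[k]} (x : HermSpace u ϖ) : Fin 6 → k :=
  ![(x.mat 0 0).re, (x.mat 1 1).re,
    (x.mat 0 1).re, (x.mat 0 1).imI, (x.mat 0 1).imJ, (x.mat 0 1).imK]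

section InvariantMeasure

variable [ProperSpace k] [MeasurableSpace k] [BorelSpace k] (u ϖ : 𝒪[k])

/-- The `G`-invariant measure `|Nrd(x)|^{-3/2} dx₁₁ dx₂₂ dx₁₂` on `X`, where `dx₁₁ dx₂₂ dx₁₂` is
an additive Haar measure. -/
def invMeasureAux : Measure (HermSpace u ϖ) :=
  (Measure.comap hermCoord (Measure.pi fun _ : Fin 6 => (Measure.addHaar : Measure k))).withDensity
    fun x => ENNReal.ofReal (‖nrd x.mat‖ ^ (-(3 / 2) : ℝ))

/-- The `G`-invariant measure `dx` on `X`, normalized so that the orbit `K · 1` has volume `1`. -/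
def invMeasure : Measure (HermSpace u ϖ) :=
  (invMeasureAux u ϖ (HermSpace.orbitK 1))⁻¹ • invMeasureAux u ϖ

variable {u ϖ}

/-- The normalized spherical Fourier transform `F(φ)(z) = ∫_X φ(x) Ψ(x⁻¹; z) dx`. -/
def sphTransform (φ : HermSpace u ϖ → ℂ) (z : Fin 2 → ℂ) : ℂ :=
  ∫ x, φ x * Psi x⁻¹ z ∂(invMeasure u ϖ)

/-- The transform in the variables `x = (z₁ + z₂)/2`, `y = (z₂ - z₁)/2`. -/
def sphTransformXY (φ : HermSpace u ϖ → ℂ) (x y : ℂ) : ℂ := sphTransform φ ![x - y, x + y]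

end InvariantMeasure

/-! ### The inner product -/

/-- The weight function `w(y)` with `u₁ = q`, `u₂ = q⁻²`. -/
def weight (q : ℕ) (y : ℂ) : ℂ :=
  (1 - (q : ℂ) ^ (2 * y)) / ((1 - (q : ℂ) ^ (2 * y + 1)) * (1 - (q : ℂ) ^ (2 * y - 2))) *
  ((1 - (q : ℂ) ^ (-2 * y)) / ((1 - (q : ℂ) ^ (-2 * y + 1)) * (1 - (q : ℂ) ^ (-2 * y - 2))))

/-- The path `Y(t) = q^{y(t)}` in the `Y`-plane, `Y = q^y`. -/
def expPath (q : ℕ) (y : ℝ → ℂ) (t : ℝ) : ℂ := (q : ℂ) ^ y t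

/-- The winding number `(1 / 2πi) ∮ dY / (Y - p)` about `p` of `Y(t) = q^{y(t)}`, `0 ≤ t ≤ 1`. -/
def winding (q : ℕ) (y : ℝ → ℂ) (p : ℂ) : ℂ :=
  (2 * π * Complex.I)⁻¹ * ∫ t in (0 : ℝ)..1, deriv (expPath q y) t / (expPath q y t - p)

/-- The poles of the weight, in the variable `Y = q^y`, that the contour encloses:
`Y = ± q^{1/2}` and `Y = ± q⁻¹`. -/
def innerPoles (q : ℕ) : Set ℂ :=
  {(q : ℂ) ^ (1 / 2 : ℂ), -(q : ℂ) ^ (1 / 2 : ℂ), (q : ℂ)⁻¹, -(q : ℂ)⁻¹}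

/-- The poles of the weight, in the variable `Y = q^y`, that the contour leaves outside:
`Y = ± q^{-1/2}` and `Y = ± q`. -/
def outerPoles (q : ℕ) : Set ℂ :=
  {(q : ℂ) ^ (-(1 / 2) : ℂ), -(q : ℂ) ^ (-(1 / 2) : ℂ), (q : ℂ), -(q : ℂ)}

/-- The deformed contour `U`, parametrized by `y : [0, 1] → ℂ`, piecewise differentiable with
integrable derivative. It runs from some `y₀` to `y₀ + 2πi / log q`, so that `Y = q^y` is a closed
path going once counterclockwise about `Y = 0`; it avoids the poles of the weight, winds once about
`± q^{1/2}`, `± q⁻¹`, and does not wind about `± q^{-1/2}`, `± q`. -/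
structure IsDeformedContour (q : ℕ) (y : ℝ → ℂ) : Prop where
  continuousOn : ContinuousOn y (Set.Icc 0 1)
  differentiableAt : ∃ S : Finset ℝ, ∀ t ∈ Set.Ioo (0 : ℝ) 1, t ∉ S → DifferentiableAt ℝ y t
  integrable_deriv : IntervalIntegrable (deriv y) volume 0 1
  period : y 1 = y 0 + 2 * π * Complex.I / Real.log q
  avoids : ∀ t ∈ Set.Icc (0 : ℝ) 1, expPath q y t ∉ innerPoles q ∪ outerPoles q
  winding_inner : ∀ p ∈ innerPoles q, winding q y p = 1
  winding_outer : ∀ p ∈ outerPoles q, winding q y p = 0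

/-- The holomorphic extension `ḡ(x, y) = conj (g (-conj x, -conj y))` of the complex conjugate
of `g` from purely imaginary `x` and `y`: it conjugates the coefficients of a Laurent polynomial
in `q^x, q^y` and replaces `q^x, q^y` by `q^{-x}, q^{-y}`. -/
def conjExt (g : ℂ → ℂ → ℂ) (x y : ℂ) : ℂ := conj (g (-conj x) (-conj y))

/-- The inner product `∫_T dx ∫_U f ḡ w(y) dy`, where `T = {it | 0 ≤ t ≤ 2π / log q}`, `U` is the
contour parametrized by `y`, and `dx`, `dy` are the constant multiples of the line elements
for which `T × U` has total mass `(1 + q⁻²)² / (2 (1 - q⁻¹))`. -/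
def pairing (q : ℕ) (y : ℝ → ℂ) (f g : ℂ → ℂ → ℂ) : ℂ :=
  ((1 + (q : ℂ)⁻¹ ^ 2) ^ 2 / (2 * (1 - (q : ℂ)⁻¹))) *
    ((Real.log q / (2 * π) : ℝ) * ∫ t in (0 : ℝ)..(2 * π / Real.log q),
      (Real.log q / (2 * π * Complex.I)) * ∫ r in (0 : ℝ)..1,
        f (t * Complex.I) (y r) * conjExt g (t * Complex.I) (y r) * weight q (y r) * deriv y r)

end

end QuatHerm

open QuatHerm

open MeasureTheory Topology
open scoped Quaternion NormedField Valued Real ComplexConjugate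

set_option linter.unusedSectionVars false

/-! ### Local fields -/

namespace QuatHerm

section LocalField

variable {k : Type*} [NontriviallyNormedField k] [IsUltrametricDist k]

/-! Every $K$-orbit in $X$ is open, so a compactly supported $K$-invariant function is a finite
combination of orbit indicators. The spherical functions are constant on orbits, and inversion
permutes the orbits while preserving their volumes. The formula therefore follows once the functions
$\Psi_\sigma$ attached to the orbits $\sigma$ are shown to be pairwise orthogonal for the pairing,
with $\langle\Psi_\sigma,\Psi_\sigma\rangle=1/\mathrm{vol}(\sigma)$. Orbits, spherical functions,
volumes and pairings are all computed explicitly.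

Orbits. By elementary moves every form becomes $\mathrm{diag}(\pi^i,\pi^{i+n})$ with $n\ge 0$, or
the antidiagonal form with entry $\pi^e\Pi$ (`IsDatum.exists_rep`). These are told apart by the
absolute value of the discriminant and by the largest norm of an entry, both $K$-invariant
(`IsDatum.mem_level_iff`). Odd residual characteristic enters through Hensel-type root finding and
the inversion of $2$.

Spherical functions. The invariant $|d_2|$ is constant on $K$-orbits and $d_1(\kappa\cdot x)$
depends only on the first row of $\kappa$, which is uniformly distributed on primitive vectors
(`IsDatum.average_row`). On diagonal forms the average reduces to $\int|N(v)+\gamma\pi^n|^s\,dv$,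
which obeys a recursion in $n$ obtained by pulling $\Pi$ out of the non-units. The case $n=0$ comes
from the hyperbolic plane, which lies in the same orbit (`IsDatum.integral_nr_add_pow`). With
$Y=q^y$, the result is $q^{(\mathrm{ord}+1)x}$, where $\mathrm{ord}$ is the order of the
discriminant, times a function of $Y$ invariant under $Y\mapsto Y^{-1}$; on antidiagonal orbits that
function is the constant $q-1$ (`IsDatum.psiFun_eq`).

Volumes. Scaling by a power of $\pi$ moves an orbit into the lattice of integral forms, where Haar
measure is a product and the discriminant is affine in a diagonal entry
(`IsDatum.invMeasure_level`).

Orthogonality. Integration over $x$ separates the orders of the discriminants. In $y$, the weight is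
$h(Y)h(Y^{-1})$, and the function of a diagonal orbit is, up to a constant,
$Y^{n+1}/h(Y^{-1})+Y^{-n-1}/h(Y)$ (`symPoly_mul_weight`). The contour has winding number $0$ about
the poles of $h(Y)$ and $1$ about those of $h(Y^{-1})$. Hence against $dY/Y$ a polynomial in $Y^2$
times $h(Y)$, or one in $Y^{-2}$ times $h(Y^{-1})$, integrates to its constant term
(`IsDeformedContour.cint_halfWeight_add`). This yields both the vanishing and the norms
(`IsDeformedContour.orbPair_ne`, `IsDeformedContour.orbPair_self`), which are assembled in
`IsDeformedContour.pairing_sum`. -/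

theorem norm_coe_le_one (x : 𝒪[k]) : ‖(x : k)‖ ≤ 1 := Valued.integer.mem_iff.1 x.2

/-- An element of `k` of norm at most one, as an element of the ring of integers. -/
def toInt (x : k) (hx : ‖x‖ ≤ 1) : 𝒪[k] := ⟨x, Valued.integer.mem_iff.2 hx⟩

@[simp] theorem coe_toInt (x : k) (hx : ‖x‖ ≤ 1) : ((toInt x hx : 𝒪[k]) : k) = x := rfl

theorem isUnit_int_iff {x : 𝒪[k]} : IsUnit x ↔ ‖(x : k)‖ = 1 :=
  Valued.integer.isUnit_iff_norm_eq_one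

theorem norm_two_eq_one (hodd : ringChar 𝓀[k] ≠ 2) : ‖(2 : k)‖ = 1 := by
  have h2 : (2 : 𝓀[k]) ≠ 0 := Ring.two_ne_zero hodd
  have h : IsUnit (2 : 𝒪[k]) := by
    by_contra hn
    apply h2
    have := (IsLocalRing.residue_eq_zero_iff (2 : 𝒪[k])).2 ((IsLocalRing.mem_maximalIdeal _).2 hn)
    rwa [map_ofNat] at this
  exact isUnit_int_iff.1 h

theorem add_norm_le {a b : k} {r : ℝ} (ha : ‖a‖ ≤ r) (hb : ‖b‖ ≤ r) : ‖a + b‖ ≤ r :=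
  (IsUltrametricDist.norm_add_le_max a b).trans (max_le ha hb)

theorem sub_norm_le {a b : k} {r : ℝ} (ha : ‖a‖ ≤ r) (hb : ‖b‖ ≤ r) : ‖a - b‖ ≤ r := by
  rw [sub_eq_add_neg]; exact add_norm_le ha (by rwa [norm_neg])

theorem add_norm_lt {a b : k} {r : ℝ} (ha : ‖a‖ < r) (hb : ‖b‖ < r) : ‖a + b‖ < r :=
  (IsUltrametricDist.norm_add_le_max a b).trans_lt (max_lt ha hb)

theorem sub_norm_lt {a b : k} {r : ℝ} (ha : ‖a‖ < r) (hb : ‖b‖ < r) : ‖a - b‖ < r := by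
  rw [sub_eq_add_neg]; exact add_norm_lt ha (by rwa [norm_neg])

theorem add_norm_eq_left {a b : k} (h : ‖b‖ < ‖a‖) : ‖a + b‖ = ‖a‖ := by
  rw [IsUltrametricDist.norm_add_eq_max_of_norm_ne_norm h.ne', max_eq_left h.le]

theorem sub_norm_eq_left {a b : k} (h : ‖b‖ < ‖a‖) : ‖a - b‖ = ‖a‖ := by
  rw [sub_eq_add_neg]; exact add_norm_eq_left (by rwa [norm_neg])

theorem sub_norm_eq_right {a b : k} (h : ‖a‖ < ‖b‖) : ‖a - b‖ = ‖b‖ := by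
  rw [← norm_neg, neg_sub]; exact sub_norm_eq_left h

theorem mul_norm_le_one {a b : k} (ha : ‖a‖ ≤ 1) (hb : ‖b‖ ≤ 1) : ‖a * b‖ ≤ 1 := by
  rw [norm_mul]; exact mul_le_one₀ ha (norm_nonneg _) hb

end LocalField

/-- The standing assumptions on the data defining the division quaternion algebra. -/
structure IsDatum {k : Type*} [NontriviallyNormedField k] [IsUltrametricDist k]
    (u ϖ : 𝒪[k]) : Prop where
  odd : ringChar 𝓀[k] ≠ 2
  isUnit : IsUnit u
  nonsq : ¬ IsSquare (u : k)
  irr : Irreducible ϖ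
  norm_eq : ‖(ϖ : k)‖ = (resCard k : ℝ)⁻¹

/-! ### Value group, square roots and norms from the unramified quadratic extension -/

section Datum

variable {k : Type*} [NontriviallyNormedField k] [IsUltrametricDist k] [ProperSpace k]

instance isDVR_int : IsDiscreteValuationRing 𝒪[k] :=
  haveI : IsPrincipalIdealRing 𝒪[k] := Valued.integer.isPrincipalIdealRing_of_compactSpace
  { not_a_field' := by
      obtain ⟨x, hx0, hx1⟩ := Valued.integer.exists_norm_coe_lt_one k
      intro h
      have hx : x ∈ IsLocalRing.maximalIdeal 𝒪[k] := (IsLocalRing.mem_maximalIdeal _).2 fun hu =>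
        hx1.ne (isUnit_int_iff.1 hu)
      rw [h, Ideal.mem_bot] at hx
      simp [hx] at hx0 }

instance finite_residue : Finite 𝓀[k] :=
  inferInstanceAs (Finite (IsLocalRing.ResidueField 𝒪[k]))

theorem two_le_resCard : 2 ≤ resCard k := Finite.one_lt_card (α := 𝓀[k])

variable {u ϖ : 𝒪[k]}

variable (k) in
/-- The cardinality of the residue field as a real number. -/
noncomputable abbrev rq : ℝ := (resCard k : ℝ)

theorem rq_pos : 0 < rq k := by
  have := two_le_resCard (k := k)
  have h : (2 : ℝ) ≤ rq k := by exact_mod_cast this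
  linarith

theorem one_lt_rq : 1 < rq k := by
  have := two_le_resCard (k := k)
  have h : (2 : ℝ) ≤ rq k := by exact_mod_cast this
  linarith

theorem rq_zpow_inj {m n : ℤ} (h : rq k ^ m = rq k ^ n) : m = n :=
  zpow_right_injective₀ rq_pos one_lt_rq.ne' h

variable (h : IsDatum u ϖ)
include h

theorem IsDatum.ne_zero : (ϖ : k) ≠ 0 := by
  intro h0
  exact h.irr.ne_zero (Subtype.ext h0)

theorem IsDatum.norm_lt_one : ‖(ϖ : k)‖ < 1 := by
  rw [h.norm_eq]; exact inv_lt_one_of_one_lt₀ one_lt_rq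

theorem IsDatum.norm_zpow (n : ℤ) : ‖(ϖ : k) ^ n‖ = rq k ^ (-n) := by
  rw [_root_.norm_zpow, h.norm_eq, inv_zpow']

theorem IsDatum.two : ‖(2 : k)‖ = 1 := norm_two_eq_one h.odd

theorem IsDatum.two_ne : (2 : k) ≠ 0 := by
  intro h0; have := h.two; rw [h0, norm_zero] at this; exact zero_ne_one this

theorem IsDatum.norm_u : ‖(u : k)‖ = 1 := isUnit_int_iff.1 h.isUnit

/-- An integral element is a unit times a power of the uniformizer; elements of norm above one are
inverted. -/
theorem IsDatum.exists_norm_eq {x : k} (hx : x ≠ 0) : ∃ n : ℤ, ‖x‖ = rq k ^ n := by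
  have key : ∀ y : k, y ≠ 0 → ‖y‖ ≤ 1 → ∃ n : ℤ, ‖y‖ = rq k ^ n := by
    intro y hy hy1
    have hy' : toInt y hy1 ≠ 0 := fun h0 => hy (by simpa using congrArg (Subtype.val) h0)
    obtain ⟨n, hn⟩ := IsDiscreteValuationRing.associated_pow_irreducible hy' h.irr
    obtain ⟨v, hv⟩ := hn.symm
    have e : (ϖ : k) ^ n * ((v : 𝒪[k]) : k) = y := by
      simpa using congrArg (Subtype.val) hv
    refine ⟨-n, ?_⟩
    rw [← e, norm_mul, isUnit_int_iff.1 v.isUnit, mul_one, ← zpow_natCast, h.norm_zpow]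
  rcases le_total ‖x‖ 1 with h1 | h1
  · exact key x hx h1
  · obtain ⟨n, hn⟩ := key x⁻¹ (inv_ne_zero hx) (by rw [norm_inv]; exact inv_le_one_of_one_le₀ h1)
    refine ⟨-n, ?_⟩
    rw [zpow_neg, ← hn, norm_inv, inv_inv]

theorem IsDatum.lt_zpow_iff {x : k} (n : ℤ) : ‖x‖ < rq k ^ n ↔ ‖x‖ ≤ rq k ^ (n - 1) := by
  rcases eq_or_ne x 0 with rfl | hx
  · simp only [norm_zero]
    exact ⟨fun _ => (zpow_pos rq_pos _).le, fun _ => zpow_pos rq_pos _⟩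
  · obtain ⟨m, hm⟩ := h.exists_norm_eq hx
    rw [hm, zpow_lt_zpow_iff_right₀ one_lt_rq, zpow_le_zpow_iff_right₀ one_lt_rq]
    omega

theorem IsDatum.norm_lt_one_iff {x : k} : ‖x‖ < 1 ↔ ‖x‖ ≤ (rq k)⁻¹ := by
  have := h.lt_zpow_iff (x := x) 0
  simpa using this

/-- The quadratic equation `a + 2 c - ϖ d c ^ 2 = 0` is solvable in the ring of integers. -/
theorem IsDatum.exists_root (a d : 𝒪[k]) :
    ∃ c : 𝒪[k], (a : k) + 2 * c - ϖ * d * c ^ 2 = 0 := by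
  have hs : IsComplete {x : k | ‖x‖ ≤ 1} := by
    have : {x : k | ‖x‖ ≤ 1} = Metric.closedBall 0 1 := by ext; simp
    rw [this]; exact Metric.isClosed_closedBall.isComplete
  -- Fixed points of this map are the roots. As $2$ is a unit, it preserves the unit ball and
  -- contracts it by the factor $|\varpi|$.
  let f : k → k := fun c => (ϖ * d * c ^ 2 - a) / 2
  have hmaps : Set.MapsTo f {x : k | ‖x‖ ≤ 1} {x : k | ‖x‖ ≤ 1} := by
    intro c (hc : ‖c‖ ≤ 1)
    change ‖(ϖ * d * c ^ 2 - a) / 2‖ ≤ 1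
    rw [norm_div, h.two, div_one]
    refine sub_norm_le ?_ (norm_coe_le_one a)
    exact mul_norm_le_one (mul_norm_le_one (norm_coe_le_one _) (norm_coe_le_one _))
      (by rw [norm_pow]; exact pow_le_one₀ (norm_nonneg _) hc)
  have hlip : LipschitzWith ⟨‖(ϖ : k)‖, norm_nonneg _⟩ (hmaps.restrict f _ _) := by
    refine LipschitzWith.of_dist_le_mul ?_
    rintro ⟨x, hx : ‖x‖ ≤ 1⟩ ⟨y, hy : ‖y‖ ≤ 1⟩
    change dist (f x) (f y) ≤ ‖(ϖ : k)‖ * dist x y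
    rw [dist_eq_norm, dist_eq_norm]
    have e : f x - f y = ϖ * (x - y) * (d * (x + y)) / 2 := by
      simp only [f]; ring
    rw [e, norm_div, h.two, div_one, norm_mul, norm_mul]
    exact mul_le_of_le_one_right (by positivity)
      (mul_norm_le_one (norm_coe_le_one _) (add_norm_le hx hy))
  have hcontr : ContractingWith ⟨‖(ϖ : k)‖, norm_nonneg _⟩ (hmaps.restrict f _ _) :=
    ⟨by exact_mod_cast h.norm_lt_one, hlip⟩
  obtain ⟨c, hc, hfix, -⟩ := hcontr.exists_fixedPoint' hs hmaps (x := 0) (by simp)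
    (edist_ne_top _ _)
  refine ⟨toInt c hc, ?_⟩
  have hfix : (ϖ * d * c ^ 2 - a) / 2 = c := hfix
  have h2 := h.two_ne
  rw [coe_toInt]
  field_simp at hfix
  linear_combination -hfix

theorem IsDatum.exists_eq_mul {x : k} (hx : ‖x‖ < 1) : ∃ y : 𝒪[k], x = ϖ * y := by
  have h0 := h.ne_zero
  refine ⟨toInt (x / ϖ) ?_, ?_⟩
  · rw [norm_div, h.norm_eq]
    have := h.norm_lt_one_iff.1 hx
    rw [div_le_one (inv_pos.2 rq_pos)]
    exact this
  · rw [coe_toInt]; field_simp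

theorem IsDatum.exists_sq {x : k} (hx : ‖x - 1‖ < 1) : ∃ y : k, ‖y‖ ≤ 1 ∧ x = y ^ 2 := by
  obtain ⟨m, hm⟩ := h.exists_eq_mul hx
  -- With $x=1+\varpi m$ and $y=1+\varpi c$, the equation $y^2=x$ becomes $-m+2c+\varpi c^2=0$.
  obtain ⟨c, hc⟩ := h.exists_root (-m) (-1)
  refine ⟨1 + ϖ * c, add_norm_le (by simp) (mul_norm_le_one (norm_coe_le_one _)
    (norm_coe_le_one _)), ?_⟩
  push_cast at hc
  linear_combination hm - (ϖ : k) * hc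

/-- The norm form of the unramified quadratic extension is anisotropic modulo the prime. -/
theorem IsDatum.norm_sq_sub (a b : k) :
    ‖a ^ 2 - u * b ^ 2‖ = max ‖a‖ ‖b‖ ^ 2 := by
  have hsq : ∀ x : k, ‖u * x ^ 2‖ = ‖x‖ ^ 2 := fun x => by
    rw [norm_mul, h.norm_u, one_mul, norm_pow]
  rcases lt_trichotomy ‖a‖ ‖b‖ with hab | hab | hab
  · rw [max_eq_right hab.le, sub_norm_eq_right, hsq]
    rw [hsq, norm_pow]; exact pow_lt_pow_left₀ hab (norm_nonneg _) two_ne_zero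
  · rw [← hab, max_self]
    refine le_antisymm (sub_norm_le (by rw [norm_pow]) (by rw [hsq, ← hab])) ?_
    -- Cancellation would make $u(b/a)^2$ congruent to $1$, hence a square, and then $u$ itself
    -- would be a square.
    by_contra! hlt
    have hb : b ≠ 0 := by
      rintro rfl
      simp only [norm_zero] at hab
      rw [hab] at hlt
      exact absurd hlt (not_lt.2 (by simp))
    have ha : a ≠ 0 := by
      rw [← norm_pos_iff, hab, norm_pos_iff]; exact hb
    obtain ⟨y, -, hy⟩ := h.exists_sq (x := u * (b / a) ^ 2) (by
      have e : u * (b / a) ^ 2 - 1 = - ((a ^ 2 - u * b ^ 2) / a ^ 2) := by field_simp; ring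
      rw [e, norm_neg, norm_div, norm_pow, div_lt_one (by positivity)]
      exact hlt)
    apply h.nonsq
    refine ⟨y * (a / b), ?_⟩
    have : (u : k) = (u * (b / a) ^ 2) * (a / b) ^ 2 := by field_simp
    rw [this, hy]; ring
  · rw [max_eq_left hab.le, sub_norm_eq_left, norm_pow]
    rw [hsq, norm_pow]; exact pow_lt_pow_left₀ hab (norm_nonneg _) two_ne_zero

/-- Every unit is a norm from the unramified quadratic extension. -/
theorem IsDatum.exists_norm_unit {c : k} (hc : ‖c‖ = 1) :
    ∃ a b : 𝒪[k], (a : k) ^ 2 - u * b ^ 2 = c := by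
  -- A solution modulo the maximal ideal suffices: the quotient of $c$ by the approximate norm is
  -- congruent to $1$, hence a square $y^2$, and $y$ is absorbed into $a$ and $b$.
  have key : ∀ (a b : 𝒪[k]), ‖(a : k) ^ 2 - u * b ^ 2 - c‖ < 1 →
      ∃ a b : 𝒪[k], (a : k) ^ 2 - u * b ^ 2 = c := by
    intro a b hab
    have hn : ‖(a : k) ^ 2 - u * b ^ 2‖ = 1 := by
      have : (a : k) ^ 2 - u * b ^ 2 = c + ((a : k) ^ 2 - u * b ^ 2 - c) := by ring
      rw [this, add_norm_eq_left (by rwa [hc]), hc]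
    have hn0 : (a : k) ^ 2 - u * b ^ 2 ≠ 0 := by
      rw [← norm_pos_iff, hn]; exact one_pos
    obtain ⟨y, hy1, hy⟩ := h.exists_sq (x := c / ((a : k) ^ 2 - u * b ^ 2)) (by
      have e : c / ((a : k) ^ 2 - u * b ^ 2) - 1
          = - (((a : k) ^ 2 - u * b ^ 2 - c) / ((a : k) ^ 2 - u * b ^ 2)) := by
        field_simp; ring
      rw [e, norm_neg, norm_div, hn, div_one]; exact hab)
    refine ⟨a * toInt y hy1, b * toInt y hy1, ?_⟩
    push_cast
    rw [coe_toInt]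
    have : c = ((a : k) ^ 2 - u * b ^ 2) * y ^ 2 := by rw [← hy]; field_simp
    rw [this]; ring
  have := Fintype.ofFinite 𝓀[k]
  have hu0 : IsLocalRing.residue 𝒪[k] u ≠ 0 := by
    rw [Ne, IsLocalRing.residue_eq_zero_iff, IsLocalRing.mem_maximalIdeal, mem_nonunits_iff]
    simpa using h.isUnit
  set c' : 𝒪[k] := toInt c hc.le with hc'
  -- Over a finite field of odd order two quadratic polynomials always have values summing to zero;
  -- here they are $X^2$ and $-\bar uX^2-\bar c$.
  open Polynomial in
  obtain ⟨a, b, hab⟩ := FiniteField.exists_root_sum_quadratic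
    (f := (X ^ 2 : 𝓀[k][X])) (g := C (-(IsLocalRing.residue 𝒪[k] u)) * X ^ 2
      + C 0 * X + C (-(IsLocalRing.residue 𝒪[k] c')))
    (by rw [degree_X_pow]; rfl) (degree_quadratic (neg_ne_zero.2 hu0)) (by
      rcases Nat.even_or_odd (Fintype.card 𝓀[k]) with he | ho
      · exfalso
        exact h.odd ((FiniteField.even_card_iff_char_two).2 (Nat.even_iff.1 he))
      · exact Nat.odd_iff.1 ho)
  obtain ⟨a, rfl⟩ := IsLocalRing.residue_surjective a
  obtain ⟨b, rfl⟩ := IsLocalRing.residue_surjective b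
  refine key a b ?_
  have hr : IsLocalRing.residue 𝒪[k] (a ^ 2 - u * b ^ 2 - c') = 0 := by
    simp only [Polynomial.eval_pow, Polynomial.eval_X, Polynomial.eval_add, Polynomial.eval_mul,
      Polynomial.eval_C] at hab
    simp only [map_sub, map_mul, map_pow]
    linear_combination hab
  rw [IsLocalRing.residue_eq_zero_iff, IsLocalRing.mem_maximalIdeal, mem_nonunits_iff,
    isUnit_int_iff] at hr
  have hle := norm_coe_le_one (a ^ 2 - u * b ^ 2 - c')
  have := lt_of_le_of_ne hle hr
  push_cast at this
  exact this

end Datum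

end QuatHerm

/-! ### Reduced norms -/

namespace QuatHerm

open scoped QuadraticAlgebra

section GenericQuaternion

variable {R : Type*} [CommRing R] {a b : R}

/-- The reduced norm of a quaternion. -/
def nr (α : ℍ[R,a,b]) : R := α.re ^ 2 - a * α.imI ^ 2 - b * α.imJ ^ 2 + a * b * α.imK ^ 2

theorem nr_mul (α β : ℍ[R,a,b]) : nr (α * β) = nr α * nr β := by
  simp only [nr, QuaternionAlgebra.re_mul, QuaternionAlgebra.imI_mul,
      QuaternionAlgebra.imJ_mul, QuaternionAlgebra.imK_mul]
  ring

@[simp] theorem nr_star (α : ℍ[R,a,b]) : nr (star α) = nr α := by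
  simp [nr]

@[simp] theorem nr_neg (α : ℍ[R,a,b]) : nr (-α) = nr α := by
  simp [nr]

@[simp] theorem nr_zero : nr (0 : ℍ[R,a,b]) = 0 := by
  simp [nr]

@[simp] theorem nr_one : nr (1 : ℍ[R,a,b]) = 1 := by
  simp [nr]

@[simp] theorem nr_coe (c : R) : nr (c : ℍ[R,a,b]) = c ^ 2 := by
  simp [nr]

theorem mul_star_eq_nr (α : ℍ[R,a,b]) : α * star α = ((nr α : R) : ℍ[R,a,b]) := by
  ext <;> simp <;> (try simp only [nr]) <;> ring

theorem star_mul_eq_nr (α : ℍ[R,a,b]) : star α * α = ((nr α : R) : ℍ[R,a,b]) := by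
  ext <;> simp <;> (try simp only [nr]) <;> ring

/-- The conjugate divided by the reduced norm is a two-sided inverse. -/
theorem isUnit_iff_isUnit_nr (α : ℍ[R,a,b]) : IsUnit α ↔ IsUnit (nr α) := by
  constructor
  · rintro ⟨v, rfl⟩
    refine IsUnit.of_mul_eq_one (nr (↑v⁻¹ : ℍ[R,a,b])) ?_
    rw [← nr_mul, v.mul_inv, nr_one]
  · rintro ⟨v, hv⟩
    refine ⟨⟨α, star α * ((↑v⁻¹ : R) : ℍ[R,a,b]), ?_, ?_⟩, rfl⟩
    · rw [← mul_assoc, mul_star_eq_nr, ← QuaternionAlgebra.coe_mul, ← hv, v.mul_inv,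
        QuaternionAlgebra.coe_one]
    · rw [mul_assoc, QuaternionAlgebra.coe_commutes, ← mul_assoc, star_mul_eq_nr,
        ← QuaternionAlgebra.coe_mul, ← hv, v.mul_inv, QuaternionAlgebra.coe_one]

variable (a b) in
/-- The regular splitting of a quaternion algebra over its quadratic subalgebra. -/
def splitHom : ℍ[R,a,b] →+* Matrix (Fin 2) (Fin 2) (QuadraticAlgebra R a 0) where
  toFun α := !![⟨α.re, α.imI⟩, ⟨b * α.imJ, b * α.imK⟩; ⟨α.imJ, -α.imK⟩, ⟨α.re, -α.imI⟩]
  map_one' := by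
    ext i j <;> fin_cases i <;> fin_cases j <;> simp
  map_zero' := by
    ext i j <;> fin_cases i <;> fin_cases j <;> simp
  map_add' α β := by
    ext i j <;> fin_cases i <;> fin_cases j <;> simp <;> ring
  map_mul' α β := by
    ext i j <;> fin_cases i <;> fin_cases j <;> simp [Matrix.mul_apply, Fin.sum_univ_two] <;> ring

/-- The determinant of a quaternion matrix after splitting. -/
noncomputable def splitDet {m : ℕ} (A : Matrix (Fin m) (Fin m) ℍ[R,a,b]) : QuadraticAlgebra R a 0 :=
  Matrix.det (Matrix.of fun p r : Fin m × Fin 2 => splitHom a b (A p.1 r.1) p.2 r.2)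

/-- Splitting entrywise and then flattening the blocks is a ring homomorphism to matrices over a
commutative ring, where determinants multiply. -/
theorem splitDet_mul {m : ℕ} (A B : Matrix (Fin m) (Fin m) ℍ[R,a,b]) :
    splitDet (A * B) = splitDet A * splitDet B := by
  have key : ∀ A : Matrix (Fin m) (Fin m) ℍ[R,a,b], splitDet A =
      Matrix.det (Matrix.compRingEquiv (Fin m) (Fin 2) (QuadraticAlgebra R a 0)
        ((splitHom a b).mapMatrix A)) := fun A => rfl
  rw [key, key, key, map_mul, map_mul, Matrix.det_mul]

theorem splitDet_hermitian_re (c d : R) (β : ℍ[R,a,b]) :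
    (splitDet (!![(c : ℍ[R,a,b]), β; star β, (d : ℍ[R,a,b])])).re = (c * d - nr β) ^ 2 := by
  rw [splitDet, ← Matrix.det_submatrix_equiv_self (finProdFinEquiv (m := 2) (n := 2)).symm,
    Matrix.det_succ_row_zero]
  simp only [Fin.sum_univ_succ, Matrix.det_succ_row_zero]
  simp [splitHom, finProdFinEquiv, Fin.divNat, Fin.modNat, Fin.succAbove, nr]
  ring_nf
  simp only [QuadraticAlgebra.re_neg, QuadraticAlgebra.re_one]
  ring

theorem splitDet_hermitian_im (c d : R) (β : ℍ[R,a,b]) :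
    (splitDet (!![(c : ℍ[R,a,b]), β; star β, (d : ℍ[R,a,b])])).im = 0 := by
  rw [splitDet, ← Matrix.det_submatrix_equiv_self (finProdFinEquiv (m := 2) (n := 2)).symm,
    Matrix.det_succ_row_zero]
  simp only [Fin.sum_univ_succ, Matrix.det_succ_row_zero]
  simp [splitHom, finProdFinEquiv, Fin.divNat, Fin.modNat, Fin.succAbove]
  ring_nf
  simp only [QuadraticAlgebra.im_neg, QuadraticAlgebra.im_one]
  ring

theorem splitDet_scalar_re (A : Matrix (Fin 1) (Fin 1) ℍ[R,a,b]) (c : R) (hA : A 0 0 = c) :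
    (splitDet A).re = c ^ 2 := by
  rw [splitDet, ← Matrix.det_submatrix_equiv_self (finProdFinEquiv (m := 1) (n := 2)).symm]
  simp only [Nat.reduceMul, Matrix.det_fin_two]
  simp [splitHom, finProdFinEquiv, Fin.divNat, Fin.modNat, hA, Fin.eq_zero]
  ring

end GenericQuaternion

/-! ### The reduced norm as an ultrametric size on the division algebra -/

section Norm

variable {k : Type*} [NontriviallyNormedField k] [IsUltrametricDist k] [ProperSpace k]
variable {u ϖ : 𝒪[k]}

theorem nr_orderIncl (α : MaxOrder u ϖ) : nr (orderIncl u ϖ α) = ((nr α : 𝒪[k]) : k) := by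
  simp [nr, orderIncl]

theorem orderIncl_star (α : MaxOrder u ϖ) : orderIncl u ϖ (star α) = star (orderIncl u ϖ α) := by
  ext <;> simp [orderIncl]

/-- The determinant of an integral matrix is integral in the quadratic algebra over $k$. Taking the
norm down to $k$ turns this into a bound on an absolute value. -/
theorem splitDet_orderIncl_re {m : ℕ} (A : Matrix (Fin m) (Fin m) (MaxOrder u ϖ)) :
    ‖(QuadraticAlgebra.norm (splitDet (A.map (orderIncl u ϖ))) : k)‖ ≤ 1 := by
  let f : QuadraticAlgebra 𝒪[k] u 0 →+* QuadraticAlgebra k (u : k) 0 :=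
    { toFun := fun z => ⟨z.re, z.im⟩
      map_one' := by ext <;> simp
      map_zero' := by ext <;> simp
      map_add' := fun z w => by ext <;> simp
      map_mul' := fun z w => by ext <;> simp }
  have e : splitDet (A.map (orderIncl u ϖ)) = f (splitDet A) := by
    rw [splitDet, splitDet, RingHom.map_det]
    congr 1
    ext p r
    · obtain ⟨p, p'⟩ := p
      obtain ⟨r, r'⟩ := r
      fin_cases p' <;> fin_cases r' <;> simp [splitHom, f, orderIncl]
    · obtain ⟨p, p'⟩ := p
      obtain ⟨r, r'⟩ := r
      fin_cases p' <;> fin_cases r' <;> simp [splitHom, f, orderIncl]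
  have e2 : (QuadraticAlgebra.norm (f (splitDet A)) : k) =
      ((QuadraticAlgebra.norm (splitDet A) : 𝒪[k]) : k) := by
    simp [QuadraticAlgebra.norm_def, f]
  rw [e, e2]
  exact norm_coe_le_one _

theorem nrd_eq_splitDet {m : ℕ} (A : Matrix (Fin m) (Fin m) (Quat u ϖ)) :
    nrd A = (splitDet A).re := rfl

variable (h : IsDatum u ϖ)
include h

/-- The reduced norm is $(a^2-ub^2)-\varpi(c^2-ud^2)$. Both quadratic norms have even order, so the
two summands have orders of different parity and cannot cancel. -/
theorem IsDatum.norm_nr (α : Quat u ϖ) :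
    ‖nr α‖ = max (max ‖α.re‖ ‖α.imI‖ ^ 2) ((rq k)⁻¹ * max ‖α.imJ‖ ‖α.imK‖ ^ 2) := by
  have e : nr α = (α.re ^ 2 - u * α.imI ^ 2) - ϖ * (α.imJ ^ 2 - u * α.imK ^ 2) := by
    rw [nr]; ring
  have e1 := h.norm_sq_sub α.re α.imI
  have e2 : ‖(ϖ : k) * (α.imJ ^ 2 - u * α.imK ^ 2)‖ = (rq k)⁻¹ * max ‖α.imJ‖ ‖α.imK‖ ^ 2 := by
    rw [norm_mul, h.norm_eq, h.norm_sq_sub]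
  have hmax : ∀ x y : k, max ‖x‖ ‖y‖ = 0 ∨ ∃ n : ℤ, max ‖x‖ ‖y‖ = rq k ^ n := by
    intro x y
    rcases max_choice ‖x‖ ‖y‖ with hm | hm <;> rw [hm]
    · rcases eq_or_ne x 0 with rfl | hx
      · left; simp
      · right; exact h.exists_norm_eq hx
    · rcases eq_or_ne y 0 with rfl | hx
      · left; simp
      · right; exact h.exists_norm_eq hx
  by_cases hne : ‖α.re ^ 2 - u * α.imI ^ 2‖ = ‖(ϖ : k) * (α.imJ ^ 2 - u * α.imK ^ 2)‖
  · have hne' := hne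
    rw [e1, e2] at hne
    rcases hmax α.re α.imI with h0 | ⟨m, hm⟩
    · rw [h0] at hne e1
      rw [h0, ← hne, max_self]
      have z1 : α.re ^ 2 - u * α.imI ^ 2 = 0 := by simpa using e1
      rw [z1, norm_zero] at hne'
      have z2 := norm_eq_zero.1 hne'.symm
      rw [e, z1, z2]; simp
    · rcases hmax α.imJ α.imK with h0 | ⟨n, hn⟩
      · rw [h0, hm] at hne
        have : 0 < rq k ^ m := zpow_pos rq_pos m
        exfalso
        have h2 : (rq k ^ m) ^ 2 = 0 := by rw [hne]; ring
        exact this.ne' (pow_eq_zero_iff two_ne_zero |>.1 h2)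
      · rw [hm, hn] at hne
        exfalso
        have : rq k ^ (m * 2) = rq k ^ (-1 + n * 2) := by
          rw [zpow_add₀ rq_pos.ne', zpow_mul, zpow_mul]
          simpa using hne
        have := rq_zpow_inj this
        omega
  · rw [e, sub_eq_add_neg, IsUltrametricDist.norm_add_eq_max_of_norm_ne_norm
      (by rwa [norm_neg]), norm_neg, e1, e2]

theorem IsDatum.norm_nr_le_iff (α : Quat u ϖ) {r : ℝ} (hr : 0 ≤ r) :
    ‖nr α‖ ≤ r ^ 2 ↔ ‖α.re‖ ≤ r ∧ ‖α.imI‖ ≤ r ∧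
      (rq k)⁻¹ * ‖α.imJ‖ ^ 2 ≤ r ^ 2 ∧ (rq k)⁻¹ * ‖α.imK‖ ^ 2 ≤ r ^ 2 := by
  have hq : 0 < (rq k)⁻¹ := inv_pos.2 rq_pos
  have e : ∀ x y : ℝ, 0 ≤ x → 0 ≤ y → max x y ^ 2 = max (x ^ 2) (y ^ 2) := by
    intro x y hx hy
    rcases le_total x y with hxy | hxy
    · rw [max_eq_right hxy, max_eq_right (pow_le_pow_left₀ hx hxy 2)]
    · rw [max_eq_left hxy, max_eq_left (pow_le_pow_left₀ hy hxy 2)]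
  rw [h.norm_nr, max_le_iff, pow_le_pow_iff_left₀ (le_max_of_le_left (norm_nonneg _)) hr two_ne_zero,
    max_le_iff, e _ _ (norm_nonneg _) (norm_nonneg _), mul_max_of_nonneg _ _ hq.le, max_le_iff,
    and_assoc]

/-- Balls for the reduced norm are cut out by conditions on the single coordinates, so they are
closed under addition. -/
theorem IsDatum.nr_add_le {α β : Quat u ϖ} {r : ℝ} (hα : ‖nr α‖ ≤ r) (hβ : ‖nr β‖ ≤ r) :
    ‖nr (α + β)‖ ≤ r := by
  have hr : 0 ≤ r := (norm_nonneg _).trans hα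
  have hq : 0 < (rq k)⁻¹ := inv_pos.2 rq_pos
  rw [← Real.sq_sqrt hr] at hα hβ ⊢
  rw [h.norm_nr_le_iff _ (Real.sqrt_nonneg r)] at hα hβ ⊢
  have key : ∀ x y : k, (rq k)⁻¹ * ‖x‖ ^ 2 ≤ √r ^ 2 → (rq k)⁻¹ * ‖y‖ ^ 2 ≤ √r ^ 2 →
      (rq k)⁻¹ * ‖x + y‖ ^ 2 ≤ √r ^ 2 := by
    intro x y hx hy
    rcases le_total ‖x‖ ‖y‖ with hxy | hxy
    · refine le_trans ?_ hy
      gcongr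
      exact add_norm_le hxy le_rfl
    · refine le_trans ?_ hx
      gcongr
      exact add_norm_le le_rfl hxy
  exact ⟨add_norm_le hα.1 hβ.1, add_norm_le hα.2.1 hβ.2.1, key _ _ hα.2.2.1 hβ.2.2.1,
    key _ _ hα.2.2.2 hβ.2.2.2⟩

theorem IsDatum.exists_orderIncl {α : Quat u ϖ} (hα : ‖nr α‖ ≤ 1) :
    ∃ β : MaxOrder u ϖ, orderIncl u ϖ β = α := by
  have hq : 0 < (rq k)⁻¹ := inv_pos.2 rq_pos
  have h1 := (h.norm_nr_le_iff α zero_le_one).1 (by simpa using hα)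
  have key : ∀ x : k, (rq k)⁻¹ * ‖x‖ ^ 2 ≤ 1 ^ 2 → ‖x‖ ≤ 1 := by
    intro x hx
    -- The hypothesis only gives $|x|\le q^{1/2}$, but this is less than $q$ and the value group is
    -- discrete.
    have hlt : ‖x‖ < rq k ^ (1 : ℤ) := by
      rw [zpow_one]
      have hx2 : ‖x‖ ^ 2 ≤ rq k := by
        rw [inv_mul_le_iff₀ rq_pos] at hx; linarith
      refine lt_of_pow_lt_pow_left₀ 2 rq_pos.le (hx2.trans_lt ?_)
      nlinarith [one_lt_rq (k := k)]
    simpa using (h.lt_zpow_iff 1).1 hlt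
  exact ⟨⟨toInt _ h1.1, toInt _ h1.2.1, toInt _ (key _ h1.2.2.1), toInt _ (key _ h1.2.2.2)⟩, rfl⟩

omit h in
theorem norm_nr_orderIncl_le (α : MaxOrder u ϖ) : ‖nr (orderIncl u ϖ α)‖ ≤ 1 := by
  rw [nr_orderIncl]; exact norm_coe_le_one _

omit h in
theorem isUnit_order_iff {α : MaxOrder u ϖ} : IsUnit α ↔ ‖nr (orderIncl u ϖ α)‖ = 1 := by
  rw [isUnit_iff_isUnit_nr, isUnit_int_iff, nr_orderIncl]

omit h in
theorem not_isUnit_order_iff {α : MaxOrder u ϖ} : ¬ IsUnit α ↔ ‖nr (orderIncl u ϖ α)‖ < 1 := by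
  rw [isUnit_order_iff]
  exact ⟨fun hn => lt_of_le_of_ne (norm_nr_orderIncl_le α) hn, fun hn => hn.ne⟩

/-- Modulo $\Pi$ only the coordinates along $1$ and $\varepsilon$ survive, and there the norm form
is anisotropic. -/
theorem IsDatum.not_isUnit_order_iff' {α : MaxOrder u ϖ} :
    ¬ IsUnit α ↔ ¬ IsUnit α.re ∧ ¬ IsUnit α.imI := by
  have hq : (rq k)⁻¹ < 1 := inv_lt_one_of_one_lt₀ one_lt_rq
  have hlt : ∀ x : 𝒪[k], ‖(x : k)‖ < 1 ↔ ¬ IsUnit x := fun x => by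
    rw [isUnit_int_iff]
    exact ⟨fun hn => hn.ne, fun hn => lt_of_le_of_ne (norm_coe_le_one x) hn⟩
  rw [not_isUnit_order_iff, h.norm_nr, ← hlt, ← hlt]
  change max (max ‖(α.re : k)‖ ‖(α.imI : k)‖ ^ 2)
    ((rq k)⁻¹ * max ‖(α.imJ : k)‖ ‖(α.imK : k)‖ ^ 2) < 1 ↔ _
  rw [max_lt_iff, pow_lt_one_iff_of_nonneg (le_max_of_le_left (norm_nonneg _)) two_ne_zero,
    max_lt_iff]
  refine and_iff_left ?_
  refine lt_of_le_of_lt (mul_le_of_le_one_right (inv_nonneg.2 rq_pos.le) ?_) hq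
  exact pow_le_one₀ (le_max_of_le_left (norm_nonneg _))
    (max_le (norm_coe_le_one _) (norm_coe_le_one _))

theorem IsDatum.exists_unit_nr {c : k} (hc : ‖c‖ = 1) :
    ∃ w : (MaxOrder u ϖ)ˣ, nr (orderIncl u ϖ w) = c := by
  obtain ⟨a, b, hab⟩ := h.exists_norm_unit hc
  have e : nr (orderIncl u ϖ ⟨a, b, 0, 0⟩) = c := by
    rw [← hab]; simp [nr, orderIncl]
  have hu : IsUnit (⟨a, b, 0, 0⟩ : MaxOrder u ϖ) := isUnit_order_iff.2 (by rw [e, hc])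
  exact ⟨hu.unit, e⟩

end Norm
end QuatHerm

/-! ### Coordinates of hermitian forms -/

namespace QuatHerm

variable {k : Type*} [NontriviallyNormedField k] [IsUltrametricDist k] [ProperSpace k]
variable {u ϖ : 𝒪[k]}

/-- The hermitian matrix with diagonal entries `a`, `d` and upper right entry `β`. -/
def hermMat (a d : k) (β : Quat u ϖ) : Matrix (Fin 2) (Fin 2) (Quat u ϖ) :=
  !![(a : Quat u ϖ), β; star β, (d : Quat u ϖ)]

theorem hermMat_mul_adj (a d : k) (β : Quat u ϖ) (c : k) (hc : (a * d - nr β) * c = 1) :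
    hermMat a d β * hermMat (c * d) (c * a) (-(c • β)) = 1 := by
  rw [nr] at hc
  ext i j <;> fin_cases i <;> fin_cases j <;>
    simp [hermMat, Matrix.mul_apply, Fin.sum_univ_two, -mul_eq_zero] <;>
    first | ring1 | linear_combination hc

theorem hermMat_adj_mul (a d : k) (β : Quat u ϖ) (c : k) (hc : (a * d - nr β) * c = 1) :
    hermMat (c * d) (c * a) (-(c • β)) * hermMat a d β = 1 := by
  rw [nr] at hc
  ext i j <;> fin_cases i <;> fin_cases j <;>
    simp [hermMat, Matrix.mul_apply, Fin.sum_univ_two, -mul_eq_zero] <;>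
    first | ring1 | linear_combination hc

theorem star_hermMat (a d : k) (β : Quat u ϖ) : star (hermMat a d β) = hermMat a d β := by
  ext i j <;> fin_cases i <;> fin_cases j <;>
    simp [hermMat, Matrix.star_apply]

namespace HermSpace

/-- The form with prescribed coordinates. -/
def ofCoord (a d : k) (β : Quat u ϖ) (hne : a * d - nr β ≠ 0) : HermSpace u ϖ :=
  ⟨⟨hermMat a d β, hermMat ((a * d - nr β)⁻¹ * d) ((a * d - nr β)⁻¹ * a)
      (-((a * d - nr β)⁻¹ • β)), hermMat_mul_adj _ _ _ _ (mul_inv_cancel₀ hne),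
      hermMat_adj_mul _ _ _ _ (mul_inv_cancel₀ hne)⟩, Units.ext (star_hermMat a d β)⟩

/-- The upper left entry of a form. -/
def fst (x : HermSpace u ϖ) : k := (x.mat 0 0).re
/-- The lower right entry of a form. -/
def snd (x : HermSpace u ϖ) : k := (x.mat 1 1).re
/-- The upper right entry of a form. -/
def off (x : HermSpace u ϖ) : Quat u ϖ := x.mat 0 1
/-- The discriminant `ad - N(β)` of a form. -/
def disc (x : HermSpace u ϖ) : k := x.fst * x.snd - nr x.off

theorem mat_injective : Function.Injective (mat : HermSpace u ϖ → _) := fun _ _ hxy =>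
  Subtype.ext (Units.ext hxy)

@[simp] theorem mat_ofCoord (a d : k) (β : Quat u ϖ) (hne) :
    (ofCoord a d β hne).mat = hermMat a d β := rfl
@[simp] theorem fst_ofCoord (a d : k) (β : Quat u ϖ) (hne) : (ofCoord a d β hne).fst = a := rfl
@[simp] theorem snd_ofCoord (a d : k) (β : Quat u ϖ) (hne) : (ofCoord a d β hne).snd = d := rfl
@[simp] theorem off_ofCoord (a d : k) (β : Quat u ϖ) (hne) : (ofCoord a d β hne).off = β := rfl

theorem star_mat (x : HermSpace u ϖ) : star x.mat = x.mat := congrArg Units.val x.2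

end HermSpace

open HermSpace

variable (h : IsDatum u ϖ)

include h in
theorem IsDatum.mat_eq (x : HermSpace u ϖ) : x.mat = hermMat x.fst x.snd x.off := by
  have key : ∀ i j, star (x.mat j i) = x.mat i j := fun i j => by
    conv_rhs => rw [← star_mat x]
    rfl
  have two := h.two_ne
  -- Since $2$ is invertible, a quaternion fixed by the involution is a scalar; this makes the
  -- diagonal entries lie in $k$.
  have hz : ∀ a : k, -a = a → a = 0 := fun a ha => by
    have : 2 * a = 0 := by linear_combination -ha
    exact (mul_eq_zero.1 this).resolve_left two
  have hdiag : ∀ i, x.mat i i = ((x.mat i i).re : Quat u ϖ) := by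
    intro i
    have hi := key i i
    have e1 := congrArg QuaternionAlgebra.imI hi
    have e2 := congrArg QuaternionAlgebra.imJ hi
    have e3 := congrArg QuaternionAlgebra.imK hi
    simp only [QuaternionAlgebra.imI_star, QuaternionAlgebra.imJ_star,
      QuaternionAlgebra.imK_star] at e1 e2 e3
    ext
    · rfl
    · exact hz _ e1
    · exact hz _ e2
    · exact hz _ e3
  refine Matrix.ext fun i j => ?_
  fin_cases i <;> fin_cases j
  · exact hdiag 0
  · rfl
  · exact (key 1 0).symm
  · exact hdiag 1

include h in
theorem IsDatum.herm_ext {x y : HermSpace u ϖ} (h1 : x.fst = y.fst) (h2 : x.snd = y.snd)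
    (h3 : x.off = y.off) : x = y := by
  apply mat_injective
  rw [h.mat_eq x, h.mat_eq y, h1, h2, h3]

theorem QuadraticAlgebra_eq_coe {R : Type*} [CommRing R] {a : R} {z : QuadraticAlgebra R a 0}
    {c : R} (h1 : z.re = c) (h2 : z.im = 0) : (QuadraticAlgebra.norm z : R) = c ^ 2 := by
  rw [QuadraticAlgebra.norm_def, h1, h2]; ring

include h in
-- The split determinant is the square of the discriminant and lies in $k$, so its quadratic norm
-- squares it once more.
theorem IsDatum.norm_splitDet_mat (x : HermSpace u ϖ) :
    (QuadraticAlgebra.norm (splitDet x.mat) : k) = x.disc ^ 4 := by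
  rw [h.mat_eq x]
  rw [hermMat, QuadraticAlgebra_eq_coe (splitDet_hermitian_re _ _ _) (splitDet_hermitian_im _ _ _), disc]
  ring

theorem splitDet_one {R : Type*} [CommRing R] {a b : R} {m : ℕ} :
    splitDet (1 : Matrix (Fin m) (Fin m) ℍ[R,a,b]) = 1 := by
  have key : splitDet (1 : Matrix (Fin m) (Fin m) ℍ[R,a,b]) =
      Matrix.det (Matrix.compRingEquiv (Fin m) (Fin 2) (QuadraticAlgebra R a 0)
        ((splitHom a b).mapMatrix 1)) := rfl
  rw [key, map_one, map_one, Matrix.det_one]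

include h in
theorem IsDatum.disc_ne_zero (x : HermSpace u ϖ) : x.disc ≠ 0 := by
  intro h0
  have e : x.mat * (x.1⁻¹ : GLD u ϖ).val = 1 := x.1.mul_inv
  have e2 := congrArg (fun A => (QuadraticAlgebra.norm (splitDet A) : k)) e
  simp only [splitDet_mul, map_mul, splitDet_one, map_one, h.norm_splitDet_mat, h0] at e2
  simp at e2

include h in
theorem IsDatum.nrd_mat (x : HermSpace u ϖ) : nrd x.mat = x.disc ^ 2 := by
  rw [nrd_eq_splitDet, h.mat_eq x]
  exact splitDet_hermitian_re _ _ _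

include h in
theorem IsDatum.absInv_zero (x : HermSpace u ϖ) : absInv x 0 = ‖x.fst‖ := by
  rw [absInv, nrd_eq_splitDet, splitDet_scalar_re _ x.fst, norm_pow,
    Real.sqrt_sq (norm_nonneg _)]
  rw [h.mat_eq x]; rfl

include h in
theorem IsDatum.absInv_one (x : HermSpace u ϖ) : absInv x 1 = ‖x.disc‖ := by
  have e : x.mat.submatrix (Fin.castLE (1 : Fin 2).isLt) (Fin.castLE (1 : Fin 2).isLt) = x.mat := by
    rfl
  rw [absInv]
  have := h.nrd_mat x
  rw [← e] at this
  rw [this, norm_pow, Real.sqrt_sq (norm_nonneg _)]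

include h in
theorem IsDatum.inv_coord (x : HermSpace u ϖ) :
    (x⁻¹).fst = x.disc⁻¹ * x.snd ∧ (x⁻¹).snd = x.disc⁻¹ * x.fst ∧
      (x⁻¹).off = -(x.disc⁻¹ • x.off) := by
  have e : (x⁻¹).mat = hermMat (x.disc⁻¹ * x.snd) (x.disc⁻¹ * x.fst) (-(x.disc⁻¹ • x.off)) := by
    have e1 : (x⁻¹).mat * x.mat = 1 := x.1.inv_mul
    have e2 := hermMat_mul_adj x.fst x.snd x.off x.disc⁻¹ (mul_inv_cancel₀ (h.disc_ne_zero x))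
    rw [← h.mat_eq x] at e2
    exact left_inv_eq_right_inv e1 e2
  refine ⟨?_, ?_, ?_⟩
  · rw [fst, e]; rfl
  · rw [snd, e]; rfl
  · rw [off, e]; rfl

/-! ### The action of the maximal compact subgroup -/

/-- The matrix over `D` of an element of `K`. -/
noncomputable def GLO.toMat (κ : GLO u ϖ) : Matrix (Fin 2) (Fin 2) (Quat u ϖ) :=
  (Units.val (α := Matrix (Fin 2) (Fin 2) (MaxOrder u ϖ)) κ).map (orderIncl u ϖ)

theorem mat_actK (κ : GLO u ϖ) (x : HermSpace u ϖ) :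
    (actK κ x).mat = κ.toMat * x.mat * star κ.toMat := rfl

theorem actK_mul (κ κ' : GLO u ϖ) (x : HermSpace u ϖ) :
    actK (κ * κ') x = actK κ (actK κ' x) := by
  apply Subtype.ext
  simp only [actK, act, map_mul, star_mul, mul_assoc]

theorem actK_one (x : HermSpace u ϖ) : actK 1 x = x := by
  apply Subtype.ext
  simp only [actK, act, map_one, star_one, mul_one, one_mul]

theorem actK_inv_actK (κ : GLO u ϖ) (x : HermSpace u ϖ) : actK κ⁻¹ (actK κ x) = x := by
  rw [← actK_mul, inv_mul_cancel, actK_one]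

/-- The value of a form at a row vector. -/
def HermSpace.value (x : HermSpace u ϖ) (v w : Quat u ϖ) : k :=
  x.fst * nr v + x.snd * nr w + 2 * (v * x.off * star w).re

include h in
-- The new upper left entry involves only the first row of $\kappa$; averaging $|d_1|$ thus becomes
-- an average over row vectors.
theorem IsDatum.actK_coord (κ : GLO u ϖ) (x : HermSpace u ϖ) :
    (actK κ x).fst = x.value (κ.toMat 0 0) (κ.toMat 0 1) ∧
    (actK κ x).snd = x.value (κ.toMat 1 0) (κ.toMat 1 1) ∧
    (actK κ x).off = x.fst • (κ.toMat 0 0 * star (κ.toMat 1 0)) +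
      x.snd • (κ.toMat 0 1 * star (κ.toMat 1 1)) + κ.toMat 0 0 * x.off * star (κ.toMat 1 1) +
      κ.toMat 0 1 * star x.off * star (κ.toMat 1 0) := by
  have e := mat_actK κ x
  rw [h.mat_eq x] at e
  refine ⟨?_, ?_, ?_⟩
  · rw [fst, e]
    simp [Matrix.mul_apply, Fin.sum_univ_two, hermMat, value, nr, Matrix.star_apply]
    ring
  · rw [snd, e]
    simp [Matrix.mul_apply, Fin.sum_univ_two, hermMat, value, nr, Matrix.star_apply]
    ring
  · rw [off, e]
    simp only [Matrix.mul_apply, Fin.sum_univ_two, hermMat, Matrix.star_apply, Matrix.of_apply,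
      Matrix.cons_val', Matrix.cons_val_zero, Matrix.cons_val_one, Matrix.cons_val_fin_one,
      ← QuaternionAlgebra.coe_commutes, add_mul, QuaternionAlgebra.coe_mul_eq_smul, smul_mul_assoc]
    abel

end QuatHerm

/-! ### Orbits and their invariants -/

namespace QuatHerm

variable {k : Type*} [NontriviallyNormedField k] [IsUltrametricDist k] [ProperSpace k]
variable {u ϖ : 𝒪[k]}

open HermSpace

/-- The size of a form: the maximal absolute value of the norms of its entries. -/
noncomputable def HermSpace.size (x : HermSpace u ϖ) : ℝ :=
  max (max (‖x.fst‖ ^ 2) (‖x.snd‖ ^ 2)) ‖nr x.off‖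

theorem splitDet_star_toMat_le (κ : GLO u ϖ) :
    ‖(QuadraticAlgebra.norm (splitDet κ.toMat) : k)‖ ≤ 1 ∧
      ‖(QuadraticAlgebra.norm (splitDet (star κ.toMat)) : k)‖ ≤ 1 := by
  constructor
  · exact splitDet_orderIncl_re _
  · have e : star κ.toMat =
        (star (Units.val (α := Matrix (Fin 2) (Fin 2) (MaxOrder u ϖ)) κ)).map (orderIncl u ϖ) := by
      ext1 i j
      simp only [GLO.toMat, Matrix.star_apply, Matrix.map_apply, orderIncl_star]
    rw [e]
    exact splitDet_orderIncl_re _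

theorem toMat_mem (κ : GLO u ϖ) (i j : Fin 2) : ‖nr (κ.toMat i j)‖ ≤ 1 := by
  rw [GLO.toMat, Matrix.map_apply]; exact norm_nr_orderIncl_le _

variable (h : IsDatum u ϖ)
include h

/-- Integrality of the determinant of $\kappa$ and of its conjugate transpose gives one inequality;
applied to $\kappa^{-1}$ it gives the other. -/
theorem IsDatum.norm_disc_actK (κ : GLO u ϖ) (x : HermSpace u ϖ) :
    ‖(actK κ x).disc‖ = ‖x.disc‖ := by
  have key : ∀ (κ : GLO u ϖ) (x : HermSpace u ϖ), ‖(actK κ x).disc‖ ≤ ‖x.disc‖ := by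
    intro κ x
    have e := h.norm_splitDet_mat (actK κ x)
    rw [mat_actK, splitDet_mul, splitDet_mul, map_mul, map_mul, h.norm_splitDet_mat] at e
    obtain ⟨h1, h2⟩ := splitDet_star_toMat_le κ
    have e2 := congrArg norm e
    rw [norm_mul, norm_mul, norm_pow, norm_pow] at e2
    refine le_of_pow_le_pow_left₀ (n := 4) (by norm_num) (norm_nonneg _) ?_
    rw [← e2]
    calc _ ≤ 1 * ‖x.disc‖ ^ 4 * 1 := by gcongr
      _ = _ := by ring
  refine le_antisymm (key κ x) ?_
  have := key κ⁻¹ (actK κ x)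
  rwa [actK_inv_actK] at this

/-- The entries of $\kappa$ have reduced norm at most one, so the ultrametric inequality prevents
the size from growing; $\kappa^{-1}$ gives the reverse bound. -/
theorem IsDatum.size_actK (κ : GLO u ϖ) (x : HermSpace u ϖ) : (actK κ x).size = x.size := by
  have key : ∀ (κ : GLO u ϖ) (x : HermSpace u ϖ), (actK κ x).size ≤ x.size := by
    intro κ x
    have hx : ∀ i j, ‖nr (x.mat i j)‖ ≤ x.size := by
      intro i j
      rw [h.mat_eq x, size]
      fin_cases i <;> fin_cases j <;> simp [hermMat]
    have hm : ∀ {α β : Quat u ϖ} {r : ℝ}, ‖nr α‖ ≤ r → ‖nr β‖ ≤ 1 → ‖nr (α * β)‖ ≤ r := by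
      intro α β r h1 h2
      rw [nr_mul, norm_mul]
      exact (mul_le_of_le_one_right (norm_nonneg _) h2).trans h1
    have hm' : ∀ {α β : Quat u ϖ} {r : ℝ}, ‖nr α‖ ≤ 1 → ‖nr β‖ ≤ r → ‖nr (α * β)‖ ≤ r := by
      intro α β r h1 h2
      rw [nr_mul, norm_mul]
      exact (mul_le_of_le_one_left (norm_nonneg _) h1).trans h2
    have hy : ∀ i j, ‖nr ((actK κ x).mat i j)‖ ≤ x.size := by
      intro i j
      rw [mat_actK]
      simp only [Matrix.mul_apply, Fin.sum_univ_two, Matrix.star_apply]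
      have hs : ∀ i j, ‖nr (star (κ.toMat i j))‖ ≤ 1 := fun i j => by
        rw [nr_star]; exact toMat_mem κ i j
      have hk := toMat_mem κ
      exact h.nr_add_le
        (hm (h.nr_add_le (hm' (hk _ _) (hx _ _)) (hm' (hk _ _) (hx _ _))) (hs _ _))
        (hm (h.nr_add_le (hm' (hk _ _) (hx _ _)) (hm' (hk _ _) (hx _ _))) (hs _ _))
    rw [size]
    have h00 := hy 0 0
    have h11 := hy 1 1
    have h01 := hy 0 1
    rw [h.mat_eq (actK κ x)] at h00 h11 h01
    refine max_le (max_le ?_ ?_) ?_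
    · simpa [hermMat] using h00
    · simpa [hermMat] using h11
    · simpa [hermMat] using h01
  refine le_antisymm (key κ x) ?_
  have := key κ⁻¹ (actK κ x)
  rwa [actK_inv_actK] at this

/-! ### Elementary moves within an orbit -/

omit h

/-- Two forms are equivalent when they lie in the same orbit of `K`. -/
def KEquiv (x y : HermSpace u ϖ) : Prop := ∃ κ : GLO u ϖ, actK κ x = y

theorem KEquiv.symm {x y : HermSpace u ϖ} (hxy : KEquiv x y) : KEquiv y x := by
  obtain ⟨κ, rfl⟩ := hxy
  exact ⟨κ⁻¹, actK_inv_actK κ x⟩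

theorem KEquiv.trans {x y z : HermSpace u ϖ} (hxy : KEquiv x y) (hyz : KEquiv y z) :
    KEquiv x z := by
  obtain ⟨κ, rfl⟩ := hxy
  obtain ⟨κ', rfl⟩ := hyz
  exact ⟨κ' * κ, actK_mul _ _ _⟩

/-- The element of `K` exchanging the two basis vectors. -/
noncomputable def swapK (u ϖ : 𝒪[k]) : GLO u ϖ :=
  (⟨!![0, 1; 1, 0], !![0, 1; 1, 0], by simp [Matrix.one_fin_two], by simp [Matrix.one_fin_two]⟩ :
    (Matrix (Fin 2) (Fin 2) (MaxOrder u ϖ))ˣ)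

/-- A lower unipotent element of `K`. -/
noncomputable def shearK (t : MaxOrder u ϖ) : GLO u ϖ :=
  (⟨!![1, 0; t, 1], !![1, 0; -t, 1], by simp [Matrix.one_fin_two], by simp [Matrix.one_fin_two]⟩ :
    (Matrix (Fin 2) (Fin 2) (MaxOrder u ϖ))ˣ)

/-- A diagonal element of `K`. -/
noncomputable def diagK (v w : (MaxOrder u ϖ)ˣ) : GLO u ϖ :=
  (⟨!![(v : MaxOrder u ϖ), 0; 0, (w : MaxOrder u ϖ)],
    !![((v⁻¹ : (MaxOrder u ϖ)ˣ) : MaxOrder u ϖ), 0; 0, ((w⁻¹ : (MaxOrder u ϖ)ˣ) : MaxOrder u ϖ)],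
    by simp [Matrix.one_fin_two], by simp [Matrix.one_fin_two]⟩ :
    (Matrix (Fin 2) (Fin 2) (MaxOrder u ϖ))ˣ)

theorem toMat_swapK : (swapK u ϖ).toMat = !![0, 1; 1, 0] := by
  ext1 i j; fin_cases i <;> fin_cases j <;> simp [GLO.toMat, swapK]

theorem toMat_shearK (t : MaxOrder u ϖ) : (shearK t).toMat = !![1, 0; orderIncl u ϖ t, 1] := by
  ext1 i j; fin_cases i <;> fin_cases j <;> simp [GLO.toMat, shearK]

theorem toMat_diagK (v w : (MaxOrder u ϖ)ˣ) :
    (diagK v w).toMat = !![orderIncl u ϖ v, 0; 0, orderIncl u ϖ w] := by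
  ext1 i j; fin_cases i <;> fin_cases j <;> simp [GLO.toMat, diagK]

include h

theorem IsDatum.equiv_swap (x : HermSpace u ϖ) : ∃ y, KEquiv x y ∧ y.fst = x.snd ∧
    y.snd = x.fst ∧ y.off = star x.off := by
  refine ⟨_, ⟨swapK u ϖ, rfl⟩, ?_⟩
  obtain ⟨h1, h2, h3⟩ := h.actK_coord (swapK u ϖ) x
  rw [h1, h2, h3, toMat_swapK]
  simp [value]

theorem IsDatum.equiv_shear (x : HermSpace u ϖ) {t : Quat u ϖ} (ht : ‖nr t‖ ≤ 1) :
    ∃ y, KEquiv x y ∧ y.fst = x.fst ∧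
      y.snd = x.snd + x.fst * nr t + 2 * (t * x.off).re ∧ y.off = x.fst • star t + x.off := by
  obtain ⟨t, rfl⟩ := h.exists_orderIncl ht
  refine ⟨_, ⟨shearK t, rfl⟩, ?_⟩
  obtain ⟨h1, h2, h3⟩ := h.actK_coord (shearK t) x
  rw [h1, h2, h3, toMat_shearK]
  refine ⟨?_, ?_, ?_⟩
  · simp [value]
  · simp [value]; ring
  · simp

theorem IsDatum.equiv_diag (x : HermSpace u ϖ) {v w : Quat u ϖ} (hv : ‖nr v‖ = 1)
    (hw : ‖nr w‖ = 1) :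
    ∃ y, KEquiv x y ∧ y.fst = x.fst * nr v ∧ y.snd = x.snd * nr w ∧
      y.off = v * x.off * star w := by
  obtain ⟨v, rfl⟩ := h.exists_orderIncl hv.le
  obtain ⟨w, rfl⟩ := h.exists_orderIncl hw.le
  refine ⟨_, ⟨diagK (isUnit_order_iff.2 hv).unit (isUnit_order_iff.2 hw).unit, rfl⟩, ?_⟩
  obtain ⟨h1, h2, h3⟩ := h.actK_coord
    (diagK (isUnit_order_iff.2 hv).unit (isUnit_order_iff.2 hw).unit) x
  rw [h1, h2, h3, toMat_diagK]
  refine ⟨?_, ?_, ?_⟩ <;> simp [value]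

/-! ### Representatives of the orbits -/

omit h in
/-- The index set of the orbits of `K` on `X`. -/
inductive OrbitIndex : Type
  | diag (i : ℤ) (n : ℕ)
  | anti (e : ℤ)

namespace OrbitIndex

omit h

/-- The order of the discriminant. -/
def ordDisc : OrbitIndex → ℤ
  | diag i n => 2 * i + n
  | anti e => 2 * e + 1

/-- The order of the size. -/
def ordSize : OrbitIndex → ℤ
  | diag i _ => 2 * i
  | anti e => 2 * e + 1

/-- The parity of the size order separates the two families. -/
theorem ord_injective {σ τ : OrbitIndex} (h1 : σ.ordDisc = τ.ordDisc)
    (h2 : σ.ordSize = τ.ordSize) : σ = τ := by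
  cases σ <;> cases τ <;> simp only [ordDisc, ordSize] at h1 h2
  · congr 1 <;> omega
  · omega
  · omega
  · congr 1; omega

end OrbitIndex

omit h in
/-- The uniformizer of `D`, multiplied by a power of the uniformizer of `k`. -/
def antiEntry (u ϖ : 𝒪[k]) (e : ℤ) : Quat u ϖ := ⟨0, 0, (ϖ : k) ^ e, 0⟩

omit h in
theorem nr_antiEntry (e : ℤ) : nr (antiEntry u ϖ e) = -ϖ * (ϖ ^ e) ^ 2 := by
  simp [nr, antiEntry]

/-- The standard representatives of the orbits of `K`. -/
def IsDatum.rep : OrbitIndex → HermSpace u ϖ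
  | .diag i n => ofCoord (ϖ ^ i) (ϖ ^ (i + n)) 0 (by
      have := h.ne_zero
      simp only [nr_zero, sub_zero]
      exact mul_ne_zero (zpow_ne_zero _ this) (zpow_ne_zero _ this))
  | .anti e => ofCoord 0 0 (antiEntry u ϖ e) (by
      have := h.ne_zero
      rw [nr_antiEntry]
      simp only [mul_zero, zero_sub, neg_mul, neg_neg]
      exact mul_ne_zero this (pow_ne_zero _ (zpow_ne_zero _ this)))

theorem IsDatum.norm_nr_antiEntry (e : ℤ) : ‖nr (antiEntry u ϖ e)‖ = rq k ^ (-(2 * e + 1)) := by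
  rw [nr_antiEntry, norm_mul, norm_neg, norm_pow, h.norm_zpow, h.norm_eq, ← zpow_natCast,
    ← zpow_mul, ← zpow_neg_one, ← zpow_add₀ rq_pos.ne']
  congr 1
  push_cast; ring

theorem IsDatum.norm_disc_rep (τ : OrbitIndex) : ‖(h.rep τ).disc‖ = rq k ^ (-τ.ordDisc) := by
  cases τ with
  | diag i n =>
    simp only [rep, disc, fst_ofCoord, snd_ofCoord, off_ofCoord, nr_zero, sub_zero, norm_mul,
      h.norm_zpow, OrbitIndex.ordDisc]
    rw [← zpow_add₀ rq_pos.ne']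
    congr 1; ring
  | anti e =>
    simp only [rep, disc, fst_ofCoord, snd_ofCoord, off_ofCoord, mul_zero, zero_sub, norm_neg,
      h.norm_nr_antiEntry, OrbitIndex.ordDisc]

theorem IsDatum.size_rep (τ : OrbitIndex) : (h.rep τ).size = rq k ^ (-τ.ordSize) := by
  cases τ with
  | diag i n =>
    have e : ∀ i : ℤ, (rq k ^ (-i)) ^ 2 = rq k ^ (-(2 * i)) := fun i => by
      rw [← zpow_natCast, ← zpow_mul]; congr 1; push_cast; ring
    simp only [rep, size, fst_ofCoord, snd_ofCoord, off_ofCoord, nr_zero, norm_zero,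
      h.norm_zpow, OrbitIndex.ordSize, e]
    rw [max_eq_left (le_max_of_le_left (zpow_pos rq_pos _).le), max_eq_left]
    exact zpow_le_zpow_right₀ one_lt_rq.le (by omega)
  | anti e =>
    simp only [rep, size, fst_ofCoord, snd_ofCoord, off_ofCoord, norm_zero,
      h.norm_nr_antiEntry, OrbitIndex.ordSize]
    have := zpow_pos (rq_pos (k := k)) (-(2 * e + 1))
    rw [max_eq_right]
    simpa using this.le

end QuatHerm

/-! ### Classification of the orbits -/

namespace QuatHerm

variable {k : Type*} [NontriviallyNormedField k] [IsUltrametricDist k] [ProperSpace k]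
variable {u ϖ : 𝒪[k]}

open HermSpace

theorem nr_smul {R : Type*} [CommRing R] {a b : R} (c : R) (α : ℍ[R,a,b]) :
    nr (c • α) = c ^ 2 * nr α := by
  simp only [nr, QuaternionAlgebra.re_smul, QuaternionAlgebra.imI_smul,
    QuaternionAlgebra.imJ_smul, QuaternionAlgebra.imK_smul, smul_eq_mul]
  ring

variable (h : IsDatum u ϖ)
include h

/-- Every unit of $\mathfrak o$ is the reduced norm of a unit of the order, so a diagonal move can
turn a diagonal entry into a power of the uniformizer. -/
theorem IsDatum.exists_unit_scaling {c : k} (hc : c ≠ 0) :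
    ∃ (i : ℤ) (w : Quat u ϖ), ‖nr w‖ = 1 ∧ c * nr w = ϖ ^ i := by
  obtain ⟨i, hi⟩ := h.exists_norm_eq hc
  have hn : ‖(ϖ : k) ^ (-i) / c‖ = 1 := by
    rw [norm_div, h.norm_zpow, hi, neg_neg, div_self (zpow_ne_zero _ rq_pos.ne')]
  obtain ⟨w, hw⟩ := h.exists_unit_nr hn
  exact ⟨-i, orderIncl u ϖ w, by rw [hw, hn], by rw [hw]; field_simp⟩

theorem IsDatum.exists_rep_of_off_eq_zero (x : HermSpace u ϖ) (hx : x.off = 0) :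
    ∃ τ, KEquiv x (h.rep τ) := by
  have hd := h.disc_ne_zero x
  simp only [disc, hx, nr_zero, sub_zero] at hd
  obtain ⟨i, v, hv, hvi⟩ := h.exists_unit_scaling (left_ne_zero_of_mul hd)
  obtain ⟨j, w, hw, hwj⟩ := h.exists_unit_scaling (right_ne_zero_of_mul hd)
  obtain ⟨y, hxy, h1, h2, h3⟩ := h.equiv_diag x hv hw
  rw [hx, mul_zero, zero_mul] at h3
  rcases le_total i j with hij | hij
  · refine ⟨.diag i (j - i).toNat, ?_⟩
    convert hxy
    refine h.herm_ext ?_ ?_ ?_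
    · simp [rep, h1, hvi]
    · simp [rep, h2, hwj, hij]
    · simp [rep, h3]
  · refine ⟨.diag j (i - j).toNat, ?_⟩
    obtain ⟨z, hyz, h1', h2', h3'⟩ := h.equiv_swap y
    convert hxy.trans hyz
    refine h.herm_ext ?_ ?_ ?_
    · simp [rep, h1', h2, hwj]
    · simp [rep, h2', h1, hvi, hij]
    · simp [rep, h3', h3]

/-- Completing the square diagonalizes the form. The required shear by $-a^{-1}\beta^*$ is integral
exactly when the upper left entry dominates. -/
theorem IsDatum.exists_rep_of_le_fst (x : HermSpace u ϖ) (hx : ‖nr x.off‖ ≤ ‖x.fst‖ ^ 2) :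
    ∃ τ, KEquiv x (h.rep τ) := by
  have hf : x.fst ≠ 0 := by
    intro h0
    apply h.disc_ne_zero x
    rw [h0, norm_zero, zero_pow two_ne_zero] at hx
    rw [disc, h0, norm_le_zero_iff.1 hx]; simp
  obtain ⟨y, hxy, h1, h2, h3⟩ := h.equiv_shear x (t := -(x.fst⁻¹ • star x.off)) (by
    rw [nr_neg, nr_smul, nr_star, norm_mul, norm_pow, norm_inv, inv_pow,
      inv_mul_le_one₀ (by positivity)]
    exact hx)
  obtain ⟨τ, hτ⟩ := h.exists_rep_of_off_eq_zero y (by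
    rw [h3, star_neg, QuaternionAlgebra.star_smul, star_star, smul_neg, smul_smul]
    simp [hf])
  exact ⟨τ, hxy.trans hτ⟩

theorem IsDatum.exists_rep_of_le_snd (x : HermSpace u ϖ) (hx : ‖nr x.off‖ ≤ ‖x.snd‖ ^ 2) :
    ∃ τ, KEquiv x (h.rep τ) := by
  obtain ⟨y, hxy, h1, h2, h3⟩ := h.equiv_swap x
  obtain ⟨τ, hτ⟩ := h.exists_rep_of_le_fst y (by rwa [h1, h3, nr_star])
  exact ⟨τ, hxy.trans hτ⟩

theorem IsDatum.lt_of_sq_lt {c : k} {e : ℤ} (hc : ‖c‖ ^ 2 < rq k ^ (2 * e)) :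
    ‖c‖ < rq k ^ e := by
  rw [mul_comm, zpow_mul, zpow_ofNat] at hc
  exact lt_of_pow_lt_pow_left₀ 2 (zpow_pos rq_pos _).le hc

/-- When the dominating entry $\beta$ has norm of even order, a shear by a scalar multiple $t$ of
$\beta^*$ with $|N(t)|=1$ and $t\beta=\varpi^{-i}$ adds $2\varpi^{-i}$ to the lower right entry,
which then dominates. -/
theorem IsDatum.exists_rep_even (x : HermSpace u ϖ) {i : ℤ} (hi : ‖nr x.off‖ = rq k ^ (2 * i))
    (h1 : ‖x.fst‖ ^ 2 < ‖nr x.off‖) (h2 : ‖x.snd‖ ^ 2 < ‖nr x.off‖) :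
    ∃ τ, KEquiv x (h.rep τ) := by
  have hn0 : nr x.off ≠ 0 := by
    rw [← norm_pos_iff, hi]; exact zpow_pos rq_pos _
  have e2 : rq k ^ (2 * i) = (rq k ^ i) ^ 2 := by rw [mul_comm, zpow_mul, zpow_ofNat]
  have hc : ‖(ϖ : k) ^ (-i) * (nr x.off)⁻¹‖ = rq k ^ i * (rq k ^ (2 * i))⁻¹ := by
    rw [norm_mul, h.norm_zpow, neg_neg, norm_inv, hi]
  have ht : ‖nr (((ϖ : k) ^ (-i) * (nr x.off)⁻¹) • star x.off)‖ = 1 := by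
    rw [nr_smul, nr_star, norm_mul, norm_pow, hc, hi, e2]
    have := (zpow_pos (rq_pos (k := k)) i).ne'
    field_simp
  obtain ⟨y, hxy, h1', h2', h3'⟩ := h.equiv_shear x ht.le
  have hre : ((((ϖ : k) ^ (-i) * (nr x.off)⁻¹) • star x.off) * x.off).re = ϖ ^ (-i) := by
    rw [smul_mul_assoc, star_mul_eq_nr, QuaternionAlgebra.re_smul, QuaternionAlgebra.re_coe,
      smul_eq_mul]
    field_simp
  rw [hre] at h2'
  rw [hi] at h1 h2
  have l1 := h.lt_of_sq_lt h1
  have l2 := h.lt_of_sq_lt h2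
  have hn : ‖y.snd‖ = rq k ^ i := by
    have : ‖(2 : k) * ϖ ^ (-i)‖ = rq k ^ i := by
      rw [norm_mul, h.two, one_mul, h.norm_zpow, neg_neg]
    rw [h2', add_comm, add_norm_eq_left, this]
    rw [this]
    exact add_norm_lt l2 (by rw [norm_mul, ht, mul_one]; exact l1)
  obtain ⟨τ, hτ⟩ := h.exists_rep_of_le_snd y (by
    rw [hn, h3', ← e2]
    refine h.nr_add_le ?_ hi.le
    rw [nr_smul, nr_star, norm_mul, ht, mul_one, norm_pow]
    exact h1.le)
  exact ⟨τ, hxy.trans hτ⟩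

theorem IsDatum.exists_normalize_off (x : HermSpace u ϖ) {e : ℤ}
    (hi : ‖nr x.off‖ = rq k ^ (-(2 * e + 1))) :
    ∃ y, KEquiv x y ∧ ‖y.fst‖ = ‖x.fst‖ ∧ y.snd = x.snd ∧ y.off = antiEntry u ϖ e := by
  have hn0 : nr x.off ≠ 0 := by
    rw [← norm_pos_iff, hi]; exact zpow_pos rq_pos _
  -- This element is `antiEntry` times the inverse of `x.off`.
  have hv : ‖nr ((nr x.off)⁻¹ • (antiEntry u ϖ e * star x.off))‖ = 1 := by
    rw [nr_smul, nr_mul, nr_star, norm_mul, norm_mul, norm_pow, norm_inv, h.norm_nr_antiEntry, hi]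
    have := (zpow_pos (rq_pos (k := k)) (-(2 * e + 1))).ne'
    field_simp
  obtain ⟨y, hxy, h1, h2, h3⟩ := h.equiv_diag x hv (w := 1) (by simp)
  refine ⟨y, hxy, by rw [h1, norm_mul, hv, mul_one], by rw [h2]; simp, ?_⟩
  rw [h3, star_one, mul_one, smul_mul_assoc, mul_assoc, star_mul_eq_nr,
    ← QuaternionAlgebra.coe_commutes, QuaternionAlgebra.coe_mul_eq_smul, smul_smul,
    inv_mul_cancel₀ hn0, one_smul]

/-- Once the off-diagonal entry is $\varpi^e\Pi$, the diagonal entries are $\varpi^{e+1}a$ and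
$\varpi^{e+1}d$ up to this common power. A shear by $c\Pi$ replaces $d$ by $d+2c-\varpi ac^2$, and
`exists_root` makes this vanish. -/
theorem IsDatum.exists_kill_snd (x : HermSpace u ϖ) {e : ℤ}
    (hi : ‖nr x.off‖ = rq k ^ (-(2 * e + 1)))
    (h1 : ‖x.fst‖ ^ 2 < ‖nr x.off‖) (h2 : ‖x.snd‖ ^ 2 < ‖nr x.off‖) :
    ∃ y, KEquiv x y ∧ ‖y.fst‖ = ‖x.fst‖ ∧ y.snd = 0 ∧ ‖nr y.off‖ = ‖nr x.off‖ := by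
  obtain ⟨y, hxy, hy1, hy2, hy3⟩ := h.exists_normalize_off x hi
  have hw0 := h.ne_zero
  -- From $|c|^2<q^{-(2e+1)}$ one gets $|c|<q^{-e}$, and discreteness then supplies one further
  -- factor $\varpi$.
  have small : ∀ c : k, ‖c‖ ^ 2 < ‖nr x.off‖ → ∃ c' : 𝒪[k], c = ϖ ^ (e + 1) * c' := by
    intro c hc
    have : ‖c‖ < rq k ^ (-e) := by
      refine h.lt_of_sq_lt (hc.trans ?_)
      rw [hi]
      exact zpow_lt_zpow_right₀ one_lt_rq (by omega)
    obtain ⟨m, hm⟩ := h.exists_eq_mul (x := c * ϖ ^ (-e)) (by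
      rw [norm_mul, h.norm_zpow, neg_neg]
      rw [zpow_neg, ← one_div, lt_div_iff₀ (zpow_pos rq_pos _)] at this
      exact this)
    refine ⟨m, ?_⟩
    rw [zpow_add_one₀ hw0]
    rw [zpow_neg] at hm
    field_simp at hm
    linear_combination hm
  obtain ⟨a, ha⟩ := small y.fst (by rwa [hy1])
  obtain ⟨d, hd⟩ := small y.snd (by rwa [hy2])
  obtain ⟨c, hc⟩ := h.exists_root d a
  -- The diagonal product is strictly smaller than the norm of the off-diagonal entry. Invariance of
  -- the discriminant will then recover that norm after the moves.
  have hdisc : ‖x.disc‖ = ‖nr x.off‖ := by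
    rw [disc, sub_norm_eq_right]
    rw [norm_mul]
    have hpos : 0 ≤ ‖nr x.off‖ := norm_nonneg _
    refine lt_of_pow_lt_pow_left₀ 2 hpos ?_
    rw [mul_pow, sq ‖nr x.off‖]
    exact mul_lt_mul'' h1 h2 (by positivity) (by positivity)
  obtain ⟨z, hyz, h1', h2', h3'⟩ := h.equiv_shear y (t := ⟨0, 0, c, 0⟩) (by
    simp only [nr]
    have : ‖(0 : k) ^ 2 - u * 0 ^ 2 - ϖ * c ^ 2 + u * ϖ * 0 ^ 2‖ ≤ 1 := by
      have e : (0 : k) ^ 2 - u * 0 ^ 2 - ϖ * c ^ 2 + u * ϖ * 0 ^ 2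
        = ((-(ϖ * c ^ 2) : 𝒪[k]) : k) := by push_cast; ring
      rw [e]; exact norm_coe_le_one _
    exact this)
  have hz0 : z.snd = 0 := by
    rw [h2', hy3, ha, hd]
    simp only [nr, antiEntry, QuaternionAlgebra.re_mul]
    rw [zpow_add_one₀ hw0]
    linear_combination (ϖ : k) ^ e * ϖ * hc
  refine ⟨z, hxy.trans hyz, by rw [h1', hy1], hz0, ?_⟩
  obtain ⟨κ, hκ⟩ := hxy.trans hyz
  have := h.norm_disc_actK κ x
  rw [hκ, hdisc, disc, hz0, mul_zero, zero_sub, norm_neg] at this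
  exact this

/-- Killing one diagonal entry does not change the absolute value of the other, so killing, swapping
and killing again leaves a zero diagonal. -/
theorem IsDatum.exists_rep_odd (x : HermSpace u ϖ) {e : ℤ}
    (hi : ‖nr x.off‖ = rq k ^ (-(2 * e + 1)))
    (h1 : ‖x.fst‖ ^ 2 < ‖nr x.off‖) (h2 : ‖x.snd‖ ^ 2 < ‖nr x.off‖) :
    KEquiv x (h.rep (.anti e)) := by
  obtain ⟨y, hxy, hy1, hy2, hy3⟩ := h.exists_kill_snd x hi h1 h2
  obtain ⟨z, hyz, hz1, hz2, hz3⟩ := h.equiv_swap y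
  have hz3' : ‖nr z.off‖ = ‖nr x.off‖ := by rw [hz3, nr_star, hy3]
  obtain ⟨w, hzw, hw1, hw2, hw3⟩ := h.exists_kill_snd z (hz3'.trans hi)
    (by rw [hz1, hy2, norm_zero, hz3', hi]; have := zpow_pos (rq_pos (k := k)) (-(2 * e + 1))
        simpa using this) (by rw [hz2, hy1, hz3']; exact h1)
  obtain ⟨v, hwv, hv1, hv2, hv3⟩ := h.exists_normalize_off w (hw3.trans (hz3'.trans hi))
  convert hxy.trans (hyz.trans (hzw.trans hwv))
  refine h.herm_ext ?_ ?_ ?_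
  · simp only [rep, fst_ofCoord]
    rw [hw1, hz1, hy2, norm_zero, norm_eq_zero] at hv1
    exact hv1.symm
  · simp only [rep, snd_ofCoord]; rw [hv2, hw2]
  · simp only [rep, off_ofCoord]; rw [hv3]

/-- Every form is equivalent to a standard representative. -/
theorem IsDatum.exists_rep (x : HermSpace u ϖ) : ∃ τ, KEquiv x (h.rep τ) := by
  by_cases h1 : ‖nr x.off‖ ≤ ‖x.fst‖ ^ 2
  · exact h.exists_rep_of_le_fst x h1
  by_cases h2 : ‖nr x.off‖ ≤ ‖x.snd‖ ^ 2
  · exact h.exists_rep_of_le_snd x h2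
  push Not at h1 h2
  have hn0 : nr x.off ≠ 0 := by
    rw [← norm_pos_iff]; exact (sq_nonneg _).trans_lt h1
  obtain ⟨n, hn⟩ := h.exists_norm_eq hn0
  rcases Int.even_or_odd' n with ⟨i, rfl | rfl⟩
  · exact h.exists_rep_even x hn h1 h2
  -- The exponent satisfies $2i+1=-(2e+1)$ exactly for $e=-i-1$.
  · refine ⟨.anti (-i - 1), h.exists_rep_odd x ?_ h1 h2⟩
    rw [hn]; congr 1; ring

omit h in
/-- The forms with prescribed discriminant and size. -/
def level (u ϖ : 𝒪[k]) (τ : OrbitIndex) : Set (HermSpace u ϖ) :=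
  {x | ‖x.disc‖ = rq k ^ (-τ.ordDisc) ∧ x.size = rq k ^ (-τ.ordSize)}

theorem IsDatum.mem_level_of_equiv {x : HermSpace u ϖ} {τ : OrbitIndex}
    (hx : KEquiv x (h.rep τ)) : x ∈ level u ϖ τ := by
  obtain ⟨κ, hκ⟩ := hx
  refine ⟨?_, ?_⟩
  · rw [← h.norm_disc_actK κ, hκ, h.norm_disc_rep]
  · rw [← h.size_actK κ, hκ, h.size_rep]

omit h in
theorem level_unique {x : HermSpace u ϖ} {σ τ : OrbitIndex} (hσ : x ∈ level u ϖ σ)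
    (hτ : x ∈ level u ϖ τ) : σ = τ := by
  refine OrbitIndex.ord_injective ?_ ?_
  · exact neg_injective (rq_zpow_inj (hσ.1.symm.trans hτ.1))
  · exact neg_injective (rq_zpow_inj (hσ.2.symm.trans hτ.2))

/-- The two invariants determine the orbit: every form is equivalent to some representative, and
different indices have different invariants. All later work can use the metric description of an
orbit. -/
theorem IsDatum.mem_level_iff {x : HermSpace u ϖ} {τ : OrbitIndex} :
    x ∈ level u ϖ τ ↔ KEquiv x (h.rep τ) := by
  refine ⟨fun hx => ?_, h.mem_level_of_equiv⟩
  obtain ⟨σ, hσ⟩ := h.exists_rep x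
  rwa [level_unique hx (h.mem_level_of_equiv hσ)]

theorem IsDatum.exists_mem_level (x : HermSpace u ϖ) : ∃ τ, x ∈ level u ϖ τ := by
  obtain ⟨τ, hτ⟩ := h.exists_rep x
  exact ⟨τ, h.mem_level_of_equiv hτ⟩

theorem IsDatum.rep_zero : h.rep (.diag 0 0) = 1 := by
  apply mat_injective
  have e : (1 : HermSpace u ϖ).mat = 1 := rfl
  rw [e]
  ext1 i j
  fin_cases i <;> fin_cases j <;> simp [rep, hermMat]

theorem IsDatum.orbitK_one : orbitK (1 : HermSpace u ϖ) = level u ϖ (.diag 0 0) := by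
  ext x
  rw [h.mem_level_iff, h.rep_zero]
  exact ⟨fun ⟨κ, hκ⟩ => KEquiv.symm ⟨κ, hκ⟩, fun hx => hx.symm⟩

/-- The index of the orbit of the inverse form. -/
def OrbitIndex.inv : OrbitIndex → OrbitIndex
  | .diag i n => .diag (-i - n) n
  | .anti e => .anti (-e - 1)

/-- The inverse is the adjugate divided by the discriminant, so the size is multiplied by
$|\mathrm{disc}|^{-2}$. -/
theorem IsDatum.inv_mem_level {x : HermSpace u ϖ} {τ : OrbitIndex} (hx : x ∈ level u ϖ τ) :
    x⁻¹ ∈ level u ϖ τ.inv := by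
  obtain ⟨h1, h2, h3⟩ := h.inv_coord x
  have hd := h.disc_ne_zero x
  have e1 : (x⁻¹).disc = x.disc⁻¹ := by
    rw [disc, h1, h2, h3, nr_neg, nr_smul]
    have : x.disc⁻¹ * x.snd * (x.disc⁻¹ * x.fst) - x.disc⁻¹ ^ 2 * nr x.off =
      x.disc⁻¹ ^ 2 * x.disc := by
      conv_rhs => rw [disc]
      rw [disc]; ring
    rw [this]; field_simp
  have e2 : (x⁻¹).size = (‖x.disc‖⁻¹) ^ 2 * x.size := by
    rw [size, h1, h2, h3, nr_neg, nr_smul, size, mul_max_of_nonneg _ _ (by positivity),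
      mul_max_of_nonneg _ _ (by positivity)]
    simp only [norm_mul, norm_inv, norm_pow, mul_pow]
    rw [max_comm (‖x.disc‖⁻¹ ^ 2 * ‖x.snd‖ ^ 2)]
  refine ⟨?_, ?_⟩
  · rw [e1, norm_inv, hx.1, ← zpow_neg]
    congr 1
    cases τ <;> simp only [OrbitIndex.inv, OrbitIndex.ordDisc] <;> ring
  · rw [e2, hx.1, hx.2, ← zpow_neg, ← zpow_natCast, ← zpow_mul, ← zpow_add₀ rq_pos.ne']
    congr 1
    cases τ <;> simp only [OrbitIndex.inv, OrbitIndex.ordDisc, OrbitIndex.ordSize] <;> push_cast <;>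
      ring

end QuatHerm

/-! ### Haar measures on the integral lattices -/

namespace QuatHerm

section CompactGroup

/-- The invariant probability measure on a compact additive group. -/
noncomputable def unitHaar (G : Type*) [AddCommGroup G] [TopologicalSpace G] [IsTopologicalAddGroup G]
    [CompactSpace G] [MeasurableSpace G] [BorelSpace G] : Measure G := Measure.addHaarMeasure ⊤

variable {G : Type*} [AddCommGroup G] [TopologicalSpace G] [IsTopologicalAddGroup G]
  [CompactSpace G] [MeasurableSpace G] [BorelSpace G]
variable {H : Type*} [AddCommGroup H] [TopologicalSpace H] [IsTopologicalAddGroup H]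
  [CompactSpace H] [MeasurableSpace H] [BorelSpace H]

instance : (unitHaar G).IsAddHaarMeasure := by unfold unitHaar; infer_instance

instance : IsProbabilityMeasure (unitHaar G) := ⟨by
  have := Measure.addHaarMeasure_self (K₀ := (⊤ : TopologicalSpace.PositiveCompacts G))
  simpa [unitHaar] using this⟩

/-- Pushforwards of invariant probability measures under continuous surjective homomorphisms are
again invariant, so uniqueness of Haar measure applies. This serves as the change of variables
formula for units and coordinate projections. -/
theorem measurePreserving_of_surjective (f : G →+ H) (hf : Continuous f)
    (hs : Function.Surjective f) : MeasurePreserving f (unitHaar G) (unitHaar H) :=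
  AddMonoidHom.measurePreserving hf hs (by simp)

theorem eq_smul_unitHaar (ν : Measure G) [IsFiniteMeasure ν] [ν.IsAddLeftInvariant] :
    ν = ν Set.univ • unitHaar G := by
  have e := Measure.isAddInvariant_eq_smul_of_compactSpace ν (unitHaar G)
  have e2 : ν Set.univ = (ν.addHaarScalarFactor (unitHaar G) : ENNReal) := by
    conv_lhs => rw [e]
    simp
  rw [e2]
  exact e

theorem unitHaar_prod [SecondCountableTopology G] [SecondCountableTopology H] :
    unitHaar (G × H) = (unitHaar G).prod (unitHaar H) := by
  have := eq_smul_unitHaar ((unitHaar G).prod (unitHaar H))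
  rw [this, measure_univ, one_smul]

variable {A : Type*} [AddCommGroup A] [TopologicalSpace A] [IsTopologicalAddGroup A]
  [T2Space A] [MeasurableSpace A] [BorelSpace A]

theorem measurableEmbedding_of_injective (f : G →+ A) (hf : Continuous f)
    (hi : Function.Injective f) : MeasurableEmbedding f :=
  (hf.isClosedEmbedding hi).measurableEmbedding

/-- The pullback along an injective homomorphism is invariant with total mass the measure of the
image. It is used for sublattices such as multiples of a uniformizer. -/
theorem comap_eq_smul_unitHaar (ν : Measure A) [ν.IsAddLeftInvariant] (f : G →+ A)
    (hf : Continuous f) (hi : Function.Injective f) (hfin : ν (Set.range f) ≠ ⊤) :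
    ν.comap f = ν (Set.range f) • unitHaar G := by
  have he := measurableEmbedding_of_injective f hf hi
  have huniv : ν.comap f Set.univ = ν (Set.range f) := by
    rw [he.comap_apply, Set.image_univ]
  have : IsFiniteMeasure (ν.comap f) := ⟨by rw [huniv]; exact hfin.lt_top⟩
  have : (ν.comap f).IsAddLeftInvariant := ⟨fun g => by
    ext s hs
    rw [Measure.map_apply (measurable_const_add g) hs, he.comap_apply, he.comap_apply]
    have : f '' ((fun x => g + x) ⁻¹' s) = (fun x => f g + x) ⁻¹' (f '' s) := by
      ext y
      constructor
      · rintro ⟨x, hx, rfl⟩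
        exact ⟨g + x, hx, by simp⟩
      · rintro ⟨x, hx, hxy⟩
        refine ⟨x - g, by simpa using hx, ?_⟩
        rw [map_sub, hxy]; simp
    rw [this, measure_preimage_add]⟩
  rw [← huniv]
  exact eq_smul_unitHaar _

theorem measure_image_eq (ν : Measure A) [ν.IsAddLeftInvariant] (f : G →+ A)
    (hf : Continuous f) (hi : Function.Injective f) (hfin : ν (Set.range f) ≠ ⊤) (s : Set G) :
    ν (f '' s) = ν (Set.range f) * unitHaar G s := by
  have he := measurableEmbedding_of_injective f hf hi
  rw [← he.comap_apply, comap_eq_smul_unitHaar ν f hf hi hfin]; rfl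

theorem setIntegral_range_eq (f : G →+ H) [T2Space H] (hf : Continuous f)
    (hi : Function.Injective f) (g : H → ℂ) :
    ∫ x in Set.range f, g x ∂(unitHaar H) =
      (unitHaar H).real (Set.range f) * ∫ x, g (f x) ∂(unitHaar G) := by
  have he := measurableEmbedding_of_injective f hf hi
  rw [← he.map_comap, he.integral_map, comap_eq_smul_unitHaar _ f hf hi (measure_ne_top _ _),
    integral_smul_measure]
  rfl

end CompactGroup

section QuaternionMeasure

variable {R : Type*} [TopologicalSpace R] {a b c : R}

instance : MeasurableSpace ℍ[R,a,b,c] := borel _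
instance : BorelSpace ℍ[R,a,b,c] := ⟨rfl⟩

instance [SecondCountableTopology R] : SecondCountableTopology ℍ[R,a,b,c] :=
  (coordHomeo (a := a) (b := b) (c := c)).isInducing.secondCountableTopology

theorem continuous_re : Continuous fun α : ℍ[R,a,b,c] => α.re := (continuous_quat.1 continuous_id).1
theorem continuous_imI : Continuous fun α : ℍ[R,a,b,c] => α.imI :=
  (continuous_quat.1 continuous_id).2.1
theorem continuous_imJ : Continuous fun α : ℍ[R,a,b,c] => α.imJ :=
  (continuous_quat.1 continuous_id).2.2.1
theorem continuous_imK : Continuous fun α : ℍ[R,a,b,c] => α.imK :=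
  (continuous_quat.1 continuous_id).2.2.2

theorem continuous_nr {R : Type*} [CommRing R] [TopologicalSpace R] [IsTopologicalRing R]
    {a b : R} : Continuous fun α : ℍ[R,a,b] => nr α := by
  have h1 := continuous_re (a := a) (b := 0) (c := b)
  have h2 := continuous_imI (a := a) (b := 0) (c := b)
  have h3 := continuous_imJ (a := a) (b := 0) (c := b)
  have h4 := continuous_imK (a := a) (b := 0) (c := b)
  unfold nr
  fun_prop

theorem continuous_quat_star {R : Type*} [CommRing R] [TopologicalSpace R] [IsTopologicalRing R]
    {a b : R} : Continuous fun α : ℍ[R,a,b] => star α := by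
  rw [continuous_quat]
  have h1 := continuous_re (a := a) (b := 0) (c := b)
  have h2 := continuous_imI (a := a) (b := 0) (c := b)
  have h3 := continuous_imJ (a := a) (b := 0) (c := b)
  have h4 := continuous_imK (a := a) (b := 0) (c := b)
  simp only [QuaternionAlgebra.re_star, QuaternionAlgebra.imI_star, QuaternionAlgebra.imJ_star,
    QuaternionAlgebra.imK_star]
  refine ⟨?_, ?_, ?_, ?_⟩ <;> fun_prop

end QuaternionMeasure

/-! ### Volumes of units and non-units, and substitution by uniformizers -/

section Integers

variable {k : Type*} [NontriviallyNormedField k] [IsUltrametricDist k] [ProperSpace k]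
  [MeasurableSpace k] [BorelSpace k] {u ϖ : 𝒪[k]}

instance : SecondCountableTopology k := secondCountable_of_proper

/-- The invariant probability measure on the ring of integers. -/
noncomputable abbrev lam (k : Type*) [NontriviallyNormedField k] [IsUltrametricDist k]
    [ProperSpace k] [MeasurableSpace k] [BorelSpace k] : Measure 𝒪[k] := unitHaar 𝒪[k]

/-- The invariant probability measure on the maximal order. -/
noncomputable abbrev muO (u ϖ : 𝒪[k]) : Measure (MaxOrder u ϖ) := unitHaar (MaxOrder u ϖ)

theorem isOpen_units_int : IsOpen {x : 𝒪[k] | IsUnit x} := by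
  have : {x : 𝒪[k] | IsUnit x} = (fun x : 𝒪[k] => (x : k)) ⁻¹' Metric.sphere 0 1 := by
    ext x; simp [isUnit_int_iff]
  rw [this]
  exact (IsUltrametricDist.isOpen_sphere 0 one_ne_zero).preimage continuous_subtype_val

theorem measurableSet_units_int : MeasurableSet {x : 𝒪[k] | IsUnit x} :=
  isOpen_units_int.measurableSet

theorem measurableSet_nonunits_int : MeasurableSet {x : 𝒪[k] | ¬ IsUnit x} :=
  measurableSet_units_int.compl

/-- The non-units form an ideal whose $q$ cosets have equal measure. -/
theorem lam_nonunits : (lam k).real {x : 𝒪[k] | ¬ IsUnit x} = (rq k)⁻¹ := by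
  let m : AddSubgroup 𝒪[k] := (IsLocalRing.maximalIdeal 𝒪[k]).toAddSubgroup
  have hm : (m : Set 𝒪[k]) = {x : 𝒪[k] | ¬ IsUnit x} := by
    ext x
    simp only [m, Submodule.coe_toAddSubgroup, SetLike.mem_coe, IsLocalRing.mem_maximalIdeal,
      mem_nonunits_iff, Set.mem_ofPred_eq]
  have hidx : m.index = resCard k := rfl
  have : m.FiniteIndex := ⟨by rw [hidx]; exact (Nat.card_pos).ne'⟩
  have e := AddSubgroup.index_mul_measure m (by rw [hm]; exact measurableSet_nonunits_int) (lam k)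
  rw [hm, measure_univ, hidx] at e
  have e2 := congrArg ENNReal.toReal e
  rw [ENNReal.toReal_mul, ENNReal.toReal_natCast, ENNReal.toReal_one] at e2
  exact eq_inv_of_mul_eq_one_right e2

theorem lam_units : (lam k).real {x : 𝒪[k] | IsUnit x} = 1 - (rq k)⁻¹ := by
  have e := measureReal_compl (μ := lam k) (measurableSet_nonunits_int (k := k))
  rw [lam_nonunits, probReal_univ] at e
  rw [← e]; congr 1; ext x; simp

theorem measurableSet_units_order : MeasurableSet {x : MaxOrder u ϖ | IsUnit x} := by
  have : {x : MaxOrder u ϖ | IsUnit x} = (fun x => nr x) ⁻¹' {x : 𝒪[k] | IsUnit x} := by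
    ext x; simp only [Set.mem_ofPred_eq, Set.mem_preimage]; exact isUnit_iff_isUnit_nr x
  rw [this]
  exact continuous_nr.measurable measurableSet_units_int

theorem measurableSet_nonunits_order : MeasurableSet {x : MaxOrder u ϖ | ¬ IsUnit x} :=
  measurableSet_units_order.compl

variable (u ϖ) in
/-- The uniformizer of the maximal order. -/
noncomputable def piO : MaxOrder u ϖ := ⟨0, 0, 1, 0⟩

theorem measurePreserving_mul_left (v : (MaxOrder u ϖ)ˣ) :
    MeasurePreserving (fun w : MaxOrder u ϖ => v * w) (muO u ϖ) (muO u ϖ) :=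
  measurePreserving_of_surjective (AddMonoidHom.mulLeft (v : MaxOrder u ϖ))
    (continuous_const.mul continuous_id) (fun w => ⟨v⁻¹ * w, by simp⟩)

theorem measurePreserving_mul_right (v : (MaxOrder u ϖ)ˣ) :
    MeasurePreserving (fun w : MaxOrder u ϖ => w * v) (muO u ϖ) (muO u ϖ) :=
  measurePreserving_of_surjective (AddMonoidHom.mulRight (v : MaxOrder u ϖ))
    (continuous_id.mul continuous_const) (fun w => ⟨w * v⁻¹, by simp⟩)

theorem measurableEmbedding_mul_left (v : (MaxOrder u ϖ)ˣ) :
    MeasurableEmbedding (fun w : MaxOrder u ϖ => v * w) :=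
  measurableEmbedding_of_injective (AddMonoidHom.mulLeft (v : MaxOrder u ϖ))
    (continuous_const.mul continuous_id) (fun _ _ hw => v.isUnit.mul_left_cancel hw)

theorem measurableEmbedding_mul_right (v : (MaxOrder u ϖ)ˣ) :
    MeasurableEmbedding (fun w : MaxOrder u ϖ => w * v) :=
  measurableEmbedding_of_injective (AddMonoidHom.mulRight (v : MaxOrder u ϖ))
    (continuous_id.mul continuous_const) (fun _ _ hw => v.isUnit.mul_right_cancel hw)

theorem integral_order_mul_left (v : (MaxOrder u ϖ)ˣ) (g : MaxOrder u ϖ → ℂ) :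
    ∫ w, g (v * w) ∂(muO u ϖ) = ∫ w, g w ∂(muO u ϖ) :=
  (measurePreserving_mul_left v).integral_comp (measurableEmbedding_mul_left v) g

theorem integral_order_mul_right (v : (MaxOrder u ϖ)ˣ) (g : MaxOrder u ϖ → ℂ) :
    ∫ w, g (w * v) ∂(muO u ϖ) = ∫ w, g w ∂(muO u ϖ) :=
  (measurePreserving_mul_right v).integral_comp (measurableEmbedding_mul_right v) g

theorem setIntegral_order_mul_left (v : (MaxOrder u ϖ)ˣ) (g : MaxOrder u ϖ → ℂ) :
    ∫ w in {w | ¬ IsUnit w}, g (v * w) ∂(muO u ϖ) = ∫ w in {w | ¬ IsUnit w}, g w ∂(muO u ϖ) := by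
  have e := (measurePreserving_mul_left v).setIntegral_preimage_emb
    (measurableEmbedding_mul_left v) g {w | ¬ IsUnit w}
  rw [← e]
  congr 2
  ext w
  simp

theorem setIntegral_order_mul_right (v : (MaxOrder u ϖ)ˣ) (g : MaxOrder u ϖ → ℂ) :
    ∫ w in {w | ¬ IsUnit w}, g (w * v) ∂(muO u ϖ) = ∫ w in {w | ¬ IsUnit w}, g w ∂(muO u ϖ) := by
  have e := (measurePreserving_mul_right v).setIntegral_preimage_emb
    (measurableEmbedding_mul_right v) g {w | ¬ IsUnit w}
  rw [← e]
  congr 2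
  ext w
  simp

theorem integral_order_re (g : 𝒪[k] → ℂ) (hg : Measurable g) :
    ∫ w, g w.re ∂(muO u ϖ) = ∫ t, g t ∂(lam k) := by
  have hmp := measurePreserving_of_surjective
    (G := MaxOrder u ϖ) (H := 𝒪[k])
    (AddMonoidHom.mk' (fun α : MaxOrder u ϖ => α.re) (fun _ _ => rfl)) continuous_re
    (fun t => ⟨⟨t, 0, 0, 0⟩, rfl⟩)
  have e : Measure.map (fun α : MaxOrder u ϖ => α.re) (muO u ϖ) = lam k := hmp.map_eq
  rw [← e, integral_map continuous_re.measurable.aemeasurable hg.aestronglyMeasurable]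

theorem integral_order_imJ (g : 𝒪[k] → ℂ) (hg : Measurable g) :
    ∫ w, g w.imJ ∂(muO u ϖ) = ∫ t, g t ∂(lam k) := by
  have hmp := measurePreserving_of_surjective
    (G := MaxOrder u ϖ) (H := 𝒪[k])
    (AddMonoidHom.mk' (fun α : MaxOrder u ϖ => α.imJ) (fun _ _ => rfl)) continuous_imJ
    (fun t => ⟨⟨0, 0, t, 0⟩, rfl⟩)
  have e : Measure.map (fun α : MaxOrder u ϖ => α.imJ) (muO u ϖ) = lam k := hmp.map_eq
  rw [← e, integral_map continuous_imJ.measurable.aemeasurable hg.aestronglyMeasurable]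

variable (h : IsDatum u ϖ)
include h

theorem IsDatum.range_mul_int :
    Set.range (fun t : 𝒪[k] => ϖ * t) = {t : 𝒪[k] | ¬ IsUnit t} := by
  ext t
  constructor
  · rintro ⟨s, rfl⟩ hs
    exact h.irr.not_isUnit (isUnit_of_mul_isUnit_left hs)
  · intro ht
    obtain ⟨y, hy⟩ := h.exists_eq_mul (x := (t : k)) (lt_of_le_of_ne (norm_coe_le_one t)
      (fun h1 => ht (isUnit_int_iff.2 h1)))
    exact ⟨y, Subtype.ext (by rw [hy]; rfl)⟩

theorem IsDatum.setIntegral_nonunits_int (g : 𝒪[k] → ℂ) :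
    ∫ t in {t : 𝒪[k] | ¬ IsUnit t}, g t ∂(lam k) =
      ((rq k)⁻¹ : ℝ) * ∫ t, g (ϖ * t) ∂(lam k) := by
  have e := setIntegral_range_eq (G := 𝒪[k]) (H := 𝒪[k]) (AddMonoidHom.mulLeft ϖ)
    (continuous_const.mul continuous_id)
    (fun _ _ hw => mul_left_cancel₀ h.irr.ne_zero hw) g
  have hr : Set.range (AddMonoidHom.mulLeft ϖ) = {t : 𝒪[k] | ¬ IsUnit t} := h.range_mul_int
  rw [hr, lam_nonunits] at e
  exact e

theorem IsDatum.range_mul_order :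
    Set.range (fun w : MaxOrder u ϖ => piO u ϖ * w) = {w : MaxOrder u ϖ | ¬ IsUnit w} := by
  ext t
  rw [Set.mem_ofPred_eq, h.not_isUnit_order_iff']
  constructor
  · rintro ⟨s, rfl⟩
    simp [piO, h.irr.not_isUnit]
  · rintro ⟨h1, h2⟩
    have key : ∀ s : 𝒪[k], ¬ IsUnit s → ∃ r, ϖ * r = s := fun s hs => by
      have : s ∈ Set.range (fun t : 𝒪[k] => ϖ * t) := by rw [h.range_mul_int]; exact hs
      exact this
    obtain ⟨r, hr⟩ := key _ h1
    obtain ⟨s, hs⟩ := key _ h2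
    -- Left multiplication by $\Pi$ exchanges the coordinates along $1,\varepsilon$ with those along
    -- $\Pi,\varepsilon\Pi$; the signs come from $\Pi\varepsilon=-\varepsilon\Pi$.
    refine ⟨⟨t.imJ, -t.imK, r, -s⟩, ?_⟩
    ext <;> simp [piO, hr, hs]

/-- Being a non-unit is a condition on two coordinates, each required to lie in the maximal ideal of
$\mathfrak o$. -/
theorem IsDatum.muO_nonunits : (muO u ϖ).real {w | ¬ IsUnit w} = ((rq k)⁻¹) ^ 2 := by
  have hmp := measurePreserving_of_surjective
    (G := MaxOrder u ϖ) (H := 𝒪[k] × 𝒪[k])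
    (AddMonoidHom.mk' (fun α : MaxOrder u ϖ => (α.re, α.imI)) (fun _ _ => rfl))
    (continuous_re.prodMk continuous_imI) (fun t => ⟨⟨t.1, t.2, 0, 0⟩, rfl⟩)
  have hm := measurableSet_nonunits_int (k := k)
  have e := hmp.measure_preimage (hm.prod hm).nullMeasurableSet
  rw [unitHaar_prod, Measure.prod_prod] at e
  have e2 : {w : MaxOrder u ϖ | ¬ IsUnit w} =
      (AddMonoidHom.mk' (fun α : MaxOrder u ϖ => (α.re, α.imI)) (fun _ _ => rfl)) ⁻¹'
        ({t : 𝒪[k] | ¬ IsUnit t} ×ˢ {t : 𝒪[k] | ¬ IsUnit t}) := by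
    ext w
    rw [Set.mem_ofPred_eq, h.not_isUnit_order_iff']
    rfl
  rw [e2, measureReal_def, e, ENNReal.toReal_mul, ← measureReal_def, lam_nonunits]
  ring

theorem IsDatum.muO_units : (muO u ϖ).real {w | IsUnit w} = 1 - ((rq k)⁻¹) ^ 2 := by
  have e := measureReal_compl (μ := muO u ϖ) (measurableSet_nonunits_order)
  rw [h.muO_nonunits, probReal_univ] at e
  rw [← e]; congr 1; ext x; simp

theorem IsDatum.setIntegral_nonunits_order (g : MaxOrder u ϖ → ℂ) :
    ∫ t in {t : MaxOrder u ϖ | ¬ IsUnit t}, g t ∂(muO u ϖ) =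
      (((rq k)⁻¹ ^ 2 : ℝ) : ℂ) * ∫ t, g (piO u ϖ * t) ∂(muO u ϖ) := by
  have e := setIntegral_range_eq (G := MaxOrder u ϖ) (H := MaxOrder u ϖ)
    (AddMonoidHom.mulLeft (piO u ϖ)) (continuous_const.mul continuous_id)
    (fun v w hw => by
      have hw : piO u ϖ * v = piO u ϖ * w := hw
      have key : piO u ϖ * (v - w) = 0 := by rw [mul_sub, hw, sub_self]
      have e := congrArg (fun α => (α.re, α.imI, α.imJ, α.imK)) key
      have h0 := h.irr.ne_zero
      simp [piO, h0] at e
      obtain ⟨e1, e2, e3, e4⟩ := e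
      ext <;> [have := e3; have := e4; have := e1; have := e2] <;>
      · rw [sub_eq_zero] at this
        rw [this]) g
  have hr : Set.range (AddMonoidHom.mulLeft (piO u ϖ)) = {w : MaxOrder u ϖ | ¬ IsUnit w} :=
    h.range_mul_order
  rw [hr, h.muO_nonunits] at e
  exact e

end Integers
end QuatHerm

/-! ### Averages over the first row -/

namespace QuatHerm

variable {k : Type*} [NontriviallyNormedField k] [IsUltrametricDist k] [ProperSpace k]
  [MeasurableSpace k] [BorelSpace k] {u ϖ : 𝒪[k]}

/-! ### Averages over the maximal compact subgroup -/

section Average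

instance : (GLO.haar u ϖ).IsHaarMeasure := by unfold GLO.haar; infer_instance

instance : IsProbabilityMeasure (GLO.haar u ϖ) := ⟨by
  have := Measure.haarMeasure_self (K₀ := (⊤ : TopologicalSpace.PositiveCompacts (GLO u ϖ)))
  simpa [GLO.haar] using this⟩

instance : (GLO.haar u ϖ).IsMulRightInvariant := ⟨fun g => by
  have : IsProbabilityMeasure (Measure.map (fun x => x * g) (GLO.haar u ϖ)) :=
    Measure.isProbabilityMeasure_map (measurable_mul_const g).aemeasurable
  exact Measure.isHaarMeasure_eq_of_isProbabilityMeasure _ _⟩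

/-- The entries of an element of `K`. -/
def GLO.entry (κ : GLO u ϖ) (i j : Fin 2) : MaxOrder u ϖ :=
  (Units.val (α := Matrix (Fin 2) (Fin 2) (MaxOrder u ϖ)) κ) i j

theorem GLO.continuous_entry (i j : Fin 2) : Continuous fun κ : GLO u ϖ => κ.entry i j := by
  have : Continuous fun κ : GLO u ϖ => (Units.val (α := Matrix (Fin 2) (Fin 2) (MaxOrder u ϖ)) κ) :=
    Units.continuous_val
  exact this.matrix_elem i j

theorem GLO.entry_mul (κ κ' : GLO u ϖ) (i j : Fin 2) :
    (κ * κ').entry i j = κ.entry i 0 * κ'.entry 0 j + κ.entry i 1 * κ'.entry 1 j := by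
  change (Units.val (α := Matrix (Fin 2) (Fin 2) (MaxOrder u ϖ)) κ *
    Units.val (α := Matrix (Fin 2) (Fin 2) (MaxOrder u ϖ)) κ') i j = _
  rw [Matrix.mul_apply, Fin.sum_univ_two]; rfl

theorem GLO.entry_one : (1 : GLO u ϖ).entry 0 0 = 1 ∧ (1 : GLO u ϖ).entry 0 1 = 0 ∧
    (1 : GLO u ϖ).entry 1 0 = 0 ∧ (1 : GLO u ϖ).entry 1 1 = 1 := by
  change (1 : Matrix (Fin 2) (Fin 2) (MaxOrder u ϖ)) 0 0 = 1 ∧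
    (1 : Matrix (Fin 2) (Fin 2) (MaxOrder u ϖ)) 0 1 = 0 ∧
    (1 : Matrix (Fin 2) (Fin 2) (MaxOrder u ϖ)) 1 0 = 0 ∧
    (1 : Matrix (Fin 2) (Fin 2) (MaxOrder u ϖ)) 1 1 = 1
  simp

/-- Right multiplication of row vectors by an element of `K`. -/
noncomputable def rowMul (κ : GLO u ϖ) : MaxOrder u ϖ × MaxOrder u ϖ →+ MaxOrder u ϖ × MaxOrder u ϖ where
  toFun p := (p.1 * κ.entry 0 0 + p.2 * κ.entry 1 0, p.1 * κ.entry 0 1 + p.2 * κ.entry 1 1)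
  map_zero' := by simp
  map_add' p p' := by
    simp only [Prod.fst_add, Prod.snd_add, add_mul, Prod.mk_add_mk]
    congr 1 <;> abel

theorem rowMul_mul (κ κ' : GLO u ϖ) (p) : rowMul (κ * κ') p = rowMul κ' (rowMul κ p) := by
  simp only [rowMul, AddMonoidHom.coe_mk, ZeroHom.coe_mk, GLO.entry_mul, mul_add, add_mul,
    mul_assoc]
  congr 1 <;> abel

theorem rowMul_one (p : MaxOrder u ϖ × MaxOrder u ϖ) : rowMul 1 p = p := by
  obtain ⟨h1, h2, h3, h4⟩ := GLO.entry_one (u := u) (ϖ := ϖ)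
  simp [rowMul, h1, h2, h3, h4]

/-- The first row of an element of `K`. -/
def GLO.row (κ : GLO u ϖ) : MaxOrder u ϖ × MaxOrder u ϖ := (κ.entry 0 0, κ.entry 0 1)

theorem GLO.row_mul (κ κ' : GLO u ϖ) : (κ * κ').row = rowMul κ' κ.row := by
  simp [GLO.row, rowMul, GLO.entry_mul]

theorem continuous_rowMul :
    Continuous fun x : GLO u ϖ × (MaxOrder u ϖ × MaxOrder u ϖ) => rowMul x.1 x.2 := by
  have e := fun i j => (GLO.continuous_entry (u := u) (ϖ := ϖ) i j).comp
    (continuous_fst (Y := MaxOrder u ϖ × MaxOrder u ϖ))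
  have h1 : Continuous fun x : GLO u ϖ × (MaxOrder u ϖ × MaxOrder u ϖ) => x.2.1 := by fun_prop
  have h2 : Continuous fun x : GLO u ϖ × (MaxOrder u ϖ × MaxOrder u ϖ) => x.2.2 := by fun_prop
  exact ((h1.mul (e 0 0)).add (h2.mul (e 1 0))).prodMk ((h1.mul (e 0 1)).add (h2.mul (e 1 1)))

theorem continuous_rowMul_right (κ : GLO u ϖ) : Continuous (rowMul κ) :=
  ((continuous_fst.mul continuous_const).add (continuous_snd.mul continuous_const)).prodMk
    ((continuous_fst.mul continuous_const).add (continuous_snd.mul continuous_const))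

variable (u ϖ) in
/-- The primitive row vectors. -/
def primVec : Set (MaxOrder u ϖ × MaxOrder u ϖ) := {p | IsUnit p.1 ∨ IsUnit p.2}

theorem measurableSet_primVec : MeasurableSet (primVec u ϖ) :=
  (measurableSet_units_order.preimage measurable_fst).union
    (measurableSet_units_order.preimage measurable_snd)

theorem exists_row_eq {p : MaxOrder u ϖ × MaxOrder u ϖ} (hp : p ∈ primVec u ϖ) :
    ∃ κ : GLO u ϖ, κ.row = p := by
  obtain ⟨v, w⟩ := p
  rcases hp with ⟨v, rfl⟩ | ⟨w, rfl⟩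
  · let κ : (Matrix (Fin 2) (Fin 2) (MaxOrder u ϖ))ˣ :=
      ⟨!![(v : MaxOrder u ϖ), w; 0, 1], !![((v⁻¹ : (MaxOrder u ϖ)ˣ) : MaxOrder u ϖ), -(v⁻¹ * w); 0, 1],
        by simp [Matrix.one_fin_two], by simp [Matrix.one_fin_two]⟩
    exact ⟨κ, rfl⟩
  · let κ : (Matrix (Fin 2) (Fin 2) (MaxOrder u ϖ))ˣ :=
      ⟨!![v, (w : MaxOrder u ϖ); 1, 0], !![0, 1; ((w⁻¹ : (MaxOrder u ϖ)ˣ) : MaxOrder u ϖ), -(w⁻¹ * v)],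
        by simp [Matrix.one_fin_two], by simp [Matrix.one_fin_two]⟩
    exact ⟨κ, rfl⟩

variable (h : IsDatum u ϖ)
include h

theorem IsDatum.not_isUnit_order_iff_le {α : MaxOrder u ϖ} :
    ¬ IsUnit α ↔ ‖nr (orderIncl u ϖ α)‖ ≤ (rq k)⁻¹ := by
  rw [not_isUnit_order_iff, h.norm_lt_one_iff]

/-- Vectors with both entries non-units are preserved by integral matrices; applying this to
$\kappa^{-1}$ preserves their complement. -/
theorem IsDatum.rowMul_mem_primVec (κ : GLO u ϖ) {p : MaxOrder u ϖ × MaxOrder u ϖ}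
    (hp : p ∈ primVec u ϖ) : rowMul κ p ∈ primVec u ϖ := by
  have key : ∀ (κ : GLO u ϖ) (p : MaxOrder u ϖ × MaxOrder u ϖ), p ∉ primVec u ϖ →
      rowMul κ p ∉ primVec u ϖ := by
    intro κ p hp
    simp only [primVec, Set.mem_ofPred_eq, not_or, h.not_isUnit_order_iff_le] at hp ⊢
    have hm : ∀ {α β : MaxOrder u ϖ}, ‖nr (orderIncl u ϖ α)‖ ≤ (rq k)⁻¹ →
        ‖nr (orderIncl u ϖ (α * β))‖ ≤ (rq k)⁻¹ := fun {α β} h1 => by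
      rw [map_mul, nr_mul, norm_mul]
      exact (mul_le_of_le_one_right (norm_nonneg _) (norm_nr_orderIncl_le β)).trans h1
    simp only [rowMul, AddMonoidHom.coe_mk, ZeroHom.coe_mk]
    constructor
    · rw [map_add]; exact h.nr_add_le (hm hp.1) (hm hp.2)
    · rw [map_add]; exact h.nr_add_le (hm hp.1) (hm hp.2)
  by_contra hn
  have := key κ⁻¹ _ hn
  rw [← rowMul_mul, mul_inv_cancel, rowMul_one] at this
  exact this hp

theorem IsDatum.rowMul_preimage_primVec (κ : GLO u ϖ) :
    rowMul κ ⁻¹' primVec u ϖ = primVec u ϖ := by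
  ext p
  refine ⟨fun hp => ?_, h.rowMul_mem_primVec κ⟩
  have := h.rowMul_mem_primVec κ⁻¹ hp
  rwa [← rowMul_mul, mul_inv_cancel, rowMul_one] at this

theorem IsDatum.setIntegral_rowMul (κ : GLO u ϖ) (F : MaxOrder u ϖ × MaxOrder u ϖ → ℂ) :
    ∫ p in primVec u ϖ, F (rowMul κ p) ∂(unitHaar _) = ∫ p in primVec u ϖ, F p ∂(unitHaar _) := by
  have hc := continuous_rowMul_right κ
  have hi : ∀ κ : GLO u ϖ, ∀ p, rowMul κ⁻¹ (rowMul κ p) = p := fun κ p => by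
    rw [← rowMul_mul, mul_inv_cancel, rowMul_one]
  have hs : Function.Surjective (rowMul κ) := by
    intro p
    refine ⟨rowMul κ⁻¹ p, ?_⟩
    rw [← rowMul_mul, inv_mul_cancel, rowMul_one]
  have hmp := measurePreserving_of_surjective (rowMul κ) hc hs
  have e := hmp.setIntegral_preimage_emb
    (measurableEmbedding_of_injective _ hc (Function.LeftInverse.injective (hi κ))) F (primVec u ϖ)
  rwa [h.rowMul_preimage_primVec] at e

/-- The average of a function of the first row over `K`, as an integral over primitive vectors. -/
theorem IsDatum.average_row (F : MaxOrder u ϖ × MaxOrder u ϖ → ℂ) (hF : Measurable F)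
    (hb : ∀ p, ‖F p‖ ≤ 1) :
    (unitHaar (MaxOrder u ϖ × MaxOrder u ϖ)).real (primVec u ϖ) *
      ∫ κ, F κ.row ∂(GLO.haar u ϖ) = ∫ p in primVec u ϖ, F p ∂(unitHaar _) := by
  set μ := (unitHaar (MaxOrder u ϖ × MaxOrder u ϖ)).restrict (primVec u ϖ)
  have hmeas : Measurable fun x : GLO u ϖ × (MaxOrder u ϖ × MaxOrder u ϖ) => F (rowMul x.1 x.2) :=
    hF.comp continuous_rowMul.measurable
  have hint : Integrable (fun x : GLO u ϖ × (MaxOrder u ϖ × MaxOrder u ϖ) => F (rowMul x.1 x.2))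
      ((GLO.haar u ϖ).prod μ) :=
    Integrable.of_bound hmeas.aestronglyMeasurable 1 (Filter.Eventually.of_forall fun _ => hb _)
  -- The double integral is read in two ways. For fixed $\kappa$ the substitution preserves the
  -- measure on primitive vectors; for fixed $p$, written as a first row, left invariance on $K$
  -- gives the average of $F$.
  have e := integral_integral_swap (f := fun κ p => F (rowMul κ p)) hint
  have e1 : ∀ κ : GLO u ϖ, ∫ p, F (rowMul κ p) ∂μ = ∫ p, F p ∂μ := fun κ =>
    h.setIntegral_rowMul κ F
  simp only [e1, integral_const, probReal_univ, one_smul] at e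
  rw [e]
  have e2 : ∫ p, ∫ κ, F (rowMul κ p) ∂(GLO.haar u ϖ) ∂μ =
      ∫ p, (∫ κ, F κ.row ∂(GLO.haar u ϖ)) ∂μ := by
    refine setIntegral_congr_fun measurableSet_primVec fun p hp => ?_
    obtain ⟨κ₀, rfl⟩ := exists_row_eq hp
    simp only [← GLO.row_mul]
    exact integral_mul_left_eq_self (μ := GLO.haar u ϖ) (fun κ => F κ.row) κ₀
  rw [e2, integral_const, Complex.real_smul]
  simp [μ]

/-- Primitive vectors split into those with second entry a unit and those with first entry a unit
and second entry a non-unit. In both pieces the remaining outer integral runs over units, of volume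
$1-q^{-2}$. -/
theorem IsDatum.setIntegral_primVec (F : MaxOrder u ϖ × MaxOrder u ϖ → ℂ) (hF : Measurable F)
    (hb : ∀ p, ‖F p‖ ≤ 1) (A B : ℂ)
    (hA : ∀ w, IsUnit w → ∫ v, F (v, w) ∂(muO u ϖ) = A)
    (hB : ∀ v, IsUnit v → ∫ w in {w | ¬ IsUnit w}, F (v, w) ∂(muO u ϖ) = B) :
    ∫ p in primVec u ϖ, F p ∂(unitHaar _) = (1 - ((rq k : ℂ)⁻¹) ^ 2) * (A + B) := by
  have hU := measurableSet_units_order (u := u) (ϖ := ϖ)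
  have hN := measurableSet_nonunits_order (u := u) (ϖ := ϖ)
  have hi : ∀ ν : Measure (MaxOrder u ϖ × MaxOrder u ϖ), IsFiniteMeasure ν → Integrable F ν :=
    fun ν _ => Integrable.of_bound hF.aestronglyMeasurable 1 (Filter.Eventually.of_forall hb)
  have hdec : primVec u ϖ = (Set.univ ×ˢ {w | IsUnit w}) ∪ ({v | IsUnit v} ×ˢ {w | ¬ IsUnit w}) := by
    ext p
    simp only [primVec, Set.mem_ofPred_eq, Set.mem_union, Set.mem_prod, Set.mem_univ, true_and]
    tauto
  have e1 : ∫ p in Set.univ ×ˢ {w | IsUnit w}, F p ∂((muO u ϖ).prod (muO u ϖ)) =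
      (1 - ((rq k : ℂ)⁻¹) ^ 2) * A := by
    rw [← Measure.prod_restrict, integral_prod_symm _ (hi _ inferInstance), Measure.restrict_univ,
      setIntegral_congr_fun hU (g := fun _ => A) (fun w hw => hA w hw), setIntegral_const,
      h.muO_units, Complex.real_smul]
    push_cast; ring
  have e2 : ∫ p in {v | IsUnit v} ×ˢ {w | ¬ IsUnit w}, F p ∂((muO u ϖ).prod (muO u ϖ)) =
      (1 - ((rq k : ℂ)⁻¹) ^ 2) * B := by
    rw [setIntegral_prod _ (hi _ inferInstance).integrableOn,
      setIntegral_congr_fun hU (g := fun _ => B) (fun w hw => hB w hw), setIntegral_const,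
      h.muO_units, Complex.real_smul]
    push_cast; ring
  rw [hdec, unitHaar_prod, setIntegral_union _ (hU.prod hN) (hi _ inferInstance).integrableOn
    (hi _ inferInstance).integrableOn, e1, e2]
  · ring
  · rw [Set.disjoint_left]
    rintro p ⟨-, h1⟩ ⟨-, h2⟩
    exact h2 h1

theorem IsDatum.setIntegral_nonunits_const :
    ∫ _ in {w : MaxOrder u ϖ | ¬ IsUnit w}, (1 : ℂ) ∂(muO u ϖ) = ((rq k : ℂ)⁻¹) ^ 2 := by
  rw [setIntegral_const, h.muO_nonunits, Complex.real_smul]; push_cast; ring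

theorem IsDatum.primVec_volume :
    ((unitHaar (MaxOrder u ϖ × MaxOrder u ϖ)).real (primVec u ϖ) : ℂ) =
      (1 - ((rq k : ℂ)⁻¹) ^ 2) * (1 + ((rq k : ℂ)⁻¹) ^ 2) := by
  have e := h.setIntegral_primVec (fun _ => 1) measurable_const (by simp) 1 (((rq k : ℂ)⁻¹) ^ 2)
    (fun w _ => by simp) (fun v _ => h.setIntegral_nonunits_const)
  rw [← e, setIntegral_const]; simp

end Average

end QuatHerm

/-! ### Averages of powers of a form -/

namespace QuatHerm

variable {k : Type*} [NontriviallyNormedField k] [IsUltrametricDist k] [ProperSpace k]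
  [MeasurableSpace k] [BorelSpace k] {u ϖ : 𝒪[k]}

open Classical in
/-- The power `|t|^s`, set to zero at `t = 0`. -/
noncomputable def absPow (s : ℂ) (t : k) : ℂ := if t = 0 then 0 else (‖t‖ : ℂ) ^ s

theorem absPow_mul (s : ℂ) (a b : k) : absPow s (a * b) = absPow s a * absPow s b := by
  unfold absPow
  by_cases ha : a = 0
  · simp [ha]
  by_cases hb : b = 0
  · simp [hb]
  rw [if_neg ha, if_neg hb, if_neg (mul_ne_zero ha hb), norm_mul, Complex.ofReal_mul,
    Complex.mul_cpow_ofReal_nonneg (norm_nonneg _) (norm_nonneg _)]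

theorem absPow_of_norm_eq_one (s : ℂ) {a : k} (ha : ‖a‖ = 1) : absPow s a = 1 := by
  have : a ≠ 0 := by rw [← norm_pos_iff, ha]; exact one_pos
  rw [absPow, if_neg this, ha]; simp

theorem absPow_zpow (s : ℂ) {a : k} (ha : a ≠ 0) (n : ℤ) : absPow s (a ^ n) = absPow s a ^ n := by
  have h0 : (‖a‖ : ℂ) ≠ 0 := by exact_mod_cast (norm_pos_iff.2 ha).ne'
  rw [absPow, absPow, if_neg ha, if_neg (zpow_ne_zero _ ha), norm_zpow,
    Complex.cpow_def_of_ne_zero (by exact_mod_cast (zpow_pos (norm_pos_iff.2 ha) n).ne'),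
    Complex.cpow_def_of_ne_zero h0, ← Complex.ofReal_log (by positivity),
    ← Complex.ofReal_log (by positivity), Real.log_zpow, ← Complex.exp_int_mul]
  congr 1; push_cast; ring

theorem measurable_absPow (s : ℂ) : Measurable (absPow s : k → ℂ) := by
  unfold absPow
  refine Measurable.ite (measurableSet_eq_fun measurable_id measurable_const) measurable_const ?_
  exact (Complex.measurable_ofReal.comp measurable_norm).pow_const s

theorem norm_absPow_le_one {s : ℂ} (hs : 0 ≤ s.re) {t : k} (ht : ‖t‖ ≤ 1) : ‖absPow s t‖ ≤ 1 := by
  unfold absPow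
  split_ifs with h0
  · simp
  · rw [Complex.norm_cpow_eq_rpow_re_of_pos (norm_pos_iff.2 h0)]
    exact Real.rpow_le_one (norm_nonneg _) ht hs

/-- The power function on the ring of integers. -/
noncomputable def intPow (s : ℂ) (t : 𝒪[k]) : ℂ := absPow s (t : k)

theorem measurable_intPow (s : ℂ) : Measurable (intPow s : 𝒪[k] → ℂ) :=
  (measurable_absPow s).comp measurable_subtype_coe

theorem norm_intPow_le_one {s : ℂ} (hs : 0 ≤ s.re) (t : 𝒪[k]) : ‖intPow s t‖ ≤ 1 :=
  norm_absPow_le_one hs (norm_coe_le_one t)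

theorem intPow_mul (s : ℂ) (a b : 𝒪[k]) : intPow s (a * b) = intPow s a * intPow s b :=
  absPow_mul s _ _

theorem intPow_of_isUnit (s : ℂ) {a : 𝒪[k]} (ha : IsUnit a) : intPow s a = 1 :=
  absPow_of_norm_eq_one s (isUnit_int_iff.1 ha)

/-- The value of an integral form at an integral row vector. -/
noncomputable def intValue (a d : 𝒪[k]) (β : MaxOrder u ϖ) (p : MaxOrder u ϖ × MaxOrder u ϖ) : 𝒪[k] :=
  a * nr p.1 + d * nr p.2 + 2 * (p.1 * β * star p.2).re

theorem continuous_intValue (a d : 𝒪[k]) (β : MaxOrder u ϖ) : Continuous (intValue a d β) := by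
  have h1 : Continuous fun p : MaxOrder u ϖ × MaxOrder u ϖ => nr p.1 :=
    continuous_nr.comp continuous_fst
  have h2 : Continuous fun p : MaxOrder u ϖ × MaxOrder u ϖ => nr p.2 :=
    continuous_nr.comp continuous_snd
  have h3 : Continuous fun p : MaxOrder u ϖ × MaxOrder u ϖ => (p.1 * β * star p.2).re :=
    continuous_re.comp ((continuous_fst.mul continuous_const).mul
      (continuous_quat_star.comp continuous_snd))
  exact ((continuous_const.mul h1).add (continuous_const.mul h2)).add (continuous_const.mul h3)

/-- The average of the power function of an integral form over `K`. -/
noncomputable def formAverage (s : ℂ) (a d : 𝒪[k]) (β : MaxOrder u ϖ) : ℂ :=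
  ∫ κ, intPow s (intValue a d β κ.row) ∂(GLO.haar u ϖ)

theorem re_mul_comm {R : Type*} [CommRing R] {a b : R} (α β : ℍ[R,a,b]) :
    (α * β).re = (β * α).re := by
  simp only [QuaternionAlgebra.re_mul]; ring

theorem star_re {R : Type*} [CommRing R] {a b : R} (α : ℍ[R,a,b]) : (star α).re = α.re := by
  simp

variable (h : IsDatum u ϖ)
include h

/-- The volume of the primitive vectors contains the same factor $1-q^{-2}$ as the integral over
them; cancelling it leaves $1+q^{-2}$. -/
theorem IsDatum.formAverage_eq {s : ℂ} (hs : 0 ≤ s.re) (a d : 𝒪[k]) (β : MaxOrder u ϖ) (A B : ℂ)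
    (hA : ∀ w, IsUnit w → ∫ v, intPow s (intValue a d β (v, w)) ∂(muO u ϖ) = A)
    (hB : ∀ v, IsUnit v →
      ∫ w in {w | ¬ IsUnit w}, intPow s (intValue a d β (v, w)) ∂(muO u ϖ) = B) :
    (1 + ((rq k : ℂ)⁻¹) ^ 2) * formAverage s a d β = A + B := by
  have hm : Measurable fun p => intPow s (intValue a d β p) :=
    (measurable_intPow s).comp (continuous_intValue a d β).measurable
  have hb : ∀ p, ‖intPow s (intValue a d β p)‖ ≤ 1 := fun p => norm_intPow_le_one hs _
  have e := h.average_row _ hm hb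
  rw [h.setIntegral_primVec _ hm hb A B hA hB, h.primVec_volume, mul_assoc] at e
  refine mul_left_cancel₀ ?_ e
  have hq := one_lt_rq (k := k)
  have : (1 - ((rq k)⁻¹) ^ 2 : ℝ) ≠ 0 := by
    have h1 : (rq k)⁻¹ < 1 := inv_lt_one_of_one_lt₀ hq
    have h2 : 0 < (rq k)⁻¹ := inv_pos.2 rq_pos
    nlinarith
  exact_mod_cast this

/-- The integral of the power function over the ring of integers. -/
theorem IsDatum.integral_intPow {s : ℂ} (hs : 0 ≤ s.re) :
    (1 - (rq k : ℂ)⁻¹ * absPow s (ϖ : k)) * ∫ t, intPow s t ∂(lam k) = 1 - (rq k : ℂ)⁻¹ := by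
  have hi : Integrable (intPow s) (lam k) :=
    Integrable.of_bound (measurable_intPow s).aestronglyMeasurable 1
      (Filter.Eventually.of_forall (norm_intPow_le_one hs))
  have e := integral_add_compl (measurableSet_units_int (k := k)) hi
  rw [setIntegral_congr_fun measurableSet_units_int (g := fun _ => (1 : ℂ))
    (fun t ht => intPow_of_isUnit s ht), setIntegral_const, lam_units] at e
  have e2 : ({x : 𝒪[k] | IsUnit x})ᶜ = {x : 𝒪[k] | ¬ IsUnit x} := rfl
  rw [e2, h.setIntegral_nonunits_int] at e
  simp only [intPow_mul, integral_const_mul, Complex.real_smul] at e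
  push_cast at e
  have e3 : intPow s ϖ = absPow s (ϖ : k) := rfl
  rw [e3] at e
  linear_combination -e

/-- The integrals of `|N(v) + γ|^s` over the maximal order satisfy a recursion. -/
theorem IsDatum.integral_nr_add {s : ℂ} (hs : 0 ≤ s.re) (γ : 𝒪[k]) :
    ∫ v, intPow s (nr v + γ * ϖ) ∂(muO u ϖ) = 1 - ((rq k : ℂ)⁻¹) ^ 2 +
      ((rq k : ℂ)⁻¹) ^ 2 * absPow s (ϖ : k) * ∫ v, intPow s (nr v + (-γ)) ∂(muO u ϖ) := by
  have hi : Integrable (fun v => intPow s (nr v + γ * ϖ)) (muO u ϖ) :=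
    Integrable.of_bound ((measurable_intPow s).comp
      (continuous_nr.add continuous_const).measurable).aestronglyMeasurable 1
      (Filter.Eventually.of_forall fun _ => norm_intPow_le_one hs _)
  have e := integral_add_compl (measurableSet_units_order (u := u) (ϖ := ϖ)) hi
  rw [setIntegral_congr_fun measurableSet_units_order (g := fun _ => (1 : ℂ)) (fun v hv => by
    refine intPow_of_isUnit s ?_
    rw [isUnit_int_iff]
    push_cast
    have hv1 : ‖((nr v : 𝒪[k]) : k)‖ = 1 := isUnit_int_iff.1 ((isUnit_iff_isUnit_nr v).1 hv)
    rw [add_norm_eq_left, hv1]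
    rw [hv1, norm_mul]
    exact (mul_le_of_le_one_left (norm_nonneg _) (norm_coe_le_one γ)).trans_lt h.norm_lt_one),
    setIntegral_const, h.muO_units] at e
  have e2 : ({x : MaxOrder u ϖ | IsUnit x})ᶜ = {x : MaxOrder u ϖ | ¬ IsUnit x} := rfl
  rw [e2, h.setIntegral_nonunits_order] at e
  -- As $N(\Pi)=-\varpi$, a factor $-\varpi$ comes out and the sign of $\gamma$ is reversed.
  have e3 : ∀ v : MaxOrder u ϖ, intPow s (nr (piO u ϖ * v) + γ * ϖ) =
      absPow s (ϖ : k) * intPow s (nr v + (-γ)) := by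
    intro v
    have : nr (piO u ϖ * v) + γ * ϖ = (-1) * (ϖ * (nr v + (-γ))) := by
      rw [nr_mul]
      have : nr (piO u ϖ) = -ϖ := by simp [nr, piO]
      rw [this]; ring
    rw [this, intPow_mul, intPow_mul, intPow_of_isUnit s (a := -1) isUnit_one.neg, one_mul]
    rfl
  simp only [e3, integral_const_mul, Complex.real_smul] at e
  push_cast at e ⊢
  rw [← e]; ring

/-- For a unit $w$, replacing $v$ by $vw$ pulls out the unit $N(w)$. When $v$ is a unit and $w$ is
not, the value is a unit, so this region contributes only its volume $q^{-2}$. -/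
theorem IsDatum.formAverage_diag {s : ℂ} (hs : 0 ≤ s.re) (γ : 𝒪[k]) :
    (1 + ((rq k : ℂ)⁻¹) ^ 2) * formAverage s 1 γ (0 : MaxOrder u ϖ) =
      ∫ v, intPow s (nr v + γ) ∂(muO u ϖ) + ((rq k : ℂ)⁻¹) ^ 2 := by
  refine h.formAverage_eq hs _ _ _ _ _ ?_ ?_
  · rintro w ⟨w, rfl⟩
    rw [← integral_order_mul_right w]
    refine integral_congr_ae (Filter.Eventually.of_forall fun v => ?_)
    have : intValue 1 γ (0 : MaxOrder u ϖ) (v * w, (w : MaxOrder u ϖ)) =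
        nr (w : MaxOrder u ϖ) * (nr v + γ) := by
      simp only [intValue, nr_mul]; simp; ring
    simp only [this, intPow_mul]
    rw [intPow_of_isUnit s ((isUnit_iff_isUnit_nr _).1 w.isUnit), one_mul]
  · intro v hv
    rw [← h.setIntegral_nonunits_const]
    refine setIntegral_congr_fun measurableSet_nonunits_order fun w hw => ?_
    refine intPow_of_isUnit s ?_
    rw [isUnit_int_iff]
    simp only [intValue]
    push_cast
    have hv1 : ‖((nr v : 𝒪[k]) : k)‖ = 1 := isUnit_int_iff.1 ((isUnit_iff_isUnit_nr v).1 hv)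
    have hw1 : ‖((nr w : 𝒪[k]) : k)‖ < 1 := by
      have := not_isUnit_order_iff.1 hw
      rwa [nr_orderIncl] at this
    simp only [mul_zero, zero_mul, QuaternionAlgebra.re_zero, ZeroMemClass.coe_zero, add_zero,
      one_mul]
    rw [add_norm_eq_left, hv1]
    rw [hv1, norm_mul]
    exact (mul_le_of_le_one_left (norm_nonneg _) (norm_coe_le_one γ)).trans_lt hw1

/-- The value $2\,\mathrm{Re}(vw^*)$ is additive in either variable. A unit in the other variable is
absorbed by substitution, leaving an integral over one coordinate; non-units, written as multiples
of $\Pi$, contribute the extra factor $q^{-2}|\varpi|^s$. -/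
theorem IsDatum.formAverage_hyperbolic {s : ℂ} (hs : 0 ≤ s.re) :
    (1 + ((rq k : ℂ)⁻¹) ^ 2) * formAverage s 0 0 (1 : MaxOrder u ϖ) =
      (∫ t, intPow s t ∂(lam k)) * (1 + ((rq k : ℂ)⁻¹) ^ 2 * absPow s (ϖ : k)) := by
  have two : ∀ t : 𝒪[k], intPow s (2 * t) = intPow s t := fun t => by
    rw [intPow_mul, intPow_of_isUnit s (a := 2), one_mul]
    rw [isUnit_int_iff]; exact h.two
  have e := h.formAverage_eq hs 0 0 (1 : MaxOrder u ϖ) (∫ t, intPow s t ∂(lam k))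
    (((rq k : ℂ)⁻¹) ^ 2 * absPow s (ϖ : k) * ∫ t, intPow s t ∂(lam k)) ?_ ?_
  · rw [e]; ring
  · rintro w hw
    have hw' : IsUnit (star w) := by rw [isUnit_iff_isUnit_nr, nr_star, ← isUnit_iff_isUnit_nr]; exact hw
    obtain ⟨w', hw'⟩ := hw'
    have : ∀ v, intPow s (intValue 0 0 1 (v, w)) = (fun α : MaxOrder u ϖ => intPow s α.re) (v * w') := by
      intro v
      simp only [intValue, ← hw', mul_one, zero_mul, zero_add, two]
    simp only [this]
    rw [integral_order_mul_right w' (fun α => intPow s α.re)]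
    exact integral_order_re _ (measurable_intPow s)
  · rintro v hv
    have hv' : IsUnit (star v) := by rw [isUnit_iff_isUnit_nr, nr_star, ← isUnit_iff_isUnit_nr]; exact hv
    obtain ⟨v', hv'⟩ := hv'
    have : ∀ w, intPow s (intValue 0 0 1 (v, w)) = (fun α : MaxOrder u ϖ => intPow s α.re) (w * v') := by
      intro w
      simp only [intValue, hv', mul_one, zero_mul, zero_add, two]
      rw [← star_re (v * star w), star_mul, star_star]
    simp only [this]
    rw [setIntegral_order_mul_right v' (fun α => intPow s α.re), h.setIntegral_nonunits_order]
    have e3 : ∀ w : MaxOrder u ϖ, intPow s (piO u ϖ * w).re = absPow s (ϖ : k) * intPow s w.imJ := by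
      intro w
      have : (piO u ϖ * w).re = ϖ * w.imJ := by simp [piO]
      rw [this, intPow_mul]; rfl
    simp only [e3, integral_const_mul]
    rw [integral_order_imJ _ (measurable_intPow s)]
    push_cast; ring

/-- The entry $\Pi$ makes every value divisible by $\varpi$. The regions of unit and non-unit $w$
give the same one-variable integral with weights $1$ and $q^{-2}$, so the factor $1+q^{-2}$ cancels.
-/
theorem IsDatum.formAverage_anti {s : ℂ} (hs : 0 ≤ s.re) :
    formAverage s 0 0 (piO u ϖ) = absPow s (ϖ : k) * ∫ t, intPow s t ∂(lam k) := by
  have two : ∀ t : 𝒪[k], intPow s (2 * t) = intPow s t := fun t => by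
    rw [intPow_mul, intPow_of_isUnit s (a := 2), one_mul]
    rw [isUnit_int_iff]; exact h.two
  have e := h.formAverage_eq hs 0 0 (piO u ϖ) (absPow s (ϖ : k) * ∫ t, intPow s t ∂(lam k))
    (((rq k : ℂ)⁻¹) ^ 2 * (absPow s (ϖ : k) * ∫ t, intPow s t ∂(lam k))) ?_ ?_
  · have hne : (1 + ((rq k : ℂ)⁻¹) ^ 2) ≠ 0 := by
      have : (1 + ((rq k)⁻¹) ^ 2 : ℝ) ≠ 0 := by positivity
      exact_mod_cast this
    refine mul_left_cancel₀ hne ?_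
    rw [e]; ring
  · rintro w hw
    have hw' : IsUnit (star w) := by rw [isUnit_iff_isUnit_nr, nr_star, ← isUnit_iff_isUnit_nr]; exact hw
    obtain ⟨w', hw'⟩ := hw'
    have : ∀ v, intPow s (intValue 0 0 (piO u ϖ) (v, w)) =
        (fun α : MaxOrder u ϖ => intPow s (ϖ * α.imJ)) (w' * v) := by
      intro v
      simp only [intValue, ← hw', zero_mul, zero_add, two]
      rw [re_mul_comm, ← mul_assoc]
      congr 1
      simp [piO]
    simp only [this]
    rw [integral_order_mul_left w' (fun α => intPow s (ϖ * α.imJ))]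
    simp only [intPow_mul, integral_const_mul]
    rw [integral_order_imJ _ (measurable_intPow s)]
    rfl
  · rintro v hv
    have hv' : IsUnit (star v) := by rw [isUnit_iff_isUnit_nr, nr_star, ← isUnit_iff_isUnit_nr]; exact hv
    obtain ⟨v', hv'⟩ := hv'
    have : ∀ w, intPow s (intValue 0 0 (piO u ϖ) (v, w)) =
        (fun α : MaxOrder u ϖ => intPow s ((-1) * (piO u ϖ * α).re)) (v' * w) := by
      intro w
      simp only [intValue, zero_mul, zero_add, two]
      congr 1
      rw [hv']
      simp [piO]
      ring
    simp only [this]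
    rw [setIntegral_order_mul_left v' (fun α => intPow s ((-1) * (piO u ϖ * α).re)),
      h.setIntegral_nonunits_order]
    have e3 : ∀ w : MaxOrder u ϖ, intPow s ((-1) * (piO u ϖ * (piO u ϖ * w)).re) =
        absPow s (ϖ : k) * intPow s w.re := by
      intro w
      have : (-1) * (piO u ϖ * (piO u ϖ * w)).re = (-1) * (ϖ * w.re) := by simp [piO]
      rw [this, intPow_mul, intPow_mul, intPow_of_isUnit s (a := -1) isUnit_one.neg, one_mul]; rfl
    simp only [e3, integral_const_mul]
    rw [integral_order_re _ (measurable_intPow s)]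
    push_cast; ring

end QuatHerm

/-! ### Explicit spherical functions -/

namespace QuatHerm

open HermSpace

/-! ### The polynomials produced by the recursion for the averages -/

section Polynomials

open Polynomial

/-- The polynomials describing the spherical functions on the diagonal orbits. -/
noncomputable def sphPoly (q : ℝ) : ℕ → ℝ[X]
  | 0 => C (1 - q⁻¹) * (1 + X)
  | n + 1 => (1 - C q * X) * (1 - C (q⁻¹ ^ 2) * X) + X * sphPoly q n

/-- The value of `sphPoly` at a complex number. -/
noncomputable def sphEval (q : ℝ) (n : ℕ) (W : ℂ) : ℂ := aeval W (sphPoly q n)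

theorem sphEval_zero (q : ℝ) (W : ℂ) : sphEval q 0 W = (1 - (q : ℂ)⁻¹) * (1 + W) := by
  simp [sphEval, sphPoly]

theorem sphEval_succ (q : ℝ) (n : ℕ) (W : ℂ) :
    sphEval q (n + 1) W = (1 - q * W) * (1 - (q : ℂ)⁻¹ ^ 2 * W) + W * sphEval q n W := by
  simp [sphEval, sphPoly]

end Polynomials

/-- The part of the spherical function depending on `Z = q^y`. -/
noncomputable def orbFun (q : ℝ) : OrbitIndex → ℂ → ℂ
  | .diag _ n, Z => (q : ℂ)⁻¹ ^ n * Z ^ (n + 1) * sphEval q n (Z⁻¹ ^ 2) / (1 + (q : ℂ)⁻¹ ^ 2)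
  | .anti _, _ => q - 1

/-- The explicit formula for the normalized spherical functions. -/
noncomputable def psiFun (q : ℕ) (τ : OrbitIndex) (x y : ℂ) : ℂ :=
  (q : ℂ) ^ ((τ.ordDisc + 1 : ℂ) * x) * orbFun q τ ((q : ℂ) ^ y)

variable {k : Type*} [NontriviallyNormedField k] [IsUltrametricDist k] [ProperSpace k]
  [MeasurableSpace k] [BorelSpace k] {u ϖ : 𝒪[k]}

/-- The average of `|d₁|^s` over the orbit of a form. -/
noncomputable def avgFst (s : ℂ) (x : HermSpace u ϖ) : ℂ :=
  ∫ κ, absPow s (actK κ x).fst ∂(GLO.haar u ϖ)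

theorem avgFst_of_equiv (s : ℂ) {x y : HermSpace u ϖ} (hxy : KEquiv x y) :
    avgFst s x = avgFst s y := by
  obtain ⟨κ₀, rfl⟩ := hxy
  unfold avgFst
  rw [← integral_mul_right_eq_self (μ := GLO.haar u ϖ) (fun κ => absPow s (actK κ x).fst) κ₀]
  simp only [actK_mul]

variable (h : IsDatum u ϖ)
include h

theorem IsDatum.avgFst_eq (s : ℂ) (x : HermSpace u ϖ) (c : k) (a d : 𝒪[k]) (β : MaxOrder u ϖ)
    (h1 : x.fst = c * a) (h2 : x.snd = c * d) (h3 : x.off = c • orderIncl u ϖ β) :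
    avgFst s x = absPow s c * formAverage s a d β := by
  unfold avgFst formAverage
  rw [← integral_const_mul]
  congr 1
  ext κ
  rw [intPow, ← absPow_mul, (h.actK_coord κ x).1]
  congr 1
  have e0 : κ.toMat 0 0 = orderIncl u ϖ (κ.entry 0 0) := rfl
  have e1 : κ.toMat 0 1 = orderIncl u ϖ (κ.entry 0 1) := rfl
  rw [value, e0, e1, h1, h2, h3, nr_orderIncl, nr_orderIncl, mul_smul_comm, smul_mul_assoc,
    QuaternionAlgebra.re_smul, ← orderIncl_star, ← map_mul, ← map_mul]
  have e2 : ∀ α : MaxOrder u ϖ, (orderIncl u ϖ α).re = (α.re : k) := fun _ => rfl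
  rw [e2]
  have e3 : ((2 : 𝒪[k]) : k) = 2 := rfl
  simp only [intValue, GLO.row]
  push_cast
  rw [smul_eq_mul, e3]
  ring

/-- The absolute value of the discriminant is constant on the orbit and never zero, so only $|d_1|$
has to be averaged. -/
theorem IsDatum.omegaInt_eq (x : HermSpace u ϖ) (s : Fin 2 → ℂ) :
    omegaInt x s = avgFst (s 0) x * (‖x.disc‖ : ℂ) ^ s 1 := by
  unfold omegaInt avgFst
  rw [← integral_mul_const]
  congr 1
  ext κ
  have hd := norm_ne_zero_iff.2 (h.disc_ne_zero (actK κ x))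
  unfold absInvPow absPow
  simp only [Fin.forall_fin_two, Fin.prod_univ_two, h.absInv_zero, h.absInv_one,
    h.norm_disc_actK] at hd ⊢
  by_cases h0 : (actK κ x).fst = 0
  · simp [h0]
  · simp [h0, hd]

/-- The form $\mathrm{diag}(1,\gamma)$ with $\gamma$ a unit has the discriminant and size of the
hyperbolic plane, hence lies in its orbit. This evaluates $\int|N(v)+\gamma|^s\,dv$ without counting
solutions of congruences. -/
theorem IsDatum.formAverage_diag_unit (s : ℂ) {γ : 𝒪[k]} (hγ : IsUnit γ) :
    formAverage s 1 γ (0 : MaxOrder u ϖ) = formAverage s 0 0 (1 : MaxOrder u ϖ) := by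
  have hγ1 : ‖(γ : k)‖ = 1 := isUnit_int_iff.1 hγ
  let x : HermSpace u ϖ := ofCoord 1 (γ : k) 0 (by
    simp only [nr_zero, sub_zero, one_mul]
    rw [← norm_pos_iff, hγ1]; exact one_pos)
  let y : HermSpace u ϖ := ofCoord 0 0 1 (by simp)
  have hx : x ∈ level u ϖ (.diag 0 0) := by
    constructor
    · simp [x, disc, hγ1, OrbitIndex.ordDisc]
    · simp [x, size, hγ1, OrbitIndex.ordSize]
  have hy : y ∈ level u ϖ (.diag 0 0) := by
    constructor
    · simp [y, disc, OrbitIndex.ordDisc]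
    · simp [y, size, OrbitIndex.ordSize]
  have hxy : KEquiv x y := (h.mem_level_iff.1 hx).trans (h.mem_level_iff.1 hy).symm
  have e1 := h.avgFst_eq s x 1 1 γ 0 (by simp [x]) (by simp [x]) (by simp [x])
  have e2 := h.avgFst_eq s y 1 0 0 1 (by simp [y]) (by simp [y]) (by simp [y])
  rw [absPow_of_norm_eq_one s norm_one, one_mul] at e1 e2
  rw [← e1, ← e2, avgFst_of_equiv s hxy]

/-- Adding $q^{-2}$ and clearing the denominator turns the integral recursion into the defining
recursion of `sphPoly`. All units $\gamma$ are treated together because the recursion replaces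
$\gamma$ by $-\gamma$. -/
theorem IsDatum.integral_nr_add_pow {s : ℂ} (hs : 0 ≤ s.re) (n : ℕ) :
    ∀ γ : 𝒪[k], IsUnit γ →
    (1 - (rq k : ℂ)⁻¹ * absPow s (ϖ : k)) *
      (∫ v, intPow s (nr v + γ * ϖ ^ n) ∂(muO u ϖ) + ((rq k : ℂ)⁻¹) ^ 2) =
      sphEval (rq k) n (((rq k : ℂ)⁻¹) ^ 2 * absPow s (ϖ : k)) := by
  have hq : (rq k : ℂ) ≠ 0 := by exact_mod_cast rq_pos.ne'
  induction n with
  | zero =>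
    intro γ hγ
    rw [pow_zero, mul_one, ← h.formAverage_diag hs, h.formAverage_diag_unit s hγ,
      h.formAverage_hyperbolic hs, sphEval_zero, ← mul_assoc, h.integral_intPow hs]
  | succ n ih =>
    intro γ hγ
    have e := h.integral_nr_add hs (γ * ϖ ^ n)
    rw [mul_assoc, ← pow_succ] at e
    have ih' := ih (-γ) hγ.neg
    rw [e, sphEval_succ, ← ih', ← neg_mul]
    field_simp
    ring

theorem IsDatum.avgFst_diag {s : ℂ} (hs : 0 ≤ s.re) (i : ℤ) (n : ℕ) :
    (1 + ((rq k : ℂ)⁻¹) ^ 2) * (1 - (rq k : ℂ)⁻¹ * absPow s (ϖ : k)) *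
      avgFst s (h.rep (.diag i n)) = absPow s (ϖ : k) ^ i *
        sphEval (rq k) n (((rq k : ℂ)⁻¹) ^ 2 * absPow s (ϖ : k)) := by
  have e := h.avgFst_eq s (h.rep (.diag i n)) (ϖ ^ i) 1 (ϖ ^ n) 0 (by simp [rep])
    (by simp [rep, zpow_add₀ h.ne_zero]) (by simp [rep])
  have e2 := h.integral_nr_add_pow hs n 1 isUnit_one
  rw [one_mul, ← h.formAverage_diag hs] at e2
  rw [e, absPow_zpow s h.ne_zero, ← e2]
  ring

theorem IsDatum.avgFst_anti {s : ℂ} (hs : 0 ≤ s.re) (e : ℤ) :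
    (1 - (rq k : ℂ)⁻¹ * absPow s (ϖ : k)) *
      avgFst s (h.rep (.anti e)) = absPow s (ϖ : k) ^ (e + 1) * (1 - (rq k : ℂ)⁻¹) := by
  have e1 := h.avgFst_eq s (h.rep (.anti e)) (ϖ ^ e) 0 0 (piO u ϖ) (by simp [rep])
    (by simp [rep]) (by
      simp only [rep, off_ofCoord]
      ext <;> simp [antiEntry, orderIncl, piO])
  have hX : absPow s (ϖ : k) ≠ 0 := by
    rw [absPow, if_neg h.ne_zero, Complex.cpow_def_of_ne_zero
      (by exact_mod_cast (norm_pos_iff.2 h.ne_zero).ne')]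
    exact Complex.exp_ne_zero _
  rw [e1, absPow_zpow s h.ne_zero, h.formAverage_anti hs, ← h.integral_intPow hs,
    zpow_add_one₀ hX]
  ring

/-- On the domain of convergence the normalized spherical function has the explicit form. -/
theorem IsDatum.psiFun_eq {τ : OrbitIndex} {x : HermSpace u ϖ} (hx : x ∈ level u ϖ τ)
    (z : Fin 2 → ℂ) (hz : 0 ≤ (sVar z 0).re) :
    psiFun (resCard k) τ ((z 0 + z 1) / 2) ((z 1 - z 0) / 2) =
      normFactor (resCard k) z * omegaInt x (sVar z) := by
  have hq0 : (0 : ℝ) < rq k := rq_pos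
  have hq : (resCard k : ℂ) ≠ 0 := by
    have : (rq k) ≠ 0 := hq0.ne'
    exact_mod_cast this
  set q : ℂ := (resCard k : ℂ) with hqdef
  set X := (z 0 + z 1) / 2 with hX
  set Y := (z 1 - z 0) / 2 with hY
  have hz0 : z 0 = X - Y := by rw [hX, hY]; ring
  have hz1 : z 1 = X + Y := by rw [hX, hY]; ring
  have hs0 : sVar z 0 = 2 * Y - 2 := by simp [sVar, hz0, hz1]; ring
  have hs1 : sVar z 1 = 1 - X - Y := by simp [sVar, hz1]; ring
  have hZ : q ^ Y ≠ 0 := by rw [Complex.cpow_def_of_ne_zero hq]; exact Complex.exp_ne_zero _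
  have hrq : ((rq k : ℝ) : ℂ) = q := by simp [hqdef]
  -- Here $s_1=2y-2$, so $|\varpi|^{s_1}=q^2q^{-2y}$ and the argument $q^{-2}|\varpi|^{s_1}$ of
  -- `sphEval` is $q^{-2y}$.
  have habs : absPow (sVar z 0) (ϖ : k) = q ^ 2 * ((q ^ Y)⁻¹) ^ 2 := by
    rw [absPow, if_neg h.ne_zero, h.norm_eq, hs0]
    push_cast
    rw [← hqdef, Complex.inv_cpow _ _ (by
      rw [hqdef, Complex.natCast_arg]; exact Real.pi_pos.ne), Complex.cpow_sub _ _ hq,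
      mul_comm 2 Y, Complex.cpow_mul_ofNat, Complex.cpow_ofNat]
    field_simp
  have hdisc : (‖x.disc‖ : ℂ) ^ sVar z 1 = q ^ (τ.ordDisc * X) * (q ^ Y) ^ τ.ordDisc *
      q ^ (-τ.ordDisc) := by
    rw [hx.1, hs1]
    push_cast
    rw [← hqdef, Complex.cpow_def_of_ne_zero (zpow_ne_zero _ hq), ← Complex.cpow_intCast q,
      Complex.cpow_def_of_ne_zero hq, Complex.cpow_def_of_ne_zero hq,
      Complex.cpow_def_of_ne_zero hq, ← Complex.exp_int_mul, ← Complex.exp_add, ← Complex.exp_add]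
    -- The exponent is real, so the principal logarithm undoes the exponential.
    have hl : Complex.log (Complex.exp (Complex.log q * ((-τ.ordDisc : ℤ) : ℂ))) =
        Complex.log q * ((-τ.ordDisc : ℤ) : ℂ) := by
      have : Complex.log q * ((-τ.ordDisc : ℤ) : ℂ) = ((Real.log (rq k) * (-τ.ordDisc : ℤ) : ℝ) : ℂ) := by
        rw [← hrq, ← Complex.ofReal_log hq0.le]; push_cast; ring
      rw [this, ← Complex.ofReal_exp, ← Complex.ofReal_log (Real.exp_pos _).le, Real.log_exp]
    rw [hl]
    congr 1; push_cast; ring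
  -- The normalizing factor contains $1-q\cdot q^{-2y}$, the denominator of the average of
  -- $|d_1|^{s_1}$; this is what makes the product entire.
  have hnf : normFactor (resCard k) z = q ^ X * (q ^ Y * (1 - q * (q ^ Y)⁻¹ ^ 2)) := by
    rw [normFactor, hz0, hz1, ← hqdef, Complex.cpow_add _ _ hq,
      show X - Y + 1 = X + (-Y) + 1 by ring, Complex.cpow_add _ _ hq, Complex.cpow_add _ _ hq,
      Complex.cpow_neg, Complex.cpow_one]
    field_simp
  have hW : ((rq k : ℂ)⁻¹) ^ 2 * absPow (sVar z 0) (ϖ : k) = (q ^ Y)⁻¹ ^ 2 := by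
    rw [habs, hrq]; field_simp
  have hqW : (1 - (rq k : ℂ)⁻¹ * absPow (sVar z 0) (ϖ : k)) = 1 - q * (q ^ Y)⁻¹ ^ 2 := by
    rw [habs, hrq]; field_simp
  have hsplit : q ^ ((τ.ordDisc + 1 : ℂ) * X) = q ^ (τ.ordDisc * X) * q ^ X := by
    rw [add_mul, one_mul, Complex.cpow_add _ _ hq]
  rw [h.omegaInt_eq, avgFst_of_equiv _ (h.mem_level_iff.1 hx), hdisc, hnf, psiFun, ← hqdef, hsplit]
  have h1q : (1 + q⁻¹ ^ 2) ≠ 0 := by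
    have : (1 + ((rq k)⁻¹) ^ 2 : ℝ) ≠ 0 := by positivity
    rw [← hrq]
    exact_mod_cast this
  cases τ with
  | diag i n =>
    have e := h.avgFst_diag hz i n
    rw [hW, hqW, habs, hrq] at e
    simp only [orbFun, OrbitIndex.ordDisc]
    have hc : ((resCard k : ℝ) : ℂ) = q := hrq
    rw [hc]
    have e' : avgFst (sVar z 0) (h.rep (.diag i n)) * (1 - q * (q ^ Y)⁻¹ ^ 2) =
        (q ^ 2 * (q ^ Y)⁻¹ ^ 2) ^ i * sphEval (rq k) n ((q ^ Y)⁻¹ ^ 2) / (1 + q⁻¹ ^ 2) := by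
      rw [eq_div_iff h1q, ← e]; ring
    -- The powers depending on $i$ coming from the two invariants cancel, so the factor in $q^y$
    -- depends only on $n$.
    have e3 : (q ^ 2 * (q ^ Y)⁻¹ ^ 2) ^ i * (q ^ Y) ^ (2 * i + (n : ℤ)) * q ^ (-(2 * i + (n : ℤ))) =
        q⁻¹ ^ n * (q ^ Y) ^ n := by
      rw [mul_zpow, neg_add, zpow_add₀ hZ, zpow_add₀ hq, zpow_mul, zpow_neg q (2 * i), zpow_mul q,
        inv_pow, inv_zpow, zpow_neg, zpow_natCast, zpow_natCast, zpow_ofNat, zpow_ofNat]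
      have a1 := zpow_ne_zero i (pow_ne_zero 2 hq)
      have a2 := zpow_ne_zero i (pow_ne_zero 2 hZ)
      rw [inv_pow q n]
      field_simp
    calc _ = q ^ (((2 * i + n : ℤ) : ℂ) * X) * q ^ X * (q ^ Y) *
          ((q⁻¹ ^ n * (q ^ Y) ^ n) * (sphEval (rq k) n ((q ^ Y)⁻¹ ^ 2) / (1 + q⁻¹ ^ 2))) := by
            rw [pow_succ]; ring
      _ = q ^ (((2 * i + n : ℤ) : ℂ) * X) * q ^ X * (q ^ Y) * ((q ^ Y) ^ (2 * i + (n : ℤ)) *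
          q ^ (-(2 * i + (n : ℤ))) * ((q ^ 2 * (q ^ Y)⁻¹ ^ 2) ^ i *
            sphEval (rq k) n ((q ^ Y)⁻¹ ^ 2) / (1 + q⁻¹ ^ 2))) := by
            rw [← e3]; ring
      _ = _ := by rw [← e']; ring
  | anti e =>
    have e1 := h.avgFst_anti hz e
    rw [hqW, habs, hrq] at e1
    simp only [orbFun, OrbitIndex.ordDisc]
    have hc : ((resCard k : ℝ) : ℂ) = q := hrq
    rw [hc]
    -- On an antidiagonal orbit every power of $q^y$ cancels and the constant $q$ remains.
    have e3 : (q ^ 2 * (q ^ Y)⁻¹ ^ 2) ^ (e + 1) * ((q ^ Y) ^ (2 * e + 1) * q ^ (-(2 * e + 1))) *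
        q ^ Y = q := by
      rw [mul_zpow, neg_add, zpow_add₀ hZ, zpow_add₀ hq, zpow_mul, zpow_neg q (2 * e), zpow_mul q,
        inv_pow, inv_zpow, zpow_neg_one, zpow_one, zpow_ofNat, zpow_ofNat, zpow_add_one₀
        (pow_ne_zero 2 hq), zpow_add_one₀ (pow_ne_zero 2 hZ)]
      have a1 := zpow_ne_zero e (pow_ne_zero 2 hq)
      have a2 := zpow_ne_zero e (pow_ne_zero 2 hZ)
      field_simp
    have e4 : q * (1 - q⁻¹) = q - 1 := by rw [mul_sub, mul_inv_cancel₀ hq, mul_one]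
    rw [← e4]
    calc _ = q ^ (((2 * e + 1 : ℤ) : ℂ) * X) * q ^ X *
          (((q ^ 2 * (q ^ Y)⁻¹ ^ 2) ^ (e + 1) * ((q ^ Y) ^ (2 * e + 1) * q ^ (-(2 * e + 1))) *
            q ^ Y) * (1 - q⁻¹)) := by rw [e3]
      _ = q ^ (((2 * e + 1 : ℤ) : ℂ) * X) * q ^ X * (((q ^ Y) ^ (2 * e + 1) *
          q ^ (-(2 * e + 1))) * q ^ Y * ((q ^ 2 * (q ^ Y)⁻¹ ^ 2) ^ (e + 1) * (1 - q⁻¹))) := by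
            ring
      _ = _ := by rw [← e1]; ring

end QuatHerm

/-! ### Analytic continuation -/

namespace QuatHerm

open HermSpace

theorem differentiable_sphEval (q : ℝ) (n : ℕ) : Differentiable ℂ (sphEval q n) := by
  unfold sphEval
  exact Polynomial.differentiable_aeval _

theorem differentiableAt_orbFun (q : ℝ) (τ : OrbitIndex) {Z : ℂ} (hZ : Z ≠ 0) :
    DifferentiableAt ℂ (orbFun q τ) Z := by
  cases τ with
  | diag i n =>
    unfold orbFun
    refine DifferentiableAt.div_const (DifferentiableAt.mul (by fun_prop) ?_) _
    exact ((differentiable_sphEval q n) _).comp Z ((differentiableAt_id.inv hZ).pow 2)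
  | anti e => exact differentiableAt_const _

theorem natCast_cpow_ne_zero {q : ℕ} (hq : q ≠ 0) (y : ℂ) : (q : ℂ) ^ y ≠ 0 := by
  rw [Complex.cpow_def_of_ne_zero (by exact_mod_cast hq)]
  exact Complex.exp_ne_zero _

theorem differentiable_natCast_cpow {q : ℕ} (hq : q ≠ 0) : Differentiable ℂ fun y : ℂ => (q : ℂ) ^ y :=
  fun y => (differentiableAt_id (x := y)).const_cpow (Or.inl (by exact_mod_cast hq))

theorem differentiable_psiFun {q : ℕ} (hq : q ≠ 0) (τ : OrbitIndex) :
    Differentiable ℂ fun z : Fin 2 → ℂ => psiFun q τ ((z 0 + z 1) / 2) ((z 1 - z 0) / 2) := by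
  intro z
  have h0 : DifferentiableAt ℂ (fun z : Fin 2 → ℂ => z 0) z := differentiableAt_apply 0 z
  have h1 : DifferentiableAt ℂ (fun z : Fin 2 → ℂ => z 1) z := differentiableAt_apply 1 z
  unfold psiFun
  have e0 : DifferentiableAt ℂ
      (fun z : Fin 2 → ℂ => (τ.ordDisc + 1 : ℂ) * ((z 0 + z 1) / 2)) z := by fun_prop
  have e1 : DifferentiableAt ℂ (fun z : Fin 2 → ℂ => (z 1 - z 0) / 2) z := by fun_prop
  exact ((differentiable_natCast_cpow hq _).comp z e0).mul
    (DifferentiableAt.comp (g := orbFun q τ) z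
      (differentiableAt_orbFun q τ (natCast_cpow_ne_zero hq _))
      ((differentiable_natCast_cpow hq _).comp z e1))

section

variable {k : Type*} [NontriviallyNormedField k] [IsUltrametricDist k] [ProperSpace k]
  {u ϖ : 𝒪[k]}

theorem IsNormalizedSpherical.unique {x : HermSpace u ϖ} {f g : (Fin 2 → ℂ) → ℂ}
    (hf : IsNormalizedSpherical x f) (hg : IsNormalizedSpherical x g) : f = g := by
  funext z
  -- Every point lies on a complex line in the $z_2$-direction, and that line meets the domain of
  -- convergence in a half plane. The identity theorem in one variable then applies.
  let L : ℂ → Fin 2 → ℂ := fun t => ![z 0, z 1 + t]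
  have hL : Differentiable ℂ L := by
    rw [differentiable_pi]
    intro i
    fin_cases i
    · exact differentiable_const _
    · exact (differentiable_const _).add differentiable_id
  have hF : AnalyticOnNhd ℂ (f ∘ L) Set.univ :=
    (hf.1.comp hL).differentiableOn.analyticOnNhd isOpen_univ
  have hG : AnalyticOnNhd ℂ (g ∘ L) Set.univ :=
    (hg.1.comp hL).differentiableOn.analyticOnNhd isOpen_univ
  have hs : ∀ t, (sVar (L t) 0).re = t.re - (z 0 - z 1 + 2).re := by
    intro t
    simp [sVar, L]
    ring
  let t₀ : ℂ := ((z 0 - z 1 + 2).re + 1 : ℝ)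
  have hopen : {t : ℂ | (z 0 - z 1 + 2).re < t.re} ∈ 𝓝 t₀ :=
    (isOpen_lt continuous_const Complex.continuous_re).mem_nhds (by
      simp only [Set.mem_ofPred_eq, t₀, Complex.ofReal_re]; linarith)
  have hev : f ∘ L =ᶠ[𝓝 t₀] g ∘ L := by
    filter_upwards [hopen] with t ht
    have h0 : 0 ≤ (sVar (L t) 0).re := by
      rw [hs]
      have : (z 0 - z 1 + 2).re < t.re := ht
      linarith
    simp only [Function.comp_apply, hf.2 _ h0, hg.2 _ h0]
  have e := congr_fun (hF.eq_of_eventuallyEq hG hev) 0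
  have hz : L 0 = z := by
    funext i
    fin_cases i <;> simp [L]
  simpa [hz] using e

end

variable {k : Type*} [NontriviallyNormedField k] [IsUltrametricDist k] [ProperSpace k]
  [MeasurableSpace k] [BorelSpace k] {u ϖ : 𝒪[k]}

theorem resCard_ne_zero : resCard k ≠ 0 := by
  have : (rq k) ≠ 0 := rq_pos.ne'
  exact_mod_cast this

variable (h : IsDatum u ϖ)
include h

theorem IsDatum.isNormalizedSpherical_psiFun {τ : OrbitIndex} {x : HermSpace u ϖ}
    (hx : x ∈ level u ϖ τ) : IsNormalizedSpherical x
      fun z => psiFun (resCard k) τ ((z 0 + z 1) / 2) ((z 1 - z 0) / 2) :=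
  ⟨differentiable_psiFun resCard_ne_zero τ, fun z hz => h.psiFun_eq hx z hz⟩

theorem IsDatum.isNormalizedSpherical_Psi (x : HermSpace u ϖ) :
    IsNormalizedSpherical x (Psi x) := by
  obtain ⟨τ, hτ⟩ := h.exists_mem_level x
  exact Classical.epsilon_spec ⟨_, h.isNormalizedSpherical_psiFun hτ⟩

theorem IsDatum.Psi_eq {τ : OrbitIndex} {x : HermSpace u ϖ} (hx : x ∈ level u ϖ τ)
    (z : Fin 2 → ℂ) :
    Psi x z = psiFun (resCard k) τ ((z 0 + z 1) / 2) ((z 1 - z 0) / 2) :=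
  congr_fun ((h.isNormalizedSpherical_Psi x).unique (h.isNormalizedSpherical_psiFun hx)) z

end QuatHerm

/-! ### Topology of the space of forms -/

namespace QuatHerm

open HermSpace

variable {k : Type*} [NontriviallyNormedField k] [IsUltrametricDist k]
  [ProperSpace k] [MeasurableSpace k] [BorelSpace k] {u ϖ : 𝒪[k]}

/-- The off-diagonal entry with given coordinates. -/
noncomputable def coordOff (u ϖ : 𝒪[k]) (v : Fin 6 → k) : Quat u ϖ := ⟨v 2, v 3, v 4, v 5⟩

/-- The discriminant in terms of coordinates. -/
noncomputable def coordDisc (u ϖ : 𝒪[k]) (v : Fin 6 → k) : k := v 0 * v 1 - nr (coordOff u ϖ v)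

theorem coordOff_hermCoord (x : HermSpace u ϖ) : coordOff u ϖ (hermCoord x) = x.off := rfl

theorem continuous_coordOff : Continuous (coordOff u ϖ) := by
  rw [continuous_quat]
  exact ⟨continuous_apply 2, continuous_apply 3, continuous_apply 4, continuous_apply 5⟩

theorem continuous_coordDisc : Continuous (coordDisc u ϖ) :=
  ((continuous_apply 0).mul (continuous_apply 1)).sub (continuous_nr.comp continuous_coordOff)

theorem continuous_mat : Continuous (HermSpace.mat : HermSpace u ϖ → _) :=
  Units.continuous_val.comp continuous_subtype_val

theorem continuous_form_fst : Continuous (HermSpace.fst : HermSpace u ϖ → k) :=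
  continuous_re.comp (continuous_mat.matrix_elem 0 0)

theorem continuous_form_snd : Continuous (HermSpace.snd : HermSpace u ϖ → k) :=
  continuous_re.comp (continuous_mat.matrix_elem 1 1)

theorem continuous_form_off : Continuous (HermSpace.off : HermSpace u ϖ → _) :=
  continuous_mat.matrix_elem 0 1

theorem continuous_form_disc : Continuous (HermSpace.disc : HermSpace u ϖ → k) :=
  (continuous_form_fst.mul continuous_form_snd).sub (continuous_nr.comp continuous_form_off)

theorem continuous_hermCoord : Continuous (hermCoord : HermSpace u ϖ → _) := by
  rw [continuous_pi_iff]
  intro i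
  fin_cases i
  · exact continuous_form_fst
  · exact continuous_form_snd
  · exact continuous_re.comp continuous_form_off
  · exact continuous_imI.comp continuous_form_off
  · exact continuous_imJ.comp continuous_form_off
  · exact continuous_imK.comp continuous_form_off

theorem continuous_hermMat {α : Type*} [TopologicalSpace α] {a d : α → k} {β : α → Quat u ϖ}
    (ha : Continuous a) (hd : Continuous d) (hβ : Continuous β) :
    Continuous fun t => hermMat (a t) (d t) (β t) := by
  have hc : ∀ {a : α → k}, Continuous a → Continuous fun t => ((a t : k) : Quat u ϖ) := by
    intro a ha
    rw [continuous_quat]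
    exact ⟨ha, continuous_const, continuous_const, continuous_const⟩
  refine continuous_matrix fun i j => ?_
  fin_cases i <;> fin_cases j
  · exact hc ha
  · exact hβ
  · exact continuous_quat_star.comp hβ
  · exact hc hd

theorem isOpen_coordDisc_ne_zero : IsOpen {v : Fin 6 → k | coordDisc u ϖ v ≠ 0} :=
  isOpen_ne_fun continuous_coordDisc continuous_const

/-- The form with given coordinates of nonzero discriminant. -/
noncomputable def ofVec (u ϖ : 𝒪[k]) (v : {v : Fin 6 → k | coordDisc u ϖ v ≠ 0}) : HermSpace u ϖ :=
  ofCoord (v.1 0) (v.1 1) (coordOff u ϖ v.1) v.2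

theorem continuous_ofVec : Continuous (ofVec u ϖ) := by
  refine Continuous.subtype_mk (Units.continuous_iff.2 ⟨?_, ?_⟩) _
  · exact continuous_hermMat ((continuous_apply 0).comp continuous_subtype_val)
      ((continuous_apply 1).comp continuous_subtype_val)
      (continuous_coordOff.comp continuous_subtype_val)
  · have hi : Continuous fun v : {v : Fin 6 → k | coordDisc u ϖ v ≠ 0} =>
        (coordDisc u ϖ v.1)⁻¹ :=
      (continuous_coordDisc.comp continuous_subtype_val).inv₀ fun v => v.2
    refine continuous_hermMat (hi.mul ((continuous_apply 1).comp continuous_subtype_val))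
      (hi.mul ((continuous_apply 0).comp continuous_subtype_val)) ?_
    rw [continuous_quat]
    have hc : ∀ j : Fin 6, Continuous fun v : {v : Fin 6 → k | coordDisc u ϖ v ≠ 0} =>
        -((coordDisc u ϖ v.1)⁻¹ * v.1 j) := fun j =>
      (hi.mul ((continuous_apply j).comp continuous_subtype_val)).neg
    exact ⟨hc 2, hc 3, hc 4, hc 5⟩

theorem hermCoord_ofVec (v : {v : Fin 6 → k | coordDisc u ϖ v ≠ 0}) :
    hermCoord (ofVec u ϖ v) = v.1 := by
  funext i
  fin_cases i <;> simp [hermCoord, ofVec, hermMat, coordOff]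

variable (h : IsDatum u ϖ)
include h

theorem IsDatum.hermCoord_injective : Function.Injective (hermCoord : HermSpace u ϖ → _) := by
  intro x y hxy
  refine h.herm_ext (congr_fun hxy 0) (congr_fun hxy 1) ?_
  rw [← coordOff_hermCoord, ← coordOff_hermCoord, hxy]

/-- The coordinates identify $X$ homeomorphically with the open set of nonzero discriminant in
$k^6$. This makes the pullback of additive Haar measure computable on images. -/
theorem IsDatum.isOpenEmbedding_hermCoord :
    IsOpenEmbedding (hermCoord : HermSpace u ϖ → Fin 6 → k) := by
  let e : HermSpace u ϖ ≃ₜ {v : Fin 6 → k | coordDisc u ϖ v ≠ 0} :=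
    { toFun := fun x => ⟨hermCoord x, h.disc_ne_zero x⟩
      invFun := ofVec u ϖ
      left_inv := fun x => h.hermCoord_injective (hermCoord_ofVec _)
      right_inv := fun v => Subtype.ext (hermCoord_ofVec v)
      continuous_toFun := continuous_hermCoord.subtype_mk _
      continuous_invFun := continuous_ofVec }
  exact isOpen_coordDisc_ne_zero.isOpenEmbedding_subtypeVal.comp e.isOpenEmbedding

theorem IsDatum.measurableEmbedding_hermCoord :
    MeasurableEmbedding (hermCoord : HermSpace u ϖ → Fin 6 → k) :=
  h.isOpenEmbedding_hermCoord.measurableEmbedding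

omit h in
theorem isClopen_sq_le {c : ℝ} (hc : 0 < c) : IsClopen {t : k | ‖t‖ ^ 2 ≤ c} := by
  have e : {t : k | ‖t‖ ^ 2 ≤ c} = Metric.closedBall 0 (Real.sqrt c) := by
    ext t
    simp [Real.le_sqrt (norm_nonneg t) hc.le]
  rw [e]
  exact IsUltrametricDist.isClopen_closedBall 0 (Real.sqrt_pos.2 hc).ne'

omit h in
theorem isClopen_sq_lt (c : ℝ) : IsClopen {t : k | ‖t‖ ^ 2 < c} := by
  have e : {t : k | ‖t‖ ^ 2 < c} = Metric.ball 0 (Real.sqrt c) := by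
    ext t
    simp [Real.lt_sqrt (norm_nonneg t)]
  rw [e]
  exact IsUltrametricDist.isClopen_ball 0 _

omit h in
-- Spheres and balls of positive radius are open and closed in an ultrametric field. Openness of the
-- orbits is what makes a compact support meet only finitely many of them.
theorem isOpen_level (τ : OrbitIndex) : IsOpen (level u ϖ τ) := by
  have hc : ∀ n : ℤ, (0 : ℝ) < rq k ^ n := fun n => zpow_pos rq_pos n
  have h1 : IsOpen {x : HermSpace u ϖ | ‖x.disc‖ = rq k ^ (-τ.ordDisc)} := by
    have := (IsUltrametricDist.isOpen_sphere (0 : k) (hc (-τ.ordDisc)).ne').preimage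
      (continuous_form_disc (u := u) (ϖ := ϖ))
    convert this using 1
    ext x; simp
  have h2 : IsOpen {x : HermSpace u ϖ | x.size ≤ rq k ^ (-τ.ordSize)} := by
    have e1 := ((isClopen_sq_le (hc (-τ.ordSize))).preimage (continuous_form_fst (u := u) (ϖ := ϖ))).2
    have e2 := ((isClopen_sq_le (hc (-τ.ordSize))).preimage (continuous_form_snd (u := u) (ϖ := ϖ))).2
    have e3 := ((IsUltrametricDist.isClopen_closedBall (0 : k) (hc (-τ.ordSize)).ne').preimage
      (continuous_nr.comp (continuous_form_off (u := u) (ϖ := ϖ)))).2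
    convert (e1.inter e2).inter e3 using 1
    ext x
    simp [size]
  have h3 : IsClosed {x : HermSpace u ϖ | x.size < rq k ^ (-τ.ordSize)} := by
    have e1 := ((isClopen_sq_lt (rq k ^ (-τ.ordSize))).preimage
      (continuous_form_fst (u := u) (ϖ := ϖ))).1
    have e2 := ((isClopen_sq_lt (rq k ^ (-τ.ordSize))).preimage
      (continuous_form_snd (u := u) (ϖ := ϖ))).1
    have e3 := ((IsUltrametricDist.isClopen_ball (0 : k) (rq k ^ (-τ.ordSize))).preimage
      (continuous_nr.comp (continuous_form_off (u := u) (ϖ := ϖ)))).1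
    convert (e1.inter e2).inter e3 using 1
    ext x
    simp [size]
  convert (h1.inter h2).inter h3.isOpen_compl using 1
  ext x
  simp only [level, Set.mem_ofPred_eq, Set.mem_inter_iff, Set.mem_compl_iff, not_lt]
  exact ⟨fun hx => ⟨⟨hx.1, hx.2.le⟩, hx.2.ge⟩, fun hx => ⟨hx.1.1, le_antisymm hx.1.2 hx.2⟩⟩

omit h in
theorem measurableSet_level (τ : OrbitIndex) : MeasurableSet (level u ϖ τ) :=
  (isOpen_level τ).measurableSet

end QuatHerm

/-! ### Volumes of sets of integral forms -/

namespace QuatHerm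

open HermSpace

theorem measureReal_prod_of_slice {α β : Type*} [MeasurableSpace α] [MeasurableSpace β]
    (μ : Measure α) (ν : Measure β) [IsFiniteMeasure μ] [IsFiniteMeasure ν] {s : Set (α × β)}
    (hs : MeasurableSet s) {t : Set β} (ht : MeasurableSet t) (c : ℝ)
    (h1 : ∀ y ∈ t, μ.real ((fun x => (x, y)) ⁻¹' s) = c)
    (h2 : ∀ y ∉ t, (fun x => (x, y)) ⁻¹' s = ∅) : (μ.prod ν).real s = ν.real t * c := by
  have e : (μ.prod ν) s = ∫⁻ y in t, ENNReal.ofReal c ∂ν := by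
    rw [Measure.prod_apply_symm hs, ← lintegral_indicator ht]
    refine lintegral_congr fun y => ?_
    by_cases hy : y ∈ t
    · rw [Set.indicator_of_mem hy, ← h1 y hy, ofReal_measureReal]
    · rw [Set.indicator_of_notMem hy, h2 y hy, measure_empty]
  rw [measureReal_def, e, setLIntegral_const, ENNReal.toReal_mul, mul_comm, measureReal_def]
  by_cases hne : t.Nonempty
  · obtain ⟨y, hy⟩ := hne
    rw [ENNReal.toReal_ofReal (h1 y hy ▸ measureReal_nonneg)]
  · rw [Set.not_nonempty_iff_eq_empty.1 hne]; simp

variable {k : Type*} [NontriviallyNormedField k] [IsUltrametricDist k] [ProperSpace k]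
  [MeasurableSpace k] [BorelSpace k] {u ϖ : 𝒪[k]}

theorem measurableSet_norm_int (c : ℝ) : MeasurableSet {t : 𝒪[k] | ‖(t : k)‖ = c} :=
  measurableSet_eq_fun (continuous_subtype_val.norm.measurable) measurable_const

/-- The product of invariant probability measures on the lattice of integral hermitian
matrices. -/
noncomputable abbrev latticeHaar (u ϖ : 𝒪[k]) : Measure (𝒪[k] × 𝒪[k] × MaxOrder u ϖ) := unitHaar _

theorem latticeHaar_eq : latticeHaar u ϖ = (lam k).prod ((lam k).prod (muO u ϖ)) := by
  rw [latticeHaar, unitHaar_prod, unitHaar_prod]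

/-- The discriminant of an integral hermitian matrix. -/
noncomputable def intDisc (p : 𝒪[k] × 𝒪[k] × MaxOrder u ϖ) : 𝒪[k] := p.1 * p.2.1 - nr p.2.2

theorem continuous_intDisc : Continuous (intDisc (u := u) (ϖ := ϖ)) :=
  (continuous_fst.mul (continuous_fst.comp continuous_snd)).sub
    (continuous_nr.comp (continuous_snd.comp continuous_snd))

theorem measurableSet_intDisc (c : ℝ) :
    MeasurableSet {p : 𝒪[k] × 𝒪[k] × MaxOrder u ϖ | ‖(intDisc p : k)‖ = c} :=
  continuous_intDisc.measurable (measurableSet_norm_int c)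

variable (h : IsDatum u ϖ)
include h

theorem IsDatum.lam_sphere (n : ℕ) :
    (lam k).real {t : 𝒪[k] | ‖(t : k)‖ = (rq k)⁻¹ ^ n} = (rq k)⁻¹ ^ n * (1 - (rq k)⁻¹) := by
  induction n with
  | zero =>
    rw [pow_zero, one_mul, ← lam_units]
    congr 1; ext t; simp [isUnit_int_iff]
  | succ n ih =>
    have e := measure_image_eq (lam k) (AddMonoidHom.mulLeft ϖ)
      (continuous_const.mul continuous_id) (fun _ _ hw => mul_left_cancel₀ h.irr.ne_zero hw)
      (measure_ne_top _ _) {t : 𝒪[k] | ‖(t : k)‖ = (rq k)⁻¹ ^ n}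
    have hr : Set.range (AddMonoidHom.mulLeft ϖ) = {t : 𝒪[k] | ¬ IsUnit t} := h.range_mul_int
    have hi : AddMonoidHom.mulLeft ϖ '' {t : 𝒪[k] | ‖(t : k)‖ = (rq k)⁻¹ ^ n} =
        {t : 𝒪[k] | ‖(t : k)‖ = (rq k)⁻¹ ^ (n + 1)} := by
      have hq := inv_ne_zero (rq_pos (k := k)).ne'
      have hmul : ∀ s : 𝒪[k], ‖((ϖ * s : 𝒪[k]) : k)‖ = (rq k)⁻¹ * ‖(s : k)‖ := fun s => by
        push_cast; rw [norm_mul, h.norm_eq]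
      ext t
      constructor
      · rintro ⟨s, hs, rfl⟩
        have hs : ‖(s : k)‖ = (rq k)⁻¹ ^ n := hs
        change ‖((ϖ * s : 𝒪[k]) : k)‖ = _
        rw [hmul, hs, pow_succ']
      · intro ht
        have ht : ‖(t : k)‖ = (rq k)⁻¹ ^ (n + 1) := ht
        have hu : t ∈ {t : 𝒪[k] | ¬ IsUnit t} := by
          intro hu
          rw [isUnit_int_iff.1 hu] at ht
          exact absurd ht.symm
            (pow_lt_one₀ (inv_nonneg.2 rq_pos.le) (inv_lt_one_of_one_lt₀ one_lt_rq)
              n.succ_ne_zero).ne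
        rw [← hr] at hu
        obtain ⟨s, rfl⟩ := hu
        refine ⟨s, ?_, rfl⟩
        change ‖((ϖ * s : 𝒪[k]) : k)‖ = _ at ht
        rw [hmul, pow_succ'] at ht
        exact mul_left_cancel₀ hq ht
    rw [hi, hr] at e
    rw [measureReal_def, e, ENNReal.toReal_mul, ← measureReal_def, ← measureReal_def, ih,
      lam_nonunits, pow_succ]
    ring

/-- For a unit $d$ the map $a\mapsto ad-c$ preserves Haar measure. -/
theorem IsDatum.lam_affine_sphere (n : ℕ) {d : 𝒪[k]} (hd : IsUnit d) (c : 𝒪[k]) :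
    (lam k).real {a : 𝒪[k] | ‖((a * d - c : 𝒪[k]) : k)‖ = (rq k)⁻¹ ^ n} =
      (rq k)⁻¹ ^ n * (1 - (rq k)⁻¹) := by
  obtain ⟨d, rfl⟩ := hd
  have hmp : MeasurePreserving (fun a : 𝒪[k] => a * d) (lam k) (lam k) :=
    measurePreserving_of_surjective (AddMonoidHom.mulRight (d : 𝒪[k]))
      (continuous_id.mul continuous_const) (fun w => ⟨w * d⁻¹, by simp⟩)
  have hmp2 := (measurePreserving_sub_right (lam k) c).comp hmp
  rw [← h.lam_sphere n, measureReal_def, measureReal_def,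
    ← hmp2.measure_preimage (measurableSet_norm_int _).nullMeasurableSet]
  rfl

/-- For fixed unit $d$ and fixed $\beta$, the discriminant $ad-N(\beta)$ is an affine function of
$a$, so every slice has the volume of a sphere. -/
theorem IsDatum.latticeHaar_snd_unit (n : ℕ) {E : Set (MaxOrder u ϖ)} (hE : MeasurableSet E) :
    (latticeHaar u ϖ).real {p | IsUnit p.2.1 ∧ p.2.2 ∈ E ∧ ‖(intDisc p : k)‖ = (rq k)⁻¹ ^ n} =
      (1 - (rq k)⁻¹) * (muO u ϖ).real E * ((rq k)⁻¹ ^ n * (1 - (rq k)⁻¹)) := by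
  have hUE : MeasurableSet ({d : 𝒪[k] | IsUnit d} ×ˢ E) := measurableSet_units_int.prod hE
  have hset : {p : 𝒪[k] × 𝒪[k] × MaxOrder u ϖ | IsUnit p.2.1 ∧ p.2.2 ∈ E ∧
      ‖(intDisc p : k)‖ = (rq k)⁻¹ ^ n} = (Prod.snd ⁻¹' ({d : 𝒪[k] | IsUnit d} ×ˢ E)) ∩
      {p | ‖(intDisc p : k)‖ = (rq k)⁻¹ ^ n} := by
    ext p; simp [and_assoc]
  rw [latticeHaar_eq, measureReal_prod_of_slice (lam k) ((lam k).prod (muO u ϖ)) (by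
    rw [hset]
    exact (measurable_snd hUE).inter (measurableSet_intDisc _)) hUE
      ((rq k)⁻¹ ^ n * (1 - (rq k)⁻¹)), measureReal_prod_prod, lam_units]
  · rintro ⟨d, β⟩ ⟨hd, hβ⟩
    rw [← h.lam_affine_sphere n hd (nr β)]
    congr 1
    ext a
    simp only [Set.mem_preimage, Set.mem_ofPred_eq, intDisc]
    exact ⟨fun hx => hx.2.2, fun hx => ⟨hd, hβ, hx⟩⟩
  · rintro ⟨d, β⟩ hn
    ext a
    simp only [Set.mem_preimage, Set.mem_ofPred_eq, Set.mem_empty_iff_false, iff_false]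
    exact fun hx => hn ⟨hx.1, hx.2.1⟩

theorem IsDatum.latticeHaar_fst_unit (n : ℕ) :
    (latticeHaar u ϖ).real {p | IsUnit p.1 ∧ ‖(intDisc p : k)‖ = (rq k)⁻¹ ^ n} =
      (1 - (rq k)⁻¹) * ((rq k)⁻¹ ^ n * (1 - (rq k)⁻¹)) := by
  have e := h.latticeHaar_snd_unit n (E := Set.univ) MeasurableSet.univ
  rw [probReal_univ, mul_one] at e
  rw [← e]
  have hmp := measurePreserving_of_surjective
    (G := 𝒪[k] × 𝒪[k] × MaxOrder u ϖ) (H := 𝒪[k] × 𝒪[k] × MaxOrder u ϖ)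
    (AddMonoidHom.mk' (fun p => (p.2.1, p.1, p.2.2)) (fun _ _ => rfl))
    (by
      change Continuous fun p : 𝒪[k] × 𝒪[k] × MaxOrder u ϖ => (p.2.1, p.1, p.2.2)
      fun_prop) (fun p => ⟨(p.2.1, p.1, p.2.2), rfl⟩)
  have hm : MeasurableSet {p : 𝒪[k] × 𝒪[k] × MaxOrder u ϖ | IsUnit p.1 ∧
      ‖(intDisc p : k)‖ = (rq k)⁻¹ ^ n} :=
    (measurable_fst measurableSet_units_int).inter (measurableSet_intDisc _)
  rw [measureReal_def, measureReal_def, ← hmp.measure_preimage hm.nullMeasurableSet]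
  congr 2
  ext p
  have : intDisc (p.2.1, p.1, p.2.2) = intDisc p := by simp only [intDisc]; ring
  simp [this]

/-! ### Integral forms of given discriminant and size -/

/-- The integral hermitian matrices of given discriminant and size. -/
def intLevel (u ϖ : 𝒪[k]) (m s : ℕ) : Set (𝒪[k] × 𝒪[k] × MaxOrder u ϖ) :=
  {p | ‖(intDisc p : k)‖ = (rq k)⁻¹ ^ m ∧
    max (max (‖(p.1 : k)‖ ^ 2) (‖(p.2.1 : k)‖ ^ 2)) ‖((nr p.2.2 : 𝒪[k]) : k)‖ = (rq k)⁻¹ ^ s}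

omit h in
theorem intSize_eq_one_iff (p : 𝒪[k] × 𝒪[k] × MaxOrder u ϖ) :
    max (max (‖(p.1 : k)‖ ^ 2) (‖(p.2.1 : k)‖ ^ 2)) ‖((nr p.2.2 : 𝒪[k]) : k)‖ = 1 ↔
      IsUnit p.1 ∨ IsUnit p.2.1 ∨ IsUnit p.2.2 := by
  have hsq : ∀ t : 𝒪[k], ‖(t : k)‖ ^ 2 ≤ 1 := fun t => pow_le_one₀ (norm_nonneg _) (norm_coe_le_one t)
  have hsq1 : ∀ t : 𝒪[k], ‖(t : k)‖ ^ 2 = 1 ↔ IsUnit t := fun t => by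
    rw [isUnit_int_iff, pow_eq_one_iff_of_nonneg (norm_nonneg _) two_ne_zero]
  rw [isUnit_iff_isUnit_nr p.2.2, ← hsq1 p.1, ← hsq1 p.2.1, isUnit_int_iff]
  constructor
  · intro hmax
    rcases max_choice (max (‖(p.1 : k)‖ ^ 2) (‖(p.2.1 : k)‖ ^ 2)) ‖((nr p.2.2 : 𝒪[k]) : k)‖
      with e | e
    · rw [hmax] at e
      rcases max_choice (‖(p.1 : k)‖ ^ 2) (‖(p.2.1 : k)‖ ^ 2) with e' | e'
      · exact Or.inl (e'.symm.trans e.symm)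
      · exact Or.inr (Or.inl (e'.symm.trans e.symm))
    · exact Or.inr (Or.inr (e.symm.trans hmax))
  · intro hor
    refine le_antisymm (max_le (max_le (hsq _) (hsq _)) (norm_coe_le_one _)) ?_
    rcases hor with e | e | e
    · exact le_max_of_le_left (le_max_of_le_left e.ge)
    · exact le_max_of_le_left (le_max_of_le_right e.ge)
    · exact le_max_of_le_right e.ge

omit h in
theorem norm_lt_one_of_not_isUnit {t : 𝒪[k]} (ht : ¬ IsUnit t) : ‖(t : k)‖ < 1 :=
  lt_of_le_of_ne (norm_coe_le_one t) fun e => ht (isUnit_int_iff.2 e)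

omit h in
theorem norm_nr_lt_one_of_not_isUnit {w : MaxOrder u ϖ} (hw : ¬ IsUnit w) :
    ‖((nr w : 𝒪[k]) : k)‖ < 1 :=
  norm_lt_one_of_not_isUnit fun e => hw ((isUnit_iff_isUnit_nr w).2 e)

omit h in
theorem coe_intDisc (p : 𝒪[k] × 𝒪[k] × MaxOrder u ϖ) :
    (intDisc p : k) = p.1 * p.2.1 - ((nr p.2.2 : 𝒪[k]) : k) := rfl

omit h in
theorem norm_mul_lt_one_of_not_isUnit_left {a : 𝒪[k]} (ha : ¬ IsUnit a) (d : 𝒪[k]) :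
    ‖(a : k) * d‖ < 1 := by
  rw [norm_mul]
  exact mul_lt_one_of_nonneg_of_lt_one_left (norm_nonneg _) (norm_lt_one_of_not_isUnit ha)
    (norm_coe_le_one d)

/-- If $a$ is not a unit, the discriminant is a unit exactly when $\beta$ is, with no condition on
$d$. The case of unit $a$ is an affine sphere. -/
theorem IsDatum.latticeHaar_zero :
    (latticeHaar u ϖ).real (intLevel u ϖ 0 0) = (1 - (rq k)⁻¹) * (1 + (rq k)⁻¹ ^ 2) := by
  have hm : MeasurableSet ({a : 𝒪[k] | ¬ IsUnit a} ×ˢ (Set.univ : Set 𝒪[k]) ×ˢ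
      {w : MaxOrder u ϖ | IsUnit w}) :=
    measurableSet_nonunits_int.prod (MeasurableSet.univ.prod measurableSet_units_order)
  have hset : intLevel u ϖ 0 0 = {p | IsUnit p.1 ∧ ‖(intDisc p : k)‖ = (rq k)⁻¹ ^ 0} ∪
      {a : 𝒪[k] | ¬ IsUnit a} ×ˢ (Set.univ : Set 𝒪[k]) ×ˢ {w : MaxOrder u ϖ | IsUnit w} := by
    ext p
    simp only [intLevel, pow_zero, intSize_eq_one_iff, Set.mem_ofPred_eq, Set.mem_union,
      Set.mem_prod, Set.mem_univ, true_and]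
    constructor
    · rintro ⟨h1, -⟩
      by_cases ha : IsUnit p.1
      · exact Or.inl ⟨ha, h1⟩
      · refine Or.inr ⟨ha, ?_⟩
        by_contra hβ
        rw [coe_intDisc] at h1
        exact absurd h1 (sub_norm_lt (norm_mul_lt_one_of_not_isUnit_left ha _)
          (norm_nr_lt_one_of_not_isUnit hβ)).ne
    · rintro (⟨ha, h1⟩ | ⟨ha, hβ⟩)
      · exact ⟨h1, Or.inl ha⟩
      · refine ⟨?_, Or.inr (Or.inr hβ)⟩
        have hN : ‖((nr p.2.2 : 𝒪[k]) : k)‖ = 1 := isUnit_int_iff.1 ((isUnit_iff_isUnit_nr _).1 hβ)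
        rw [coe_intDisc, sub_norm_eq_right (by
          rw [hN]; exact norm_mul_lt_one_of_not_isUnit_left ha _), hN]
  rw [hset, measureReal_union _ hm, h.latticeHaar_fst_unit, latticeHaar_eq, measureReal_prod_prod,
    measureReal_prod_prod, lam_nonunits, probReal_univ, h.muO_units]
  · ring
  · rw [Set.disjoint_left]
    exact fun p hp hp' => hp'.1 hp.1

/-- Suppose $a$ is not a unit. Since the discriminant is not a unit, $\beta$ cannot be one, so size
one forces $d$ to be a unit. Conversely a unit $d$ and non-unit $\beta$ force $a$ to be a non-unit,
so the two pieces are disjoint. -/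
theorem IsDatum.latticeHaar_pos {n : ℕ} (hn : n ≠ 0) :
    (latticeHaar u ϖ).real (intLevel u ϖ n 0) =
      (1 - (rq k)⁻¹) ^ 2 * (1 + (rq k)⁻¹ ^ 2) * (rq k)⁻¹ ^ n := by
  have hm : MeasurableSet {p : 𝒪[k] × 𝒪[k] × MaxOrder u ϖ | IsUnit p.2.1 ∧
      p.2.2 ∈ {w : MaxOrder u ϖ | ¬ IsUnit w} ∧ ‖(intDisc p : k)‖ = (rq k)⁻¹ ^ n} :=
    (measurable_snd (measurable_fst measurableSet_units_int)).inter
      ((measurable_snd (measurable_snd measurableSet_nonunits_order)).inter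
        (measurableSet_intDisc _))
  have hlt : (rq k)⁻¹ ^ n < 1 :=
    pow_lt_one₀ (inv_nonneg.2 rq_pos.le) (inv_lt_one_of_one_lt₀ one_lt_rq) hn
  have hna : ∀ p : 𝒪[k] × 𝒪[k] × MaxOrder u ϖ, IsUnit p.2.1 → ¬ IsUnit p.2.2 →
      ‖(intDisc p : k)‖ = (rq k)⁻¹ ^ n → ¬ IsUnit p.1 := by
    intro p hd hβ h1 ha
    rw [coe_intDisc, sub_norm_eq_left, norm_mul, isUnit_int_iff.1 ha, isUnit_int_iff.1 hd] at h1
    · linarith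
    · rw [norm_mul, isUnit_int_iff.1 ha, isUnit_int_iff.1 hd, one_mul]
      exact norm_nr_lt_one_of_not_isUnit hβ
  have hset : intLevel u ϖ n 0 = {p | IsUnit p.1 ∧ ‖(intDisc p : k)‖ = (rq k)⁻¹ ^ n} ∪
      {p | IsUnit p.2.1 ∧ p.2.2 ∈ {w : MaxOrder u ϖ | ¬ IsUnit w} ∧
        ‖(intDisc p : k)‖ = (rq k)⁻¹ ^ n} := by
    ext p
    simp only [intLevel, pow_zero, intSize_eq_one_iff, Set.mem_ofPred_eq, Set.mem_union]
    constructor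
    · rintro ⟨h1, h2⟩
      by_cases ha : IsUnit p.1
      · exact Or.inl ⟨ha, h1⟩
      · refine Or.inr ?_
        have hβ : ¬ IsUnit p.2.2 := by
          intro hβ
          have hN : ‖((nr p.2.2 : 𝒪[k]) : k)‖ = 1 :=
            isUnit_int_iff.1 ((isUnit_iff_isUnit_nr _).1 hβ)
          rw [coe_intDisc, sub_norm_eq_right (by
            rw [hN]; exact norm_mul_lt_one_of_not_isUnit_left ha _), hN] at h1
          linarith
        exact ⟨by tauto, hβ, h1⟩
    · rintro (⟨ha, h1⟩ | ⟨hd, hβ, h1⟩)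
      · exact ⟨h1, Or.inl ha⟩
      · exact ⟨h1, Or.inr (Or.inl hd)⟩
  rw [hset, measureReal_union _ hm, h.latticeHaar_fst_unit,
    h.latticeHaar_snd_unit n measurableSet_nonunits_order, h.muO_nonunits]
  · ring
  · rw [Set.disjoint_left]
    exact fun p hp hp' => hna p hp'.1 hp'.2.1 hp'.2.2 hp.1

/-- These elements are exactly $\Pi$ times the units of the order. -/
theorem IsDatum.muO_norm_eq_inv :
    (muO u ϖ).real {w | ‖((nr w : 𝒪[k]) : k)‖ = (rq k)⁻¹} =
      (rq k)⁻¹ ^ 2 * (1 - (rq k)⁻¹ ^ 2) := by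
  have hinj : Function.Injective (AddMonoidHom.mulLeft (piO u ϖ)) := fun v w hw => by
    have hw : piO u ϖ * v = piO u ϖ * w := hw
    have hϖ : (ϖ : 𝒪[k]) ≠ 0 := h.irr.ne_zero
    have e := QuaternionAlgebra.ext_iff.1 hw
    simp [piO, hϖ] at e
    exact QuaternionAlgebra.ext e.2.2.1 e.2.2.2 e.1 e.2.1
  have e := measure_image_eq (muO u ϖ) (AddMonoidHom.mulLeft (piO u ϖ))
    (continuous_const.mul continuous_id) hinj (measure_ne_top _ _) {w | IsUnit w}
  have hr : Set.range (AddMonoidHom.mulLeft (piO u ϖ)) = {w : MaxOrder u ϖ | ¬ IsUnit w} :=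
    h.range_mul_order
  have hmul : ∀ w : MaxOrder u ϖ, ‖((nr (piO u ϖ * w) : 𝒪[k]) : k)‖ =
      (rq k)⁻¹ * ‖((nr w : 𝒪[k]) : k)‖ := fun w => by
    have : nr (piO u ϖ) = -ϖ := by simp [nr, piO]
    rw [nr_mul, this, ← h.norm_eq, ← norm_mul, ← norm_neg]
    congr 1
    push_cast
    ring
  have hq := inv_ne_zero (rq_pos (k := k)).ne'
  have hi : AddMonoidHom.mulLeft (piO u ϖ) '' {w | IsUnit w} =
      {w : MaxOrder u ϖ | ‖((nr w : 𝒪[k]) : k)‖ = (rq k)⁻¹} := by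
    ext t
    constructor
    · rintro ⟨s, hs, rfl⟩
      change ‖((nr (piO u ϖ * s) : 𝒪[k]) : k)‖ = _
      rw [hmul, isUnit_int_iff.1 ((isUnit_iff_isUnit_nr _).1 hs), mul_one]
    · intro ht
      have ht : ‖((nr t : 𝒪[k]) : k)‖ = (rq k)⁻¹ := ht
      have hu : t ∈ {t : MaxOrder u ϖ | ¬ IsUnit t} := by
        intro hu
        rw [isUnit_int_iff.1 ((isUnit_iff_isUnit_nr _).1 hu)] at ht
        exact absurd ht.symm (inv_lt_one_of_one_lt₀ one_lt_rq).ne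
      rw [← hr] at hu
      obtain ⟨s, rfl⟩ := hu
      refine ⟨s, ?_, rfl⟩
      change ‖((nr (piO u ϖ * s) : 𝒪[k]) : k)‖ = _ at ht
      rw [hmul, mul_eq_left₀ hq] at ht
      exact (isUnit_iff_isUnit_nr _).2 (isUnit_int_iff.2 ht)
  rw [hi, hr] at e
  rw [measureReal_def, e, ENNReal.toReal_mul, ← measureReal_def, ← measureReal_def,
    h.muO_nonunits, h.muO_units]

/-- Squares of diagonal absolute values are even powers of $q$, so size $q^{-1}$ must come from
$\beta$ with $a,d$ non-units. The discriminant condition is then automatic and the set is a product.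
-/
theorem IsDatum.latticeHaar_anti :
    (latticeHaar u ϖ).real (intLevel u ϖ 1 1) = (rq k)⁻¹ ^ 4 * (1 - (rq k)⁻¹ ^ 2) := by
  have hq0 : 0 < (rq k)⁻¹ := inv_pos.2 rq_pos
  have hq1 : (rq k)⁻¹ < 1 := inv_lt_one_of_one_lt₀ one_lt_rq
  have hsq : ∀ t : 𝒪[k], ‖(t : k)‖ ^ 2 ≤ (rq k)⁻¹ → ¬ IsUnit t := by
    intro t ht hu
    rw [isUnit_int_iff.1 hu] at ht
    linarith
  have hsq' : ∀ t : 𝒪[k], ¬ IsUnit t → ‖(t : k)‖ ≤ (rq k)⁻¹ := fun t ht =>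
    h.norm_lt_one_iff.1 (norm_lt_one_of_not_isUnit ht)
  have hlt : ∀ t : 𝒪[k], ¬ IsUnit t → ‖(t : k)‖ ^ 2 < (rq k)⁻¹ := fun t ht => by
    have := pow_le_pow_left₀ (norm_nonneg _) (hsq' t ht) 2
    nlinarith
  have hset : intLevel u ϖ 1 1 = {a : 𝒪[k] | ¬ IsUnit a} ×ˢ {a : 𝒪[k] | ¬ IsUnit a} ×ˢ
      {w : MaxOrder u ϖ | ‖((nr w : 𝒪[k]) : k)‖ = (rq k)⁻¹} := by
    ext p
    simp only [intLevel, pow_one, Set.mem_ofPred_eq, Set.mem_prod]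
    constructor
    · rintro ⟨-, h2⟩
      have ha := hsq _ ((le_max_left _ _).trans ((le_max_left _ _).trans h2.le))
      have hd := hsq _ ((le_max_right _ _).trans ((le_max_left _ _).trans h2.le))
      refine ⟨ha, hd, ?_⟩
      rcases max_choice (max (‖(p.1 : k)‖ ^ 2) (‖(p.2.1 : k)‖ ^ 2)) ‖((nr p.2.2 : 𝒪[k]) : k)‖
        with e | e
      · rw [h2] at e
        exact absurd e (max_lt (hlt _ ha) (hlt _ hd)).ne'
      · exact e.symm.trans h2
    · rintro ⟨ha, hd, hβ⟩
      constructor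
      · rw [coe_intDisc, sub_norm_eq_right, hβ]
        rw [hβ, norm_mul]
        nlinarith [hsq' _ ha, hsq' _ hd, norm_nonneg (p.1 : k), norm_nonneg (p.2.1 : k)]
      · rw [hβ, max_eq_right]
        exact (max_lt (hlt _ ha) (hlt _ hd)).le
  rw [hset, latticeHaar_eq, measureReal_prod_prod, measureReal_prod_prod, lam_nonunits,
    h.muO_norm_eq_inv]
  ring

end QuatHerm

/-! ### Volumes of the orbits -/

namespace QuatHerm

open HermSpace

variable {k : Type*} [NontriviallyNormedField k] [IsUltrametricDist k] [ProperSpace k]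
  [MeasurableSpace k] [BorelSpace k] {u ϖ : 𝒪[k]}

/-- The coordinates of `c` times an integral hermitian matrix. -/
noncomputable def latticeVec (u ϖ : 𝒪[k]) (c : k) (p : 𝒪[k] × 𝒪[k] × MaxOrder u ϖ) : Fin 6 → k :=
  ![c * p.1, c * p.2.1, c * p.2.2.re, c * p.2.2.imI, c * p.2.2.imJ, c * p.2.2.imK]

/-- The map `latticeVec` as a homomorphism. -/
noncomputable def latticeHom (u ϖ : 𝒪[k]) (c : k) :
    𝒪[k] × 𝒪[k] × MaxOrder u ϖ →+ (Fin 6 → k) :=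
  AddMonoidHom.mk' (latticeVec u ϖ c) fun p p' => by
    funext i
    fin_cases i <;> simp [latticeVec, mul_add]

theorem continuous_latticeVec (c : k) : Continuous (latticeVec u ϖ c) := by
  have hβ : Continuous fun p : 𝒪[k] × 𝒪[k] × MaxOrder u ϖ => p.2.2 := by fun_prop
  have hc : ∀ {f : 𝒪[k] × 𝒪[k] × MaxOrder u ϖ → 𝒪[k]}, Continuous f →
      Continuous fun p => c * (f p : k) := fun hf =>
    continuous_const.mul (continuous_subtype_val.comp hf)
  rw [continuous_pi_iff]
  intro i
  fin_cases i
  · exact hc continuous_fst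
  · exact hc (continuous_fst.comp continuous_snd)
  · exact hc (continuous_re.comp hβ)
  · exact hc (continuous_imI.comp hβ)
  · exact hc (continuous_imJ.comp hβ)
  · exact hc (continuous_imK.comp hβ)

theorem latticeVec_injective {c : k} (hc : c ≠ 0) : Function.Injective (latticeVec u ϖ c) := by
  intro p p' hp
  have key : ∀ i, latticeVec u ϖ c p i = latticeVec u ϖ c p' i := fun i => congr_fun hp i
  have e : ∀ {a b : 𝒪[k]}, c * (a : k) = c * b → a = b := fun hab =>
    Subtype.ext (mul_left_cancel₀ hc hab)
  exact Prod.ext (e (key 0)) (Prod.ext (e (key 1))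
    (QuaternionAlgebra.ext (e (key 2)) (e (key 3)) (e (key 4)) (e (key 5))))

theorem range_latticeVec {c : k} (hc : c ≠ 0) : Set.range (latticeVec u ϖ c) =
    Set.pi Set.univ fun _ => Metric.closedBall (0 : k) ‖c‖ := by
  ext v
  simp only [Set.mem_range, Set.mem_pi, Set.mem_univ, mem_closedBall_zero_iff, true_imp_iff]
  constructor
  · rintro ⟨p, rfl⟩ i
    have e : ∀ a : 𝒪[k], ‖c * (a : k)‖ ≤ ‖c‖ := fun a => by
      rw [norm_mul]; exact mul_le_of_le_one_right (norm_nonneg _) (norm_coe_le_one a)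
    fin_cases i <;> exact e _
  · intro hv
    have e : ∀ i, ‖v i / c‖ ≤ 1 := fun i => by
      rw [norm_div]; exact div_le_one_of_le₀ (hv i) (norm_nonneg _)
    refine ⟨(toInt _ (e 0), toInt _ (e 1),
      ⟨toInt _ (e 2), toInt _ (e 3), toInt _ (e 4), toInt _ (e 5)⟩), ?_⟩
    funext i
    fin_cases i <;> simp [latticeVec, mul_div_cancel₀ _ hc]

variable (k) in
/-- The additive Haar measure on the space of coordinates. -/
noncomputable abbrev coordHaar : Measure (Fin 6 → k) :=
  Measure.pi fun _ : Fin 6 => (Measure.addHaar : Measure k)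

variable (k) in
/-- The volume of the ring of integers. -/
noncomputable def haarInt : ℝ := (Measure.addHaar : Measure k).real (Metric.closedBall 0 1)

theorem haarInt_pos : 0 < haarInt k :=
  ENNReal.toReal_pos (Metric.measure_closedBall_pos _ _ one_pos).ne'
    (isCompact_closedBall _ _).measure_lt_top.ne

variable (h : IsDatum u ϖ)
include h

theorem IsDatum.haar_closedBall_succ {c : k} (hc : c ≠ 0) :
    (Measure.addHaar : Measure k).real (Metric.closedBall 0 ‖c * ϖ‖) =
      (rq k)⁻¹ * (Measure.addHaar : Measure k).real (Metric.closedBall 0 ‖c‖) := by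
  let f : 𝒪[k] →+ k := AddMonoidHom.mk' (fun t => c * t) fun s t => by push_cast; ring
  have hr : ∀ {b : k}, b ≠ 0 → Set.range (fun t : 𝒪[k] => b * (t : k)) =
      Metric.closedBall 0 ‖b‖ := by
    intro b hb
    ext x
    simp only [Set.mem_range, mem_closedBall_zero_iff]
    constructor
    · rintro ⟨t, rfl⟩
      rw [norm_mul]; exact mul_le_of_le_one_right (norm_nonneg _) (norm_coe_le_one t)
    · intro hx
      refine ⟨toInt (x / b) ?_, by rw [coe_toInt, mul_div_cancel₀ _ hb]⟩
      rw [norm_div]; exact div_le_one_of_le₀ hx (norm_nonneg _)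
  have hrf : Set.range f = Metric.closedBall 0 ‖c‖ := hr hc
  have hfin : (Measure.addHaar : Measure k) (Set.range f) ≠ ⊤ := by
    rw [hrf]; exact (isCompact_closedBall _ _).measure_lt_top.ne
  have e := measure_image_eq (Measure.addHaar : Measure k) f
    (continuous_const.mul continuous_subtype_val)
    (fun s t hst => Subtype.ext (mul_left_cancel₀ hc hst)) hfin {t : 𝒪[k] | ¬ IsUnit t}
  have hi : f '' {t : 𝒪[k] | ¬ IsUnit t} = Metric.closedBall 0 ‖c * ϖ‖ := by
    rw [← h.range_mul_int, ← Set.range_comp, ← hr (mul_ne_zero hc h.ne_zero)]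
    congr 1
    funext t
    simp [f, mul_assoc]
  rw [measureReal_def, ← hi, e, ENNReal.toReal_mul, ← measureReal_def, ← measureReal_def, hrf,
    lam_nonunits, mul_comm]

theorem IsDatum.haar_closedBall (i : ℤ) :
    (Measure.addHaar : Measure k).real (Metric.closedBall 0 ‖(ϖ : k) ^ i‖) =
      rq k ^ (-i) * haarInt k := by
  have hq := (rq_pos (k := k)).ne'
  have hstep : ∀ j : ℤ,
      (Measure.addHaar : Measure k).real (Metric.closedBall 0 ‖(ϖ : k) ^ (j + 1)‖) =
        (rq k)⁻¹ * (Measure.addHaar : Measure k).real (Metric.closedBall 0 ‖(ϖ : k) ^ j‖) :=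
    fun j => by
      rw [zpow_add_one₀ h.ne_zero]; exact h.haar_closedBall_succ (zpow_ne_zero _ h.ne_zero)
  induction i with
  | zero => simp [haarInt]
  | succ i ih =>
    rw [hstep, ih, neg_add, zpow_add₀ hq, zpow_neg_one]; ring
  | pred i ih =>
    have e := hstep (-(i : ℤ) - 1)
    rw [sub_add_cancel, ih] at e
    rw [neg_sub, sub_neg_eq_add, add_comm, zpow_add₀ hq, zpow_one]
    rw [neg_neg] at e
    rw [mul_right_comm, mul_comm, ← mul_assoc] 
    field_simp at e ⊢
    linarith

theorem IsDatum.coordHaar_range (i : ℤ) :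
    (coordHaar k).real (Set.range (latticeVec u ϖ ((ϖ : k) ^ i))) =
      rq k ^ (-6 * i) * haarInt k ^ 6 := by
  rw [range_latticeVec (zpow_ne_zero _ h.ne_zero), measureReal_def, Measure.pi_pi,
    ENNReal.toReal_prod, Finset.prod_const, Finset.card_univ, Fintype.card_fin, ← measureReal_def,
    h.haar_closedBall, mul_pow, ← zpow_natCast, ← zpow_mul]
  congr 2
  push_cast; ring

theorem IsDatum.coordHaar_image (i : ℤ) (s : Set (𝒪[k] × 𝒪[k] × MaxOrder u ϖ)) :
    (coordHaar k).real (latticeVec u ϖ ((ϖ : k) ^ i) '' s) =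
      rq k ^ (-6 * i) * haarInt k ^ 6 * (latticeHaar u ϖ).real s := by
  have hc : (ϖ : k) ^ i ≠ 0 := zpow_ne_zero _ h.ne_zero
  have hfin : coordHaar k (Set.range (latticeHom u ϖ ((ϖ : k) ^ i))) ≠ ⊤ := by
    have : Set.range (latticeHom u ϖ ((ϖ : k) ^ i)) = _ := range_latticeVec hc
    rw [this]
    exact (isCompact_univ_pi fun _ => isCompact_closedBall _ _).measure_lt_top.ne
  have e := measure_image_eq (coordHaar k) (latticeHom u ϖ ((ϖ : k) ^ i))
    (continuous_latticeVec _) (latticeVec_injective hc) hfin s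
  rw [← h.coordHaar_range i, measureReal_def, measureReal_def, measureReal_def,
    ← ENNReal.toReal_mul]
  exact congrArg ENNReal.toReal e

theorem IsDatum.mem_level_iff_mem_intLevel {τ : OrbitIndex} {i : ℤ} {m s : ℕ}
    (hm : τ.ordDisc = 2 * i + m) (hs : τ.ordSize = 2 * i + s) {x : HermSpace u ϖ}
    {p : 𝒪[k] × 𝒪[k] × MaxOrder u ϖ} (h1 : x.fst = (ϖ : k) ^ i * p.1)
    (h2 : x.snd = (ϖ : k) ^ i * p.2.1) (h3 : x.off = (ϖ : k) ^ i • orderIncl u ϖ p.2.2) :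
    x ∈ level u ϖ τ ↔ p ∈ intLevel u ϖ m s := by
  have hq := rq_pos (k := k)
  have hc : 0 < ‖(ϖ : k) ^ i‖ ^ 2 := pow_pos (norm_pos_iff.2 (zpow_ne_zero _ h.ne_zero)) 2
  have hpow : ∀ j : ℕ, rq k ^ (-(2 * i + (j : ℤ))) = ‖(ϖ : k) ^ i‖ ^ 2 * (rq k)⁻¹ ^ j := by
    intro j
    rw [h.norm_zpow, neg_add, zpow_add₀ hq.ne', zpow_neg _ (j : ℤ), zpow_natCast, inv_pow,
      ← zpow_natCast (rq k ^ (-i)), ← zpow_mul]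
    congr 2
    push_cast; ring
  have hdisc : x.disc = ((ϖ : k) ^ i) ^ 2 * intDisc p := by
    rw [disc, h1, h2, h3, nr_smul, nr_orderIncl, coe_intDisc]; ring
  have hsize : x.size = ‖(ϖ : k) ^ i‖ ^ 2 *
      max (max (‖(p.1 : k)‖ ^ 2) (‖(p.2.1 : k)‖ ^ 2)) ‖((nr p.2.2 : 𝒪[k]) : k)‖ := by
    rw [size, h1, h2, h3, nr_smul, nr_orderIncl, norm_mul, norm_mul, norm_mul, mul_pow, mul_pow,
      norm_pow, mul_max_of_nonneg _ _ hc.le, mul_max_of_nonneg _ _ hc.le]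
  simp only [level, intLevel, Set.mem_ofPred_eq, hm, hs, hpow, hdisc, hsize, norm_mul, norm_pow,
    mul_right_inj' hc.ne']

/-- The size bound forces all entries into $\varpi^i$ times the integral lattice, and dividing by
$\varpi^i$ reduces the orbit to a set of integral forms. -/
theorem IsDatum.hermCoord_image_level {τ : OrbitIndex} {i : ℤ} {m s : ℕ}
    (hm : τ.ordDisc = 2 * i + m) (hs : τ.ordSize = 2 * i + s) :
    hermCoord '' level u ϖ τ = latticeVec u ϖ ((ϖ : k) ^ i) '' intLevel u ϖ m s := by
  have hq := rq_pos (k := k)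
  have hc : (ϖ : k) ^ i ≠ 0 := zpow_ne_zero _ h.ne_zero
  have hcn : 0 < ‖(ϖ : k) ^ i‖ := norm_pos_iff.2 hc
  ext v
  constructor
  · rintro ⟨x, hx, rfl⟩
    have hsz : x.size ≤ ‖(ϖ : k) ^ i‖ ^ 2 := by
      rw [hx.2, h.norm_zpow, ← zpow_natCast, ← zpow_mul]
      exact zpow_le_zpow_right₀ one_lt_rq.le (by rw [hs]; push_cast; omega)
    have e : ∀ {t : k}, ‖t‖ ^ 2 ≤ x.size → ‖t / ϖ ^ i‖ ≤ 1 := fun ht => by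
      rw [norm_div, div_le_one hcn]
      exact le_of_sq_le_sq (ht.trans hsz) hcn.le
    obtain ⟨β, hβ⟩ := h.exists_orderIncl (α := ((ϖ : k) ^ i)⁻¹ • x.off) (by
      rw [nr_smul, norm_mul, norm_pow, norm_inv, inv_pow, inv_mul_le_iff₀ (pow_pos hcn 2), mul_one]
      exact (le_max_right _ _).trans hsz)
    have hβ' : x.off = (ϖ : k) ^ i • orderIncl u ϖ β := by rw [hβ, smul_inv_smul₀ hc]
    let p : 𝒪[k] × 𝒪[k] × MaxOrder u ϖ :=
      (toInt (x.fst / ϖ ^ i) (e ((le_max_left _ _).trans (le_max_left _ _))),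
        toInt (x.snd / ϖ ^ i) (e ((le_max_right _ _).trans (le_max_left _ _))), β)
    have h1 : x.fst = (ϖ : k) ^ i * p.1 := by simp only [p, coe_toInt]; field_simp
    have h2 : x.snd = (ϖ : k) ^ i * p.2.1 := by simp only [p, coe_toInt]; field_simp
    refine ⟨p, (h.mem_level_iff_mem_intLevel hm hs h1 h2 hβ').1 hx, ?_⟩
    funext j
    fin_cases j
    · exact h1.symm
    · exact h2.symm
    · exact (congrArg (fun α : Quat u ϖ => α.re) hβ').symm
    · exact (congrArg (fun α : Quat u ϖ => α.imI) hβ').symm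
    · exact (congrArg (fun α : Quat u ϖ => α.imJ) hβ').symm
    · exact (congrArg (fun α : Quat u ϖ => α.imK) hβ').symm
  · rintro ⟨p, hp, rfl⟩
    have hp0 : (intDisc p : k) ≠ 0 := by
      rw [← norm_pos_iff, hp.1]
      exact pow_pos (inv_pos.2 hq) _
    have hne : (ϖ : k) ^ i * p.1 * ((ϖ : k) ^ i * p.2.1) -
        nr ((ϖ : k) ^ i • orderIncl u ϖ p.2.2) ≠ 0 := by
      have : (ϖ : k) ^ i * p.1 * ((ϖ : k) ^ i * p.2.1) -
          nr ((ϖ : k) ^ i • orderIncl u ϖ p.2.2) = ((ϖ : k) ^ i) ^ 2 * intDisc p := by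
        rw [nr_smul, nr_orderIncl, coe_intDisc]; ring
      rw [this]
      exact mul_ne_zero (pow_ne_zero 2 hc) hp0
    refine ⟨ofCoord _ _ _ hne, (h.mem_level_iff_mem_intLevel hm hs rfl rfl rfl).2 hp, ?_⟩
    funext j
    fin_cases j <;> rfl

/-- On the orbit the density is the constant $q^{3\,\mathrm{ord}}$. Its part $q^{6i}$ cancels the
lattice volume $q^{-6i}$, so the orbit volume does not depend on the scale $i$. -/
theorem IsDatum.invMeasureAux_level_real {τ : OrbitIndex} {i : ℤ} {m s : ℕ}
    (hm : τ.ordDisc = 2 * i + m) (hs : τ.ordSize = 2 * i + s) :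
    (invMeasureAux u ϖ).real (level u ϖ τ) =
      haarInt k ^ 6 * (rq k ^ (3 * m) * (latticeHaar u ϖ).real (intLevel u ϖ m s)) := by
  have hq := rq_pos (k := k)
  have e : invMeasureAux u ϖ (level u ϖ τ) =
      ENNReal.ofReal (rq k ^ (3 * τ.ordDisc)) * coordHaar k (hermCoord '' level u ϖ τ) := by
    rw [invMeasureAux, withDensity_apply _ (measurableSet_level τ),
      ← h.measurableEmbedding_hermCoord.comap_apply, ← setLIntegral_const]
    refine setLIntegral_congr_fun (measurableSet_level τ) fun x hx => ?_
    have e2 : (rq k ^ (-τ.ordDisc)) ^ 2 = rq k ^ (((-2 * τ.ordDisc : ℤ) : ℝ)) := by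
      rw [Real.rpow_intCast, ← zpow_natCast, ← zpow_mul]; congr 1; push_cast; ring
    simp only [h.nrd_mat, norm_pow, hx.1]
    rw [e2, ← Real.rpow_mul hq.le, ← Real.rpow_intCast]
    congr 2
    push_cast; ring
  rw [measureReal_def, e, ENNReal.toReal_mul, ENNReal.toReal_ofReal (zpow_pos hq _).le,
    ← measureReal_def, h.hermCoord_image_level hm hs, h.coordHaar_image, hm, mul_add,
    zpow_add₀ hq.ne']
  have e3 : rq k ^ (3 * (2 * i)) * rq k ^ (-6 * i) = 1 := by
    rw [← zpow_add₀ hq.ne']; convert zpow_zero _ using 2; ring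
  have e4 : rq k ^ (3 * m) = rq k ^ (3 * (m : ℤ)) := by rw [← zpow_natCast]; push_cast; rfl
  rw [e4]
  linear_combination (rq k ^ (3 * (m : ℤ)) * haarInt k ^ 6 *
    (latticeHaar u ϖ).real (intLevel u ϖ m s)) * e3

/-- The volumes of the orbits of `K`. -/
noncomputable def OrbitIndex.vol (q : ℝ) : OrbitIndex → ℝ
  | .diag _ 0 => 1
  | .diag _ (n + 1) => q ^ (2 * (n + 1)) * (1 - q⁻¹)
  | .anti _ => (1 + q⁻¹) / (q * (1 + q⁻¹ ^ 2))

/-- The volume of the orbit of the identity before normalization. -/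
noncomputable def IsDatum.volOne (_ : IsDatum u ϖ) : ℝ :=
  haarInt k ^ 6 * ((1 - (rq k)⁻¹) * (1 + (rq k)⁻¹ ^ 2))

theorem IsDatum.volOne_pos : 0 < h.volOne := by
  have h1 : (rq k)⁻¹ < 1 := inv_lt_one_of_one_lt₀ one_lt_rq
  have := haarInt_pos (k := k)
  have h2 : 0 < 1 - (rq k)⁻¹ := by linarith
  unfold volOne
  positivity

theorem IsDatum.invMeasureAux_level (τ : OrbitIndex) :
    (invMeasureAux u ϖ).real (level u ϖ τ) = h.volOne * τ.vol (rq k) := by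
  have hq := rq_pos (k := k)
  match τ with
  | .diag i 0 =>
    rw [h.invMeasureAux_level_real (i := i) (m := 0) (s := 0) (by simp [OrbitIndex.ordDisc])
      (by simp [OrbitIndex.ordSize]), h.latticeHaar_zero, OrbitIndex.vol, volOne]
    simp
  | .diag i (n + 1) =>
    rw [h.invMeasureAux_level_real (i := i) (m := n + 1) (s := 0) (by simp [OrbitIndex.ordDisc])
      (by simp [OrbitIndex.ordSize]), h.latticeHaar_pos (show n + 1 ≠ 0 by omega), OrbitIndex.vol, volOne]
    have : rq k ^ (3 * (n + 1)) * (rq k)⁻¹ ^ (n + 1) = rq k ^ (2 * (n + 1)) := by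
      rw [inv_pow, show 3 * (n + 1) = 2 * (n + 1) + (n + 1) by ring, pow_add]
      field_simp
    linear_combination (haarInt k ^ 6 * ((1 - (rq k)⁻¹) ^ 2 * (1 + (rq k)⁻¹ ^ 2))) * this
  | .anti e =>
    rw [h.invMeasureAux_level_real (i := e) (m := 1) (s := 1) (by simp [OrbitIndex.ordDisc])
      (by simp [OrbitIndex.ordSize]), h.latticeHaar_anti, OrbitIndex.vol, volOne]
    field_simp
    ring

theorem IsDatum.vol_pos (τ : OrbitIndex) : 0 < τ.vol (rq k) := by
  have hq := rq_pos (k := k)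
  have h1 : (rq k)⁻¹ < 1 := inv_lt_one_of_one_lt₀ one_lt_rq
  have h2 : 0 < 1 - (rq k)⁻¹ := by linarith
  match τ with
  | .diag i 0 => simp [OrbitIndex.vol]
  | .diag i (n + 1) => simp only [OrbitIndex.vol]; positivity
  | .anti e => simp only [OrbitIndex.vol]; positivity

theorem IsDatum.invMeasureAux_level_ne (τ : OrbitIndex) :
    invMeasureAux u ϖ (level u ϖ τ) = ENNReal.ofReal (h.volOne * τ.vol (rq k)) := by
  have e := h.invMeasureAux_level τ
  have hpos := mul_pos h.volOne_pos (h.vol_pos τ)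
  have hne : invMeasureAux u ϖ (level u ϖ τ) ≠ ⊤ := by
    -- `toReal` sends an infinite measure to $0$, contradicting positivity of the computed value.
    intro htop
    rw [measureReal_def, htop, ENNReal.toReal_top] at e
    exact hpos.ne e
  rw [← e, ofReal_measureReal hne]

theorem IsDatum.invMeasure_level (τ : OrbitIndex) :
    invMeasure u ϖ (level u ϖ τ) = ENNReal.ofReal (τ.vol (rq k)) := by
  have e1 := h.invMeasureAux_level_ne (.diag 0 0)
  rw [invMeasure, h.orbitK_one, Measure.smul_apply, e1, h.invMeasureAux_level_ne τ]
  simp only [OrbitIndex.vol, mul_one]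
  rw [ENNReal.ofReal_mul h.volOne_pos.le, smul_eq_mul, ← mul_assoc, ENNReal.inv_mul_cancel, one_mul]
  · simpa using h.volOne_pos
  · exact ENNReal.ofReal_ne_top

end QuatHerm

/-! ### Integrals along the contour -/

namespace QuatHerm

/-- The integral `(1 / 2πi) ∮ g dY / Y` along the path `Y = q^y`. -/
noncomputable def cint (q : ℕ) (y : ℝ → ℂ) (g : ℝ → ℂ) : ℂ :=
  Real.log q / (2 * π * Complex.I) * ∫ r in (0 : ℝ)..1, g r * deriv y r

namespace IsDeformedContour

variable {q : ℕ} {y : ℝ → ℂ} (hy : IsDeformedContour q y)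
include hy

theorem intervalIntegrable {g : ℝ → ℂ} (hg : ContinuousOn g (Set.Icc 0 1)) :
    IntervalIntegrable (fun r => g r * deriv y r) volume 0 1 :=
  hy.integrable_deriv.continuousOn_mul (by rwa [Set.uIcc_of_le zero_le_one])

theorem cint_add {f g : ℝ → ℂ} (hf : ContinuousOn f (Set.Icc 0 1))
    (hg : ContinuousOn g (Set.Icc 0 1)) :
    cint q y (fun r => f r + g r) = cint q y f + cint q y g := by
  simp only [cint, add_mul]
  rw [intervalIntegral.integral_add (hy.intervalIntegrable hf) (hy.intervalIntegrable hg), mul_add]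

omit hy in
theorem _root_.QuatHerm.cint_const_mul (c : ℂ) (g : ℝ → ℂ) :
    cint q y (fun r => c * g r) = c * cint q y g := by
  simp only [cint, mul_assoc]
  rw [intervalIntegral.integral_const_mul]
  ring

omit hy in
theorem _root_.QuatHerm.cint_congr {f g : ℝ → ℂ} (hfg : Set.EqOn f g (Set.Icc 0 1)) :
    cint q y f = cint q y g := by
  unfold cint
  congr 1
  refine intervalIntegral.integral_congr fun r hr => ?_
  rw [Set.uIcc_of_le zero_le_one] at hr
  simp only [hfg hr]

variable (hq : 1 < q)
include hq

omit hy in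
theorem _root_.QuatHerm.expPath_ne_zero (r : ℝ) : expPath q y r ≠ 0 :=
  natCast_cpow_ne_zero (by omega) _

theorem continuousOn_expPath : ContinuousOn (expPath q y) (Set.Icc 0 1) :=
  (differentiable_natCast_cpow (by omega)).continuous.comp_continuousOn hy.continuousOn

omit hy in
theorem _root_.QuatHerm.log_natCast_ne_zero : (Real.log q : ℂ) ≠ 0 := by
  have : 0 < Real.log q := Real.log_pos (by exact_mod_cast hq)
  exact_mod_cast this.ne'

theorem expPath_one : expPath q y 1 = expPath q y 0 := by
  have hq0 : (q : ℂ) ≠ 0 := by exact_mod_cast (show q ≠ 0 by omega)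
  have hl := log_natCast_ne_zero hq
  unfold expPath
  rw [hy.period, Complex.cpow_add _ _ hq0, Complex.cpow_def_of_ne_zero hq0 (_ / _),
    ← Complex.natCast_log]
  have : (Real.log q : ℂ) * (2 * π * Complex.I / Real.log q) = 2 * π * Complex.I := by
    field_simp
  rw [this, Complex.exp_two_pi_mul_I, mul_one]

omit hy in
theorem _root_.QuatHerm.hasDerivAt_expPath {r : ℝ} (hr : DifferentiableAt ℝ y r) :
    HasDerivAt (expPath q y) (expPath q y r * (Real.log q * deriv y r)) r := by
  have hq0 : (q : ℂ) ≠ 0 := by exact_mod_cast (show q ≠ 0 by omega)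
  have e : expPath q y = fun r => Complex.exp (Real.log q * y r) := by
    funext r
    rw [expPath, Complex.cpow_def_of_ne_zero hq0, Complex.natCast_log]
  rw [e]
  exact (hr.hasDerivAt.const_mul (Real.log q : ℂ)).cexp

/-- The fundamental theorem of calculus, insensitive to the finitely many bad points, reduces this
to the displacement $2\pi i/\log q$ of the path. -/
theorem cint_one : cint q y (fun _ => 1) = 1 := by
  obtain ⟨S, hS⟩ := hy.differentiableAt
  have e := integral_eq_of_hasDerivAt_off_countable_of_le y (deriv y) zero_le_one
    S.countable_toSet hy.continuousOn (fun r hr => (hS r hr.1 hr.2).hasDerivAt) hy.integrable_deriv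
  have hl := log_natCast_ne_zero hq
  have hI := Complex.I_ne_zero
  have hpi : (π : ℂ) ≠ 0 := by exact_mod_cast Real.pi_ne_zero
  unfold cint
  simp only [one_mul]
  rw [e, hy.period]
  field_simp
  ring

/-- A nonzero power $Y^n$ is, up to a constant, its own primitive for $dY/Y$, and the path closes up
in the $Y$-plane. -/
theorem cint_zpow {n : ℤ} (hn : n ≠ 0) : cint q y (fun r => expPath q y r ^ n) = 0 := by
  obtain ⟨S, hS⟩ := hy.differentiableAt
  have hc : ContinuousOn (fun r => expPath q y r ^ n) (Set.Icc 0 1) :=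
    (hy.continuousOn_expPath hq).zpow₀ n fun r _ => Or.inl (expPath_ne_zero hq r)
  have e := integral_eq_of_hasDerivAt_off_countable_of_le (fun r => expPath q y r ^ n)
    (fun r => (n * Real.log q : ℂ) * (expPath q y r ^ n * deriv y r)) zero_le_one
    S.countable_toSet hc (fun r hr => by
      have hd := (hasDerivAt_zpow n (expPath q y r) (Or.inl (expPath_ne_zero hq r))).comp r
        (hasDerivAt_expPath hq (hS r hr.1 hr.2))
      have hz := expPath_ne_zero (y := y) hq r
      have e : (n * Real.log q : ℂ) * (expPath q y r ^ n * deriv y r) =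
          n * expPath q y r ^ (n - 1) * (expPath q y r * (Real.log q * deriv y r)) := by
        rw [zpow_sub_one₀ hz]
        field_simp
      rw [e]
      exact hd) ((hy.intervalIntegrable hc).const_mul _)
  rw [intervalIntegral.integral_const_mul, hy.expPath_one hq, sub_self] at e
  have hne : (n * Real.log q : ℂ) ≠ 0 :=
    mul_ne_zero (by exact_mod_cast hn) (log_natCast_ne_zero hq)
  rw [cint, (mul_eq_zero.1 e).resolve_left hne, mul_zero]

/-- Along the path $dY=Y\log q\,dy$ off a finite set, which converts integrals in $y$ into winding
numbers in $Y$. -/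
theorem cint_winding (p : ℂ) :
    cint q y (fun r => expPath q y r / (expPath q y r - p)) = winding q y p := by
  obtain ⟨S, hS⟩ := hy.differentiableAt
  have e : ∫ t in (0 : ℝ)..1, deriv (expPath q y) t / (expPath q y t - p) =
      ∫ t in (0 : ℝ)..1, (Real.log q : ℂ) *
        (expPath q y t / (expPath q y t - p) * deriv y t) := by
    refine intervalIntegral.integral_congr_ae ?_
    have h1 := (S.finite_toSet.union (Set.finite_singleton (1 : ℝ))).countable.ae_notMem volume
    filter_upwards [h1] with t ht hmem
    rw [Set.uIoc_of_le zero_le_one] at hmem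
    simp only [Set.mem_union, Set.mem_singleton_iff, not_or] at ht
    rw [(hasDerivAt_expPath hq (hS t ⟨hmem.1, lt_of_le_of_ne hmem.2 ht.2⟩ ht.1)).deriv]
    ring
  rw [winding, e, intervalIntegral.integral_const_mul, cint]
  ring

/-- The contour integral of the values of a polynomial divided by a linear factor. -/
theorem cint_div_linear {W : ℝ → ℂ} (hW : ContinuousOn W (Set.Icc 0 1)) {c : ℂ} (hc : c ≠ 0)
    (hne : ∀ r ∈ Set.Icc (0 : ℝ) 1, 1 - c * W r ≠ 0)
    (hpow : ∀ j : ℕ, j ≠ 0 → cint q y (fun r => W r ^ j) = 0)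
    (h1 : cint q y (fun r => W r / (1 - c * W r)) = 0) (P : Polynomial ℂ) :
    cint q y (fun r => P.eval (W r) / (1 - c * W r)) = P.eval 0 := by
  have hcont : ∀ {f : ℝ → ℂ}, ContinuousOn f (Set.Icc 0 1) →
      ContinuousOn (fun r => f r / (1 - c * W r)) (Set.Icc 0 1) := fun hf =>
    hf.div (continuousOn_const.sub (continuousOn_const.mul hW)) hne
  have hj : ∀ j : ℕ, cint q y (fun r => W r ^ (j + 1) / (1 - c * W r)) = 0 := by
    intro j
    induction j with
    | zero => simpa using h1
    | succ j ih =>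
      -- Division with remainder by $1-cW$ lowers the power of $W$ by one, at the cost of a monomial
      -- with zero integral.
      have e : Set.EqOn (fun r => W r ^ (j + 1 + 1) / (1 - c * W r))
          (fun r => c⁻¹ * (W r ^ (j + 1) / (1 - c * W r)) + (-c⁻¹) * W r ^ (j + 1))
          (Set.Icc 0 1) := fun r hr => by
        have := hne r hr
        simp only
        field_simp
        ring
      rw [cint_congr e, hy.cint_add, cint_const_mul, cint_const_mul, ih, hpow _ j.succ_ne_zero]
      · simp
      · exact continuousOn_const.mul (hcont (hW.pow _))
      · exact continuousOn_const.mul (hW.pow _)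
  have h0 : cint q y (fun r => 1 / (1 - c * W r)) = 1 := by
    have e : Set.EqOn (fun r => 1 / (1 - c * W r))
        (fun r => 1 + c * (W r / (1 - c * W r))) (Set.Icc 0 1) := fun r hr => by
      have := hne r hr
      simp only
      field_simp
      ring
    rw [cint_congr e, hy.cint_add, cint_const_mul, h1, hy.cint_one hq]
    · simp
    · exact continuousOn_const
    · exact continuousOn_const.mul (hcont hW)
  have hPc : ∀ P : Polynomial ℂ, ContinuousOn (fun r => P.eval (W r)) (Set.Icc 0 1) := fun P =>
    P.continuous.comp_continuousOn hW
  induction P using Polynomial.induction_on' with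
  | add P Q hP hQ =>
    simp only [Polynomial.eval_add, add_div]
    rw [hy.cint_add (hcont (hPc P)) (hcont (hPc Q)), hP, hQ]
  | monomial n a =>
    simp only [Polynomial.eval_monomial, mul_div_assoc]
    rw [cint_const_mul]
    cases n with
    | zero => simp only [pow_zero, h0]
    | succ j => simp [hj]

/-- Partial fractions reduce to two linear denominators, whose coefficients sum to $1$. The integral
thus extracts the constant term in $W$, as it would for a quotient holomorphic inside the contour.
-/
theorem cint_div_quadratic {W : ℝ → ℂ} (hW : ContinuousOn W (Set.Icc 0 1)) {a b : ℂ} (ha : a ≠ 0)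
    (hb : b ≠ 0) (hab : a ≠ b) (hnea : ∀ r ∈ Set.Icc (0 : ℝ) 1, 1 - a * W r ≠ 0)
    (hneb : ∀ r ∈ Set.Icc (0 : ℝ) 1, 1 - b * W r ≠ 0)
    (hpow : ∀ j : ℕ, j ≠ 0 → cint q y (fun r => W r ^ j) = 0)
    (ha1 : cint q y (fun r => W r / (1 - a * W r)) = 0)
    (hb1 : cint q y (fun r => W r / (1 - b * W r)) = 0) (P : Polynomial ℂ) :
    cint q y (fun r => P.eval (W r) * ((1 - W r) / ((1 - a * W r) * (1 - b * W r)))) =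
      P.eval 0 := by
  have hab' : a - b ≠ 0 := _root_.sub_ne_zero.2 hab
  have hPc : ContinuousOn (fun r => P.eval (W r)) (Set.Icc 0 1) :=
    P.continuous.comp_continuousOn hW
  have e : Set.EqOn (fun r => P.eval (W r) * ((1 - W r) / ((1 - a * W r) * (1 - b * W r))))
      (fun r => ((a - 1) / (a - b)) * (P.eval (W r) / (1 - a * W r)) +
        ((1 - b) / (a - b)) * (P.eval (W r) / (1 - b * W r))) (Set.Icc 0 1) := fun r hr => by
    have h1 := hnea r hr
    have h2 := hneb r hr
    simp only
    generalize W r = w at h1 h2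
    have key : (1 - w) / ((1 - a * w) * (1 - b * w)) =
        (a - 1) / (a - b) * (1 - a * w)⁻¹ + (1 - b) / (a - b) * (1 - b * w)⁻¹ := by
      rw [div_eq_iff (mul_ne_zero h1 h2), add_mul, mul_assoc, mul_assoc, ← mul_assoc _ (1 - a * w),
        inv_mul_cancel₀ h1, mul_comm (1 - a * w), ← mul_assoc _ (1 - b * w), inv_mul_cancel₀ h2]
      field_simp
      ring
    rw [key]
    ring
  rw [cint_congr e, hy.cint_add, cint_const_mul, cint_const_mul,
    hy.cint_div_linear hq hW ha hnea hpow ha1, hy.cint_div_linear hq hW hb hneb hpow hb1]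
  · rw [← add_mul, ← add_div, sub_add_sub_cancel, div_self hab', one_mul]
  · exact continuousOn_const.mul
      (hPc.div (continuousOn_const.sub (continuousOn_const.mul hW)) hnea)
  · exact continuousOn_const.mul
      (hPc.div (continuousOn_const.sub (continuousOn_const.mul hW)) hneb)

omit hq in
theorem sub_ne_zero {p : ℂ} (h1 : p ∈ innerPoles q ∪ outerPoles q)
    (h2 : -p ∈ innerPoles q ∪ outerPoles q) {r : ℝ} (hr : r ∈ Set.Icc (0 : ℝ) 1) :
    expPath q y r - p ≠ 0 ∧ expPath q y r - -p ≠ 0 :=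
  ⟨fun e => hy.avoids r hr (_root_.sub_eq_zero.1 e ▸ h1), fun e => hy.avoids r hr (_root_.sub_eq_zero.1 e ▸ h2)⟩

theorem one_sub_outer_ne {p : ℂ} (hp : p ≠ 0) (h1 : p ∈ outerPoles q) (h2 : -p ∈ outerPoles q)
    {r : ℝ} (hr : r ∈ Set.Icc (0 : ℝ) 1) : 1 - (p ^ 2)⁻¹ * expPath q y r ^ 2 ≠ 0 := by
  obtain ⟨n1, n2⟩ := hy.sub_ne_zero (Or.inr h1) (Or.inr h2) hr
  have : 1 - (p ^ 2)⁻¹ * expPath q y r ^ 2 =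
      -(p ^ 2)⁻¹ * ((expPath q y r - p) * (expPath q y r - -p)) := by field_simp; ring
  rw [this]
  exact mul_ne_zero (neg_ne_zero.2 (inv_ne_zero (pow_ne_zero 2 hp))) (mul_ne_zero n1 n2)

theorem one_sub_inner_ne {p : ℂ} (h1 : p ∈ innerPoles q) (h2 : -p ∈ innerPoles q)
    {r : ℝ} (hr : r ∈ Set.Icc (0 : ℝ) 1) : 1 - p ^ 2 * (expPath q y r)⁻¹ ^ 2 ≠ 0 := by
  obtain ⟨n1, n2⟩ := hy.sub_ne_zero (Or.inl h1) (Or.inl h2) hr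
  have hz := expPath_ne_zero (y := y) hq r
  have : 1 - p ^ 2 * (expPath q y r)⁻¹ ^ 2 =
      (expPath q y r)⁻¹ ^ 2 * ((expPath q y r - p) * (expPath q y r - -p)) := by field_simp; ring
  rw [this]
  exact mul_ne_zero (pow_ne_zero 2 (inv_ne_zero hz)) (mul_ne_zero n1 n2)

/-- The contour integral around a pair of exterior poles. -/
theorem cint_outer {p : ℂ} (hp : p ≠ 0) (h1 : p ∈ outerPoles q) (h2 : -p ∈ outerPoles q) :
    cint q y (fun r => expPath q y r ^ 2 / (1 - (p ^ 2)⁻¹ * expPath q y r ^ 2)) = 0 := by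
  have hc := hy.continuousOn_expPath hq
  have hne := fun r hr => hy.sub_ne_zero (r := r) (Or.inr h1) (Or.inr h2) hr
  have e : Set.EqOn (fun r => expPath q y r ^ 2 / (1 - (p ^ 2)⁻¹ * expPath q y r ^ 2))
      (fun r => (-(p ^ 2 / 2)) * (expPath q y r / (expPath q y r - p)) +
        (-(p ^ 2 / 2)) * (expPath q y r / (expPath q y r - -p))) (Set.Icc 0 1) := fun r hr => by
    obtain ⟨n1, n2⟩ := hne r hr
    have n3 := hy.one_sub_outer_ne hq hp h1 h2 hr
    have n4 : p ^ 2 - expPath q y r ^ 2 ≠ 0 := by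
      have : p ^ 2 - expPath q y r ^ 2 = -((expPath q y r - p) * (expPath q y r - -p)) := by ring
      rw [this]
      exact neg_ne_zero.2 (mul_ne_zero n1 n2)
    simp only
    rw [sub_neg_eq_add] at n2 ⊢
    field_simp
    ring
  rw [cint_congr e, hy.cint_add, cint_const_mul, cint_const_mul, hy.cint_winding hq,
    hy.cint_winding hq, hy.winding_outer p h1, hy.winding_outer (-p) h2]
  · simp
  · exact continuousOn_const.mul (hc.div (hc.sub continuousOn_const) fun r hr => (hne r hr).1)
  · exact continuousOn_const.mul (hc.div (hc.sub continuousOn_const) fun r hr => (hne r hr).2)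

/-- The contour integral around a pair of interior poles. -/
theorem cint_inner {p : ℂ} (hp : p ≠ 0) (h1 : p ∈ innerPoles q) (h2 : -p ∈ innerPoles q) :
    cint q y (fun r => (expPath q y r)⁻¹ ^ 2 / (1 - p ^ 2 * (expPath q y r)⁻¹ ^ 2)) = 0 := by
  have hc := hy.continuousOn_expPath hq
  have hne := fun r hr => hy.sub_ne_zero (r := r) (Or.inl h1) (Or.inl h2) hr
  have c1 : ContinuousOn (fun r => expPath q y r / (expPath q y r - p)) (Set.Icc 0 1) :=
    hc.div (hc.sub continuousOn_const) fun r hr => (hne r hr).1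
  have c2 : ContinuousOn (fun r => expPath q y r / (expPath q y r - -p)) (Set.Icc 0 1) :=
    hc.div (hc.sub continuousOn_const) fun r hr => (hne r hr).2
  -- Partial fractions in $Y$: the two winding numbers $1$ are balanced by the constant term, the
  -- contribution of $dY/Y$ at $Y=0$.
  have e : Set.EqOn (fun r => (expPath q y r)⁻¹ ^ 2 / (1 - p ^ 2 * (expPath q y r)⁻¹ ^ 2))
      (fun r => ((p ^ 2)⁻¹ / 2) * (expPath q y r / (expPath q y r - p)) +
        (((p ^ 2)⁻¹ / 2) * (expPath q y r / (expPath q y r - -p)) + (-(p ^ 2)⁻¹) * 1))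
      (Set.Icc 0 1) := fun r hr => by
    obtain ⟨n1, n2⟩ := hne r hr
    have hz := expPath_ne_zero (y := y) hq r
    have n4 : expPath q y r ^ 2 - p ^ 2 ≠ 0 := by
      have : expPath q y r ^ 2 - p ^ 2 = (expPath q y r - p) * (expPath q y r - -p) := by ring
      rw [this]
      exact mul_ne_zero n1 n2
    have n3 := hy.one_sub_inner_ne hq h1 h2 hr
    simp only
    rw [sub_neg_eq_add] at n2 ⊢
    field_simp
    ring
  rw [cint_congr e, hy.cint_add, hy.cint_add, cint_const_mul, cint_const_mul, cint_const_mul,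
    hy.cint_winding hq, hy.cint_winding hq, hy.winding_inner p h1, hy.winding_inner (-p) h2,
    hy.cint_one hq]
  · ring
  · exact continuousOn_const.mul c2
  · exact continuousOn_const.mul continuousOn_const
  · exact continuousOn_const.mul c1
  · exact (continuousOn_const.mul c2).add (continuousOn_const.mul continuousOn_const)

end IsDeformedContour

end QuatHerm

/-! ### The weight -/

namespace QuatHerm

/-- One of the two factors of the weight, as a function of `Z = q^y`. -/
noncomputable def halfWeight (q : ℂ) (Z : ℂ) : ℂ :=
  (1 - Z ^ 2) / ((1 - q * Z ^ 2) * (1 - q⁻¹ ^ 2 * Z ^ 2))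

theorem weight_eq {q : ℕ} (hq : 1 < q) (y : ℂ) :
    weight q y = halfWeight q ((q : ℂ) ^ y) * halfWeight q ((q : ℂ) ^ y)⁻¹ := by
  have hq0 : (q : ℂ) ≠ 0 := by exact_mod_cast (show q ≠ 0 by omega)
  have e1 : (q : ℂ) ^ (2 * y) = ((q : ℂ) ^ y) ^ 2 := by rw [mul_comm, Complex.cpow_mul_ofNat]
  have e2 : (q : ℂ) ^ (-2 * y) = ((q : ℂ) ^ y)⁻¹ ^ 2 := by
    rw [neg_mul, Complex.cpow_neg, e1, inv_pow]
  have e3 : (q : ℂ) ^ (-2 : ℂ) = (q : ℂ)⁻¹ ^ 2 := by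
    rw [Complex.cpow_neg, Complex.cpow_ofNat, inv_pow]
  simp only [weight, halfWeight, sub_eq_add_neg _ (2 : ℂ), Complex.cpow_add _ _ hq0, e1, e2, e3,
    Complex.cpow_one, mul_comm _ (q : ℂ), mul_comm _ ((q : ℂ)⁻¹ ^ 2)]

/-- The spherical function on a diagonal orbit up to a constant. -/
noncomputable def symPoly (q : ℝ) (n : ℕ) (Z : ℂ) : ℂ := Z ^ (n + 1) * sphEval q n (Z⁻¹ ^ 2)

/-! ### The weight identities in the variable $Z=q^y$ -/

section Algebra

variable {q : ℝ} (hq : q ≠ 0)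
include hq

/-- Multiplication by $1-W$ telescopes the recursion and gives a closed form. -/
theorem sphEval_mul (n : ℕ) (W : ℂ) : sphEval q n W * (1 - W) =
    (1 - q * W) * (1 - (q : ℂ)⁻¹ ^ 2 * W) - W ^ n * ((W - q) * (W - (q : ℂ)⁻¹ ^ 2)) := by
  have hq' : (q : ℂ) ≠ 0 := by exact_mod_cast hq
  induction n with
  | zero => rw [sphEval_zero]; field_simp; ring
  | succ n ih => rw [sphEval_succ]; linear_combination W * ih

theorem symPoly_mul (n : ℕ) {Z : ℂ} (hZ : Z ≠ 0) : symPoly q n Z * (1 - Z⁻¹ ^ 2) =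
    Z ^ (n + 1) * ((1 - q * Z⁻¹ ^ 2) * (1 - (q : ℂ)⁻¹ ^ 2 * Z⁻¹ ^ 2)) -
      Z⁻¹ ^ (n + 1) * (Z ^ 2 * ((Z⁻¹ ^ 2 - q) * (Z⁻¹ ^ 2 - (q : ℂ)⁻¹ ^ 2))) := by
  have e : Z ^ (n + 1) * (Z⁻¹ ^ 2) ^ n = Z⁻¹ ^ (n + 1) * Z ^ 2 := by
    have h1 : (Z * Z⁻¹) ^ n = 1 := by rw [mul_inv_cancel₀ hZ, one_pow]
    have h2 : Z * Z⁻¹ = 1 := mul_inv_cancel₀ hZ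
    rw [mul_pow] at h1
    calc Z ^ (n + 1) * (Z⁻¹ ^ 2) ^ n = (Z ^ n * Z⁻¹ ^ n) * Z⁻¹ ^ n * Z := by ring
      _ = Z⁻¹ ^ n * Z * (Z * Z⁻¹) := by rw [h1, h2]; ring
      _ = _ := by ring
  rw [symPoly, mul_assoc, sphEval_mul hq, mul_sub, ← mul_assoc _ ((Z⁻¹ ^ 2) ^ n), e]
  ring

theorem symPoly_inv (n : ℕ) {Z : ℂ} (hZ : Z ≠ 0) : symPoly q n Z⁻¹ = symPoly q n Z := by
  -- The closed form loses information where $1-Z^{-2}$ vanishes, but there $Z^{-1}=Z$.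
  by_cases h1 : Z⁻¹ ^ 2 = 1
  · have : Z⁻¹ = Z := by
      field_simp at h1 ⊢
      exact h1
    rw [this]
  · have hq' : (q : ℂ) ≠ 0 := by exact_mod_cast hq
    have e1 := symPoly_mul hq n hZ
    have e2 := symPoly_mul hq n (inv_ne_zero hZ)
    rw [inv_inv] at e2
    have hne : 1 - Z⁻¹ ^ 2 ≠ 0 := sub_ne_zero.2 (Ne.symm h1)
    apply mul_right_cancel₀ hne
    rw [e1]
    have e3 : symPoly q n Z⁻¹ * (1 - Z⁻¹ ^ 2) = -Z⁻¹ ^ 2 * (symPoly q n Z⁻¹ * (1 - Z ^ 2)) := by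
      field_simp
      ring
    rw [e3, e2]
    generalize Z ^ (n + 1) = P
    generalize Z⁻¹ ^ (n + 1) = Q
    field_simp
    ring

/-- Writing the closed form as $Z^{n+1}/h(Z^{-1})+Z^{-n-1}/h(Z)$ splits the weighted function into
two terms exchanged by $Z\mapsto Z^{-1}$. The contour treats all poles of a given half weight alike.
-/
theorem symPoly_mul_weight (n : ℕ) {Z : ℂ} (hZ : Z ≠ 0)
    (h1 : (1 - q * Z ^ 2) * (1 - (q : ℂ)⁻¹ ^ 2 * Z ^ 2) ≠ 0)
    (h2 : (1 - q * Z⁻¹ ^ 2) * (1 - (q : ℂ)⁻¹ ^ 2 * Z⁻¹ ^ 2) ≠ 0) :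
    symPoly q n Z * (halfWeight q Z * halfWeight q Z⁻¹) =
      Z ^ (n + 1) * halfWeight q Z + Z⁻¹ ^ (n + 1) * halfWeight q Z⁻¹ := by
  have hq' : (q : ℂ) ≠ 0 := by exact_mod_cast hq
  have e := symPoly_mul hq n hZ
  have key : symPoly q n Z * (1 - Z⁻¹ ^ 2) * (1 - Z ^ 2) =
      Z ^ (n + 1) * (1 - Z ^ 2) * ((1 - q * Z⁻¹ ^ 2) * (1 - (q : ℂ)⁻¹ ^ 2 * Z⁻¹ ^ 2)) +
      Z⁻¹ ^ (n + 1) * (1 - Z⁻¹ ^ 2) * ((1 - q * Z ^ 2) * (1 - (q : ℂ)⁻¹ ^ 2 * Z ^ 2)) := by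
    rw [e]
    generalize Z ^ (n + 1) = P
    generalize Z⁻¹ ^ (n + 1) = Q
    field_simp
    ring
  unfold halfWeight
  rw [div_mul_div_comm, mul_div_assoc', mul_div_assoc', mul_div_assoc', div_add_div _ _ h1 h2]
  congr 1
  linear_combination key

/-- This splits the weight itself in the same way. It is needed for the antidiagonal orbits, where
the spherical function is constant in $Z$. -/
theorem weight_identity {Z : ℂ} (hZ : Z ≠ 0)
    (h1 : (1 - q * Z ^ 2) * (1 - (q : ℂ)⁻¹ ^ 2 * Z ^ 2) ≠ 0)
    (h2 : (1 - q * Z⁻¹ ^ 2) * (1 - (q : ℂ)⁻¹ ^ 2 * Z⁻¹ ^ 2) ≠ 0) :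
    (q - (q : ℂ)⁻¹ ^ 3) * (halfWeight q Z * halfWeight q Z⁻¹) =
      (1 + (q : ℂ)⁻¹ * Z ^ 2) * halfWeight q Z + (1 + (q : ℂ)⁻¹ * Z⁻¹ ^ 2) * halfWeight q Z⁻¹ := by
  have hq' : (q : ℂ) ≠ 0 := by exact_mod_cast hq
  have key : (q - (q : ℂ)⁻¹ ^ 3) * ((1 - Z ^ 2) * (1 - Z⁻¹ ^ 2)) =
      (1 + (q : ℂ)⁻¹ * Z ^ 2) * (1 - Z ^ 2) *
        ((1 - q * Z⁻¹ ^ 2) * (1 - (q : ℂ)⁻¹ ^ 2 * Z⁻¹ ^ 2)) +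
      (1 + (q : ℂ)⁻¹ * Z⁻¹ ^ 2) * (1 - Z⁻¹ ^ 2) *
        ((1 - q * Z ^ 2) * (1 - (q : ℂ)⁻¹ ^ 2 * Z ^ 2)) := by
    field_simp
    ring
  unfold halfWeight
  rw [div_mul_div_comm, mul_div_assoc', mul_div_assoc', mul_div_assoc', div_add_div _ _ h1 h2]
  congr 1
  linear_combination key

end Algebra

/-! ### Constant terms along the contour -/

namespace IsDeformedContour

variable {q : ℕ} {y : ℝ → ℂ} (hy : IsDeformedContour q y) (hq : 1 < q)
include hy hq

omit hy in
theorem _root_.QuatHerm.natCast_cpow_neg_half_sq : (((q : ℂ) ^ (-(1 / 2) : ℂ)) ^ 2)⁻¹ = q := by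
  rw [← Complex.cpow_mul_ofNat]
  norm_num [Complex.cpow_neg_one]

omit hy in
theorem _root_.QuatHerm.natCast_cpow_half_sq : ((q : ℂ) ^ (1 / 2 : ℂ)) ^ 2 = q := by
  rw [← Complex.cpow_mul_ofNat]
  norm_num

omit hy hq in
theorem _root_.QuatHerm.mem_outerPoles :
    ((q : ℂ) ^ (-(1 / 2) : ℂ) ∈ outerPoles q ∧ -(q : ℂ) ^ (-(1 / 2) : ℂ) ∈ outerPoles q) ∧
      (q : ℂ) ∈ outerPoles q ∧ -(q : ℂ) ∈ outerPoles q := by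
  simp [outerPoles]

omit hy hq in
theorem _root_.QuatHerm.mem_innerPoles :
    ((q : ℂ) ^ (1 / 2 : ℂ) ∈ innerPoles q ∧ -(q : ℂ) ^ (1 / 2 : ℂ) ∈ innerPoles q) ∧
      (q : ℂ)⁻¹ ∈ innerPoles q ∧ -(q : ℂ)⁻¹ ∈ innerPoles q := by
  simp [innerPoles]

omit hy in
theorem _root_.QuatHerm.natCast_ne_inv_sq : (q : ℂ) ≠ (q : ℂ)⁻¹ ^ 2 := by
  have h1 : (1 : ℝ) < q := by exact_mod_cast hq
  have h2 : ((q : ℝ)⁻¹) ^ 2 < 1 :=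
    pow_lt_one₀ (by positivity) (inv_lt_one_of_one_lt₀ h1) two_ne_zero
  intro e
  have e' : (q : ℝ) = (q : ℝ)⁻¹ ^ 2 := Complex.ofReal_injective (by push_cast; exact e)
  linarith

theorem outer_ne {r : ℝ} (hr : r ∈ Set.Icc (0 : ℝ) 1) :
    1 - q * expPath q y r ^ 2 ≠ 0 ∧ 1 - (q : ℂ)⁻¹ ^ 2 * expPath q y r ^ 2 ≠ 0 := by
  have hq0 : q ≠ 0 := by omega
  have h1 := hy.one_sub_outer_ne hq (natCast_cpow_ne_zero hq0 _) mem_outerPoles.1.1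
    mem_outerPoles.1.2 hr
  have h2 := hy.one_sub_outer_ne hq (by exact_mod_cast hq0) mem_outerPoles.2.1
    mem_outerPoles.2.2 hr
  rw [natCast_cpow_neg_half_sq hq] at h1
  rw [← inv_pow] at h2
  exact ⟨h1, h2⟩

theorem inner_ne {r : ℝ} (hr : r ∈ Set.Icc (0 : ℝ) 1) :
    1 - q * (expPath q y r)⁻¹ ^ 2 ≠ 0 ∧ 1 - (q : ℂ)⁻¹ ^ 2 * (expPath q y r)⁻¹ ^ 2 ≠ 0 := by
  have h1 := hy.one_sub_inner_ne hq mem_innerPoles.1.1 mem_innerPoles.1.2 hr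
  have h2 := hy.one_sub_inner_ne hq mem_innerPoles.2.1 mem_innerPoles.2.2 hr
  rw [natCast_cpow_half_sq hq] at h1
  exact ⟨h1, h2⟩

theorem continuousOn_inv : ContinuousOn (fun r => (expPath q y r)⁻¹) (Set.Icc 0 1) :=
  (hy.continuousOn_expPath hq).inv₀ fun r _ => expPath_ne_zero hq r

theorem continuousOn_halfWeight :
    ContinuousOn (fun r => halfWeight q (expPath q y r)) (Set.Icc 0 1) := by
  have hc := (hy.continuousOn_expPath hq).pow 2
  refine (continuousOn_const.sub hc).div
    ((continuousOn_const.sub (continuousOn_const.mul hc)).mul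
      (continuousOn_const.sub (continuousOn_const.mul hc))) fun r hr => ?_
  exact mul_ne_zero (hy.outer_ne hq hr).1 (hy.outer_ne hq hr).2

theorem continuousOn_halfWeight_inv :
    ContinuousOn (fun r => halfWeight q (expPath q y r)⁻¹) (Set.Icc 0 1) := by
  have hc := (hy.continuousOn_inv hq).pow 2
  refine (continuousOn_const.sub hc).div
    ((continuousOn_const.sub (continuousOn_const.mul hc)).mul
      (continuousOn_const.sub (continuousOn_const.mul hc))) fun r hr => ?_
  exact mul_ne_zero (hy.inner_ne hq hr).1 (hy.inner_ne hq hr).2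

/-- All poles of $h(Y)$, namely $\pm q^{-1/2}$ and $\pm q$, have winding number zero. -/
theorem cint_halfWeight (P : Polynomial ℂ) :
    cint q y (fun r => P.eval (expPath q y r ^ 2) * halfWeight q (expPath q y r)) = P.eval 0 := by
  have hq0 : q ≠ 0 := by omega
  have hqc : (q : ℂ) ≠ 0 := by exact_mod_cast hq0
  have ha := hy.cint_outer hq (natCast_cpow_ne_zero hq0 _) mem_outerPoles.1.1 mem_outerPoles.1.2
  have hb := hy.cint_outer hq hqc mem_outerPoles.2.1 mem_outerPoles.2.2
  rw [natCast_cpow_neg_half_sq hq] at ha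
  rw [← inv_pow] at hb
  refine hy.cint_div_quadratic hq ((hy.continuousOn_expPath hq).pow 2) hqc
    (pow_ne_zero 2 (inv_ne_zero hqc)) (natCast_ne_inv_sq hq) (fun r hr => (hy.outer_ne hq hr).1)
    (fun r hr => (hy.outer_ne hq hr).2) (fun j hj => ?_) ha hb P
  have e := hy.cint_zpow hq (n := 2 * j) (by omega)
  rw [← e]
  refine cint_congr fun r _ => ?_
  simp only [Pi.pow_apply, zpow_mul, zpow_ofNat, zpow_natCast]

/-- All poles of $h(Y^{-1})$, namely $\pm q^{1/2}$ and $\pm q^{-1}$, have winding number one, so the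
expansion in $Y^{-2}$ plays the role of the expansion in $Y^2$. -/
theorem cint_halfWeight_inv (P : Polynomial ℂ) :
    cint q y (fun r => P.eval ((expPath q y r)⁻¹ ^ 2) * halfWeight q (expPath q y r)⁻¹) =
      P.eval 0 := by
  have hq0 : q ≠ 0 := by omega
  have hqc : (q : ℂ) ≠ 0 := by exact_mod_cast hq0
  have ha := hy.cint_inner hq (natCast_cpow_ne_zero hq0 _) mem_innerPoles.1.1 mem_innerPoles.1.2
  have hb := hy.cint_inner hq (inv_ne_zero hqc) mem_innerPoles.2.1 mem_innerPoles.2.2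
  rw [natCast_cpow_half_sq hq] at ha
  refine hy.cint_div_quadratic hq ((hy.continuousOn_inv hq).pow 2) hqc
    (pow_ne_zero 2 (inv_ne_zero hqc)) (natCast_ne_inv_sq hq) (fun r hr => (hy.inner_ne hq hr).1)
    (fun r hr => (hy.inner_ne hq hr).2) (fun j hj => ?_) ha hb P
  have e := hy.cint_zpow hq (n := -(2 * j)) (by omega)
  rw [← e]
  refine cint_congr fun r _ => ?_
  simp only [Pi.pow_apply, zpow_neg, zpow_mul, zpow_ofNat, zpow_natCast, inv_pow]

/-- The contour integral of a combination of the two factors of the weight. -/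
theorem cint_halfWeight_add (P : Polynomial ℂ) :
    cint q y (fun r => P.eval (expPath q y r ^ 2) * halfWeight q (expPath q y r) +
      P.eval ((expPath q y r)⁻¹ ^ 2) * halfWeight q (expPath q y r)⁻¹) = 2 * P.eval 0 := by
  rw [hy.cint_add, hy.cint_halfWeight hq, hy.cint_halfWeight_inv hq]
  · ring
  · exact (P.continuous.comp_continuousOn ((hy.continuousOn_expPath hq).pow 2)).mul
      (hy.continuousOn_halfWeight hq)
  · exact (P.continuous.comp_continuousOn ((hy.continuousOn_inv hq).pow 2)).mul
      (hy.continuousOn_halfWeight_inv hq)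

/-- The weight along the contour. -/
noncomputable def _root_.QuatHerm.pathWeight (q : ℕ) (y : ℝ → ℂ) (r : ℝ) : ℂ :=
  halfWeight q (expPath q y r) * halfWeight q (expPath q y r)⁻¹

theorem cint_pathWeight : cint q y (pathWeight q y) = 2 / (q - (q : ℂ)⁻¹ ^ 3) := by
  have hq0 : (q : ℝ) ≠ 0 := by exact_mod_cast (show q ≠ 0 by omega)
  have hne : (q - (q : ℂ)⁻¹ ^ 3) ≠ 0 := by
    have h1 : (1 : ℝ) < q := by exact_mod_cast hq
    have h2 : ((q : ℝ)⁻¹) ^ 3 < 1 :=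
      pow_lt_one₀ (by positivity) (inv_lt_one_of_one_lt₀ h1) three_ne_zero
    intro e
    have e' : (q : ℝ) - (q : ℝ)⁻¹ ^ 3 = 0 := Complex.ofReal_injective (by push_cast; exact e)
    linarith
  have e := hy.cint_halfWeight_add hq (1 + Polynomial.C (q : ℂ)⁻¹ * Polynomial.X)
  simp only [Polynomial.eval_add, Polynomial.eval_one, Polynomial.eval_mul, Polynomial.eval_C,
    Polynomial.eval_X, mul_zero, add_zero, mul_one] at e
  rw [eq_div_iff hne, ← e, mul_comm, ← cint_const_mul]
  refine cint_congr fun r hr => ?_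
  have h1 := mul_ne_zero (hy.outer_ne hq hr).1 (hy.outer_ne hq hr).2
  have h2 := mul_ne_zero (hy.inner_ne hq hr).1 (hy.inner_ne hq hr).2
  have := weight_identity hq0 (expPath_ne_zero (y := y) hq r)
    (by rw [Complex.ofReal_natCast]; exact h1) (by rw [Complex.ofReal_natCast]; exact h2)
  simpa [pathWeight] using this

theorem symPoly_mul_pathWeight (n : ℕ) {r : ℝ} (hr : r ∈ Set.Icc (0 : ℝ) 1) :
    symPoly q n (expPath q y r) * pathWeight q y r =
      expPath q y r ^ (n + 1) * halfWeight q (expPath q y r) +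
        (expPath q y r)⁻¹ ^ (n + 1) * halfWeight q (expPath q y r)⁻¹ := by
  have hq0 : (q : ℝ) ≠ 0 := by exact_mod_cast (show q ≠ 0 by omega)
  have h1 := mul_ne_zero (hy.outer_ne hq hr).1 (hy.outer_ne hq hr).2
  have h2 := mul_ne_zero (hy.inner_ne hq hr).1 (hy.inner_ne hq hr).2
  have := symPoly_mul_weight hq0 n (expPath_ne_zero (y := y) hq r)
    (by rw [Complex.ofReal_natCast]; exact h1) (by rw [Complex.ofReal_natCast]; exact h2)
  simpa [pathWeight] using this

/-- For odd $n$ the factor $Z^{n+1}$ is a positive power of $Z^2$, whose constant term is zero. -/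
theorem cint_symPoly_odd {n : ℕ} (hn : Odd n) :
    cint q y (fun r => symPoly q n (expPath q y r) * pathWeight q y r) = 0 := by
  obtain ⟨j, rfl⟩ := hn
  have e := hy.cint_halfWeight_add hq (Polynomial.X ^ (j + 1))
  simp only [Polynomial.eval_pow, Polynomial.eval_X, ne_eq, Nat.add_eq_zero_iff, one_ne_zero,
    and_false, not_false_eq_true, zero_pow, mul_zero] at e
  rw [← e]
  refine cint_congr fun r hr => ?_
  rw [hy.symPoly_mul_pathWeight hq _ hr]
  ring

/-- After splitting the weighted function of larger index, the other factor is expanded in the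
matching variable $Z^2$ or $Z^{-2}$. Both terms then carry the polynomial $X^j$ times `sphPoly`,
whose constant term survives only for $j=0$. -/
theorem cint_symPoly_mul_of_le (m j : ℕ) :
    cint q y (fun r => symPoly q (m + 2 * j) (expPath q y r) * symPoly q m (expPath q y r) *
      pathWeight q y r) = if j = 0 then 2 * sphEval q m 0 else 0 := by
  have hq0 : (q : ℝ) ≠ 0 := by exact_mod_cast (show q ≠ 0 by omega)
  have e := hy.cint_halfWeight_add hq
    (Polynomial.X ^ j * (sphPoly q m).map (algebraMap ℝ ℂ))
  have hev : ∀ W : ℂ, ((sphPoly q m).map (algebraMap ℝ ℂ)).eval W = sphEval q m W := fun W => by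
    rw [sphEval, Polynomial.aeval_def, Polynomial.eval₂_eq_eval_map]
  simp only [Polynomial.eval_mul, Polynomial.eval_pow, Polynomial.eval_X, hev] at e
  have e2 : (if j = 0 then 2 * sphEval q m 0 else 0) = 2 * (0 ^ j * sphEval q m 0) := by
    split_ifs with hj <;> simp [hj]
  rw [e2, ← e]
  refine cint_congr fun r hr => ?_
  rw [mul_right_comm, hy.symPoly_mul_pathWeight hq _ hr, add_mul]
  have hz := expPath_ne_zero (y := y) hq r
  set Z := expPath q y r with hZ
  have hZZ : Z * Z⁻¹ = 1 := mul_inv_cancel₀ hz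
  have hpow : Z ^ (m + 1) * Z⁻¹ ^ (m + 1) = 1 := by rw [← mul_pow, hZZ, one_pow]
  -- Symmetry under $Z\mapsto Z^{-1}$ supplies the expansion in $Z^2$ needed for the first term.
  have e3 : symPoly q m Z = Z⁻¹ ^ (m + 1) * sphEval q m (Z ^ 2) := by
    rw [← symPoly_inv hq0 m hz, symPoly, inv_inv]
  congr 1
  · rw [e3]
    linear_combination (Z ^ (2 * j) * halfWeight q Z * sphEval q m (Z ^ 2)) * hpow
  · rw [symPoly]
    linear_combination (Z⁻¹ ^ (2 * j) * halfWeight q Z⁻¹ * sphEval q m (Z⁻¹ ^ 2)) * hpow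

end IsDeformedContour

end QuatHerm

/-! ### The inner product of explicit spherical functions -/

namespace QuatHerm

theorem OrbitIndex.inv_inv (τ : OrbitIndex) : τ.inv.inv = τ := by
  cases τ <;> simp only [OrbitIndex.inv] <;> congr 1 <;> ring

theorem OrbitIndex.inv_injective : Function.Injective OrbitIndex.inv :=
  Function.LeftInverse.injective (g := OrbitIndex.inv) OrbitIndex.inv_inv

theorem OrbitIndex.vol_inv (q : ℝ) (τ : OrbitIndex) : τ.inv.vol q = τ.vol q := by
  match τ with
  | .diag i 0 => rfl
  | .diag i (n + 1) => rfl
  | .anti e => rfl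

theorem orbFun_diag (q : ℝ) (i : ℤ) (n : ℕ) (Z : ℂ) :
    orbFun q (.diag i n) Z = (q : ℂ)⁻¹ ^ n / (1 + (q : ℂ)⁻¹ ^ 2) * symPoly q n Z := by
  simp only [orbFun, symPoly]; ring

theorem orbFun_anti (q : ℝ) (e : ℤ) (Z : ℂ) : orbFun q (.anti e) Z = q - 1 := rfl

theorem orbFun_inv {q : ℝ} (hq : q ≠ 0) (τ : OrbitIndex) {Z : ℂ} (hZ : Z ≠ 0) :
    orbFun q τ Z⁻¹ = orbFun q τ Z := by
  cases τ with
  | diag i n => rw [orbFun_diag, orbFun_diag, symPoly_inv hq n hZ]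
  | anti e => rfl

theorem conj_orbFun (q : ℝ) (τ : OrbitIndex) (Z : ℂ) :
    conj (orbFun q τ Z) = orbFun q τ (conj Z) := by
  cases τ with
  | diag i n => simp [orbFun, sphEval, ← Polynomial.aeval_conj]
  | anti e => simp [orbFun]

theorem conj_natCast_cpow (q : ℕ) (w : ℂ) : conj ((q : ℂ) ^ w) = (q : ℂ) ^ conj w := by
  rw [Complex.cpow_conj _ _ (by rw [Complex.natCast_arg]; exact Real.pi_pos.ne),
    Complex.conj_natCast]

/-- Conjugation inverts both $q^x$ and $q^y$, but the factor in $q^y$ has real coefficients and is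
invariant under inversion. Only the factor in $q^x$ changes. -/
theorem conjExt_psiFun {q : ℕ} (hq : q ≠ 0) (τ : OrbitIndex) (x y : ℂ) :
    conjExt (psiFun q τ) x y =
      (q : ℂ) ^ (-((τ.ordDisc + 1 : ℂ) * x)) * orbFun q τ ((q : ℂ) ^ y) := by
  have hq0 : (q : ℝ) ≠ 0 := by exact_mod_cast hq
  rw [conjExt, psiFun, map_mul, conj_natCast_cpow, conj_orbFun, conj_natCast_cpow, map_neg,
    Complex.conj_conj, Complex.cpow_neg, orbFun_inv hq0 _ (natCast_cpow_ne_zero hq _)]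
  simp

theorem sphEval_zero_right (q : ℝ) (n : ℕ) :
    sphEval q n 0 = if n = 0 then 1 - (q : ℂ)⁻¹ else 1 := by
  cases n with
  | zero => simp [sphEval_zero]
  | succ n => simp [sphEval_succ]

namespace IsDeformedContour

variable {q : ℕ} {y : ℝ → ℂ} (hy : IsDeformedContour q y) (hq : 1 < q)
include hy hq

theorem cint_symPoly_self (n : ℕ) :
    cint q y (fun r => symPoly q n (expPath q y r) * symPoly q n (expPath q y r) *
      pathWeight q y r) = 2 * sphEval q n 0 := by
  have := hy.cint_symPoly_mul_of_le hq n 0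
  simpa using this

/-- Equal discriminant orders force $m$ and $n$ to have the same parity, so they differ by some $2l$
with $l>0$. -/
theorem cint_symPoly_ne {m n : ℕ} (hmn : m ≠ n) {i j : ℤ} (h : 2 * i + m = 2 * j + n) :
    cint q y (fun r => symPoly q m (expPath q y r) * symPoly q n (expPath q y r) *
      pathWeight q y r) = 0 := by
  rcases lt_or_gt_of_ne hmn with hlt | hlt
  · obtain ⟨l, hl⟩ : ∃ l : ℕ, n = m + 2 * l := ⟨(n - m) / 2, by omega⟩
    have := hy.cint_symPoly_mul_of_le hq m l
    rw [if_neg (by omega), ← hl] at this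
    simp only [mul_comm (symPoly q m _), this]
  · obtain ⟨l, hl⟩ : ∃ l : ℕ, m = n + 2 * l := ⟨(m - n) / 2, by omega⟩
    have := hy.cint_symPoly_mul_of_le hq n l
    rw [if_neg (by omega), ← hl] at this
    exact this

/-- The contour integral of a product of two spherical functions. -/
noncomputable def _root_.QuatHerm.orbPair (q : ℕ) (y : ℝ → ℂ) (σ τ : OrbitIndex) : ℂ :=
  cint q y fun r => orbFun q σ (expPath q y r) * orbFun q τ (expPath q y r) * pathWeight q y r

/-- Equal discriminant orders are enough, as the integral over $x$ handles the rest. A diagonal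
orbit sharing its order with an antidiagonal one has odd $n$. -/
theorem orbPair_ne {σ τ : OrbitIndex} (hne : σ ≠ τ) (h : σ.ordDisc = τ.ordDisc) :
    orbPair q y σ τ = 0 := by
  have hodd : ∀ {i e : ℤ} {n : ℕ}, 2 * i + (n : ℤ) = 2 * e + 1 → Odd n := fun {i e n} h =>
    ⟨n / 2, by omega⟩
  cases σ with
  | diag i m =>
    cases τ with
    | diag j n =>
      simp only [OrbitIndex.ordDisc] at h
      have hmn : m ≠ n := by
        rintro rfl
        exact hne (by congr 1; omega)
      have e := hy.cint_symPoly_ne hq hmn h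
      have e2 : orbPair q y (.diag i m) (.diag j n) = cint q y fun r =>
          ((q : ℂ)⁻¹ ^ m / (1 + (q : ℂ)⁻¹ ^ 2) * ((q : ℂ)⁻¹ ^ n / (1 + (q : ℂ)⁻¹ ^ 2))) *
          (symPoly q m (expPath q y r) * symPoly q n (expPath q y r) * pathWeight q y r) :=
        cint_congr fun r _ => by
          simp only [orbFun_diag, Complex.ofReal_natCast]; ring
      rw [e2, cint_const_mul, e, mul_zero]
    | anti e =>
      have e1 := hy.cint_symPoly_odd hq (hodd h)
      have e2 : orbPair q y (.diag i m) (.anti e) = cint q y fun r =>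
          ((q : ℂ)⁻¹ ^ m / (1 + (q : ℂ)⁻¹ ^ 2) * (q - 1)) *
          (symPoly q m (expPath q y r) * pathWeight q y r) :=
        cint_congr fun r _ => by
          simp only [orbFun_diag, orbFun_anti, Complex.ofReal_natCast]; ring
      rw [e2, cint_const_mul, e1, mul_zero]
  | anti e =>
    cases τ with
    | diag j n =>
      have e1 := hy.cint_symPoly_odd hq (hodd h.symm)
      have e2 : orbPair q y (.anti e) (.diag j n) = cint q y fun r =>
          ((q : ℂ)⁻¹ ^ n / (1 + (q : ℂ)⁻¹ ^ 2) * (q - 1)) *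
          (symPoly q n (expPath q y r) * pathWeight q y r) :=
        cint_congr fun r _ => by
          simp only [orbFun_diag, orbFun_anti, Complex.ofReal_natCast]; ring
      rw [e2, cint_const_mul, e1, mul_zero]
    | anti e' =>
      simp only [OrbitIndex.ordDisc] at h
      exact absurd (by congr 1; omega) hne

/-- The constant term of `sphPoly` is $1-q^{-1}$ for $n=0$ and $1$ otherwise, which accounts for the
two shapes of diagonal volume; the antidiagonal case uses the total integral of the weight. The
normalization of the pairing turns all three into inverse volumes. -/
theorem orbPair_self (τ : OrbitIndex) :
    (1 + (q : ℂ)⁻¹ ^ 2) ^ 2 / (2 * (1 - (q : ℂ)⁻¹)) * orbPair q y τ τ = ((τ.vol q : ℝ) : ℂ)⁻¹ := by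
  have hq1 : (1 : ℝ) < q := by exact_mod_cast hq
  have hqi : (q : ℝ)⁻¹ < 1 := inv_lt_one_of_one_lt₀ hq1
  have hqi0 : 0 < (q : ℝ)⁻¹ := by positivity
  have hqc : (q : ℂ) ≠ 0 := by exact_mod_cast (show q ≠ 0 by omega)
  have n1 : 1 + (q : ℂ)⁻¹ ^ 2 ≠ 0 := by
    intro e
    have e' : 1 + (q : ℝ)⁻¹ ^ 2 = 0 := Complex.ofReal_injective (by push_cast; exact e)
    nlinarith
  have n2 : 1 - (q : ℂ)⁻¹ ≠ 0 := by
    intro e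
    have e' : 1 - (q : ℝ)⁻¹ = 0 := Complex.ofReal_injective (by push_cast; exact e)
    linarith
  have hdiag : ∀ i n, orbPair q y (.diag i n) (.diag i n) =
      ((q : ℂ)⁻¹ ^ n / (1 + (q : ℂ)⁻¹ ^ 2)) ^ 2 * (2 * sphEval q n 0) := by
    intro i n
    rw [← hy.cint_symPoly_self hq n, ← cint_const_mul]
    exact cint_congr fun r _ => by
      simp only [orbFun_diag, Complex.ofReal_natCast]; ring
  match τ with
  | .diag i 0 =>
    rw [hdiag, sphEval_zero_right, if_pos rfl]
    simp only [OrbitIndex.vol, Complex.ofReal_natCast, Complex.ofReal_one]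
    generalize 1 + (q : ℂ)⁻¹ ^ 2 = A at n1
    generalize 1 - (q : ℂ)⁻¹ = B at n2
    field_simp
  | .diag i (n + 1) =>
    rw [hdiag, sphEval_zero_right, if_neg (by omega)]
    simp only [OrbitIndex.vol]
    push_cast
    generalize 1 + (q : ℂ)⁻¹ ^ 2 = A at n1
    generalize 1 - (q : ℂ)⁻¹ = B at n2
    rw [inv_pow, mul_inv, div_pow, inv_pow, ← pow_mul, mul_comm (n + 1) 2]
    field_simp
  | .anti e =>
    have e1 : orbPair q y (.anti e) (.anti e) = (q - 1) ^ 2 * (2 / (q - (q : ℂ)⁻¹ ^ 3)) := by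
      rw [← hy.cint_pathWeight hq, ← cint_const_mul]
      exact cint_congr fun r _ => by
        simp only [orbFun, Complex.ofReal_natCast]; ring
    have n3 : 1 + (q : ℂ)⁻¹ ≠ 0 := by
      intro e
      have e' : 1 + (q : ℝ)⁻¹ = 0 := Complex.ofReal_injective (by push_cast; exact e)
      linarith
    have e2 : (q - (q : ℂ)⁻¹ ^ 3) =
        q * ((1 - (q : ℂ)⁻¹) * (1 + (q : ℂ)⁻¹) * (1 + (q : ℂ)⁻¹ ^ 2)) := by
      field_simp; ring
    have e3 : (q : ℂ) - 1 = q * (1 - (q : ℂ)⁻¹) := by field_simp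
    rw [e1, e2, e3]
    simp only [OrbitIndex.vol]
    push_cast
    generalize 1 + (q : ℂ)⁻¹ ^ 2 = A at n1
    generalize 1 - (q : ℂ)⁻¹ = B at n2
    generalize 1 + (q : ℂ)⁻¹ = C at n3
    field_simp

theorem continuousOn_orbFun (τ : OrbitIndex) :
    ContinuousOn (fun r => orbFun q τ (expPath q y r)) (Set.Icc 0 1) := fun r hr =>
  (differentiableAt_orbFun q τ (expPath_ne_zero hq r)).continuousAt.comp_continuousWithinAt
    (hy.continuousOn_expPath hq r hr)

theorem continuousOn_orbPair (σ τ : OrbitIndex) :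
    ContinuousOn (fun r => orbFun q σ (expPath q y r) * orbFun q τ (expPath q y r) *
      pathWeight q y r) (Set.Icc 0 1) :=
  ((hy.continuousOn_orbFun hq σ).mul (hy.continuousOn_orbFun hq τ)).mul
    ((hy.continuousOn_halfWeight hq).mul (hy.continuousOn_halfWeight_inv hq))

omit hq in
theorem cint_sum {ι : Type*} (T : Finset ι) {g : ι → ℝ → ℂ}
    (hg : ∀ i, ContinuousOn (g i) (Set.Icc 0 1)) :
    cint q y (fun r => ∑ i ∈ T, g i r) = ∑ i ∈ T, cint q y (g i) := by
  classical
  induction T using Finset.induction_on with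
  | empty => simp [cint]
  | insert i T hi ih =>
    simp only [Finset.sum_insert hi]
    rw [hy.cint_add (hg i) (continuousOn_finsetSum _ fun i _ => hg i), ih]

omit hy in
-- Orthogonality of the characters $q^{mx}$ over one period of the imaginary axis.
theorem _root_.QuatHerm.integral_natCast_cpow (m : ℤ) :
    ((Real.log q / (2 * π) : ℝ) : ℂ) * ∫ t in (0 : ℝ)..(2 * π / Real.log q),
      (q : ℂ) ^ ((m : ℂ) * (t * Complex.I)) = if m = 0 then 1 else 0 := by
  have hl := log_natCast_ne_zero hq
  have hl' : Real.log q ≠ 0 := by exact_mod_cast hl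
  have hqc : (q : ℂ) ≠ 0 := by exact_mod_cast (show q ≠ 0 by omega)
  have hpi := Real.pi_ne_zero
  split_ifs with hm
  · subst hm
    simp only [Int.cast_zero, zero_mul, Complex.cpow_zero, intervalIntegral.integral_const,
      sub_zero, Complex.real_smul, mul_one]
    rw [← Complex.ofReal_mul]
    rw [show Real.log q / (2 * π) * (2 * π / Real.log q) = 1 by field_simp]
    simp
  · have hm' : (m : ℂ) ≠ 0 := by exact_mod_cast hm
    have e : ∀ t : ℝ, (q : ℂ) ^ ((m : ℂ) * (t * Complex.I)) =
        Complex.exp (Real.log q * m * Complex.I * t) := fun t => by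
      rw [Complex.cpow_def_of_ne_zero hqc, Complex.natCast_log]
      congr 1
      ring
    simp only [e]
    rw [integral_exp_mul_complex (mul_ne_zero (mul_ne_zero hl hm') Complex.I_ne_zero)]
    have e2 : (Real.log q * m * Complex.I * ((2 * π / Real.log q : ℝ) : ℂ)) =
        m * (2 * π * Complex.I) := by
      rw [Complex.ofReal_div, Complex.ofReal_mul, Complex.ofReal_ofNat]
      field_simp
    rw [e2, Complex.exp_int_mul_two_pi_mul_I]
    simp

/-- The inner product of two combinations of explicit spherical functions. -/
theorem pairing_sum {ι : Type*} (T : Finset ι) (e : ι → OrbitIndex) (he : Function.Injective e)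
    (a b : ι → ℂ) :
    pairing q y (fun x y => ∑ i ∈ T, a i * psiFun q (e i) x y)
      (fun x y => ∑ i ∈ T, b i * psiFun q (e i) x y) =
      ∑ i ∈ T, a i * conj (b i) * (((e i).vol q : ℝ) : ℂ)⁻¹ := by
  classical
  have hq0 : q ≠ 0 := by omega
  have hqc : (q : ℂ) ≠ 0 := by exact_mod_cast hq0
  have hconj : ∀ x z : ℂ, conjExt (fun x y => ∑ i ∈ T, b i * psiFun q (e i) x y) x z =
      ∑ i ∈ T, conj (b i) * conjExt (psiFun q (e i)) x z := fun x z => by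
    simp only [conjExt, map_sum, map_mul]
  have hinner : ∀ t : ℝ, (Real.log q / (2 * π * Complex.I)) * ∫ r in (0 : ℝ)..1,
      (∑ i ∈ T, a i * psiFun q (e i) (t * Complex.I) (y r)) *
        conjExt (fun x y => ∑ i ∈ T, b i * psiFun q (e i) x y) (t * Complex.I) (y r) *
          weight q (y r) * deriv y r =
      ∑ i ∈ T, ∑ j ∈ T, a i * conj (b j) * orbPair q y (e i) (e j) *
        (q : ℂ) ^ ((((e i).ordDisc - (e j).ordDisc : ℤ) : ℂ) * (t * Complex.I)) := by
    intro t
    have e1 : cint q y (fun r => (∑ i ∈ T, a i * psiFun q (e i) (t * Complex.I) (y r)) *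
        conjExt (fun x y => ∑ i ∈ T, b i * psiFun q (e i) x y) (t * Complex.I) (y r) *
          weight q (y r)) = cint q y (fun r => ∑ i ∈ T, ∑ j ∈ T, (a i * conj (b j) *
        (q : ℂ) ^ ((((e i).ordDisc - (e j).ordDisc : ℤ) : ℂ) * (t * Complex.I))) *
          (orbFun q (e i) (expPath q y r) * orbFun q (e j) (expPath q y r) *
            pathWeight q y r)) := by
      refine cint_congr fun r _ => ?_
      simp only [hconj]
      rw [Finset.sum_mul_sum, Finset.sum_mul]
      refine Finset.sum_congr rfl fun i _ => ?_
      rw [Finset.sum_mul]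
      refine Finset.sum_congr rfl fun j _ => ?_
      rw [conjExt_psiFun hq0, psiFun, weight_eq hq]
      have e2 : (q : ℂ) ^ ((((e i).ordDisc - (e j).ordDisc : ℤ) : ℂ) * (t * Complex.I)) =
          (q : ℂ) ^ (((e i).ordDisc + 1 : ℂ) * (t * Complex.I)) *
            (q : ℂ) ^ (-(((e j).ordDisc + 1 : ℂ) * (t * Complex.I))) := by
        rw [← Complex.cpow_add _ _ hqc]
        congr 1
        push_cast; ring
      rw [e2]
      simp only [expPath, pathWeight]
      ring
    change cint q y _ = _
    rw [e1, hy.cint_sum]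
    · refine Finset.sum_congr rfl fun i _ => ?_
      rw [hy.cint_sum]
      · refine Finset.sum_congr rfl fun j _ => ?_
        rw [cint_const_mul]
        simp only [orbPair]
        ring
      · exact fun j => continuousOn_const.mul (hy.continuousOn_orbPair hq _ _)
    · exact fun i => continuousOn_finsetSum _ fun j _ =>
        continuousOn_const.mul (hy.continuousOn_orbPair hq _ _)
  have hc : ∀ m : ℤ, Continuous fun t : ℝ => (q : ℂ) ^ ((m : ℂ) * (t * Complex.I)) := fun m =>
    (differentiable_natCast_cpow hq0).continuous.comp (by fun_prop)
  have houter : ((Real.log q / (2 * π) : ℝ) : ℂ) * (∫ t in (0 : ℝ)..(2 * π / Real.log q),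
      ∑ i ∈ T, ∑ j ∈ T, a i * conj (b j) * orbPair q y (e i) (e j) *
        (q : ℂ) ^ ((((e i).ordDisc - (e j).ordDisc : ℤ) : ℂ) * (t * Complex.I))) =
      ∑ i ∈ T, ∑ j ∈ T, a i * conj (b j) * orbPair q y (e i) (e j) *
        (if (e i).ordDisc - (e j).ordDisc = 0 then 1 else 0) := by
    rw [intervalIntegral.integral_finsetSum, Finset.mul_sum]
    · refine Finset.sum_congr rfl fun i _ => ?_
      rw [intervalIntegral.integral_finsetSum, Finset.mul_sum]
      · refine Finset.sum_congr rfl fun j _ => ?_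
        rw [intervalIntegral.integral_const_mul, ← integral_natCast_cpow hq]
        ring
      · exact fun j _ => (continuous_const.mul (hc _)).intervalIntegrable _ _
    · exact fun i _ => (continuous_finsetSum _ fun j _ =>
        continuous_const.mul (hc _)).intervalIntegrable _ _
  rw [pairing]
  simp only [hinner]
  rw [houter, Finset.mul_sum]
  refine Finset.sum_congr rfl fun i hi => ?_
  -- Off-diagonal terms vanish, either by the integral over $x$ when the discriminant orders differ,
  -- or by the contour integral when they agree.
  rw [Finset.sum_eq_single_of_mem i hi]
  · rw [sub_self, if_pos rfl, mul_one, ← hy.orbPair_self hq]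
    ring
  · intro j _ hji
    split_ifs with h0
    · rw [hy.orbPair_ne hq (fun h => hji (he h).symm) (sub_eq_zero.1 h0)]
      ring
    · ring

end IsDeformedContour

end QuatHerm

/-! ### The Plancherel formula -/

namespace QuatHerm

open HermSpace

variable {k : Type*} [NontriviallyNormedField k] [IsUltrametricDist k] [ProperSpace k]
  [MeasurableSpace k] [BorelSpace k] {u ϖ : 𝒪[k]}

/-- The indicator function of an orbit. -/
noncomputable def levelInd (u ϖ : 𝒪[k]) (τ : OrbitIndex) : HermSpace u ϖ → ℂ :=
  (level u ϖ τ).indicator fun _ => 1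

theorem levelInd_of_mem {τ : OrbitIndex} {x : HermSpace u ϖ} (hx : x ∈ level u ϖ τ) :
    levelInd u ϖ τ x = 1 := Set.indicator_of_mem hx _

theorem levelInd_of_notMem {τ : OrbitIndex} {x : HermSpace u ϖ} (hx : x ∉ level u ϖ τ) :
    levelInd u ϖ τ x = 0 := Set.indicator_of_notMem hx _

variable (h : IsDatum u ϖ)
include h

theorem IsDatum.isSchwartz_eq_rep {φ : HermSpace u ϖ → ℂ} (hφ : IsSchwartz φ) {τ : OrbitIndex}
    {x : HermSpace u ϖ} (hx : x ∈ level u ϖ τ) : φ x = φ (h.rep τ) := by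
  obtain ⟨κ, hκ⟩ := h.mem_level_iff.1 hx
  rw [← hκ, hφ.1]

/-- The orbits form a cover by disjoint open sets, so a compact support meets only finitely many. -/
theorem IsDatum.isSchwartz_finite {φ : HermSpace u ϖ → ℂ} (hφ : IsSchwartz φ) :
    ∃ T : Finset OrbitIndex, ∀ τ ∉ T, φ (h.rep τ) = 0 := by
  obtain ⟨T, hT⟩ := hφ.2.isCompact.elim_finite_subcover (fun τ => level u ϖ τ) isOpen_level
    (fun x _ => by
      obtain ⟨τ, hτ⟩ := h.exists_mem_level x
      exact Set.mem_iUnion.2 ⟨τ, hτ⟩)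
  refine ⟨T, fun τ hτ => ?_⟩
  by_contra hne
  have hmem := hT (subset_tsupport φ (Function.mem_support.2 hne))
  simp only [Set.mem_iUnion] at hmem
  obtain ⟨σ, hσ, hmem⟩ := hmem
  have : τ = σ := level_unique (h.mem_level_iff.2 ⟨1, actK_one _⟩) hmem
  exact hτ (this ▸ hσ)

/-- A function that is constant on orbits, zero outside finitely many orbits, is a finite sum. -/
theorem IsDatum.eq_sum_levelInd {g : HermSpace u ϖ → ℂ} {c : OrbitIndex → ℂ}
    (hg : ∀ τ, ∀ x ∈ level u ϖ τ, g x = c τ) {T : Finset OrbitIndex} (hT : ∀ τ ∉ T, c τ = 0) :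
    g = fun x => ∑ τ ∈ T, c τ * levelInd u ϖ τ x := by
  funext x
  obtain ⟨σ, hσ⟩ := h.exists_mem_level x
  have hne : ∀ τ, τ ≠ σ → levelInd u ϖ τ x = 0 := fun τ hτ =>
    levelInd_of_notMem fun hx => hτ (level_unique hx hσ)
  rw [hg σ x hσ]
  by_cases hmem : σ ∈ T
  · rw [Finset.sum_eq_single_of_mem σ hmem fun τ _ hτ => by rw [hne τ hτ, mul_zero],
      levelInd_of_mem hσ, mul_one]
  · rw [hT σ hmem, Finset.sum_eq_zero]
    intro τ hτ
    rw [hne τ (fun e => hmem (e ▸ hτ)), mul_zero]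

theorem IsDatum.integrable_levelInd (τ : OrbitIndex) :
    Integrable (levelInd u ϖ τ) (invMeasure u ϖ) := by
  refine (integrable_indicator_iff (measurableSet_level τ)).2 (integrableOn_const ?_)
  rw [h.invMeasure_level]
  exact ENNReal.ofReal_ne_top

theorem IsDatum.integral_levelInd (τ : OrbitIndex) :
    ∫ x, levelInd u ϖ τ x ∂(invMeasure u ϖ) = (τ.vol (rq k) : ℂ) := by
  rw [levelInd, integral_indicator (measurableSet_level τ), setIntegral_const, measureReal_def,
    h.invMeasure_level, ENNReal.toReal_ofReal (h.vol_pos τ).le]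
  simp

theorem IsDatum.integrable_of_orbit {g : HermSpace u ϖ → ℂ} {c : OrbitIndex → ℂ}
    (hg : ∀ τ, ∀ x ∈ level u ϖ τ, g x = c τ) {T : Finset OrbitIndex} (hT : ∀ τ ∉ T, c τ = 0) :
    Integrable g (invMeasure u ϖ) := by
  rw [h.eq_sum_levelInd hg hT]
  exact integrable_finsetSum _ fun τ _ => (h.integrable_levelInd τ).const_mul _

theorem IsDatum.integral_of_orbit {g : HermSpace u ϖ → ℂ} {c : OrbitIndex → ℂ}
    (hg : ∀ τ, ∀ x ∈ level u ϖ τ, g x = c τ) {T : Finset OrbitIndex} (hT : ∀ τ ∉ T, c τ = 0) :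
    ∫ x, g x ∂(invMeasure u ϖ) = ∑ τ ∈ T, c τ * (τ.vol (rq k) : ℂ) := by
  rw [h.eq_sum_levelInd hg hT, integral_finsetSum _ fun τ _ => (h.integrable_levelInd τ).const_mul _]
  refine Finset.sum_congr rfl fun τ _ => ?_
  rw [integral_const_mul, h.integral_levelInd]

theorem IsDatum.mul_Psi_inv {φ : HermSpace u ϖ → ℂ} (hφ : IsSchwartz φ) (z : Fin 2 → ℂ)
    (τ : OrbitIndex) (x : HermSpace u ϖ) (hx : x ∈ level u ϖ τ) :
    φ x * Psi x⁻¹ z = φ (h.rep τ) *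
      psiFun (resCard k) τ.inv ((z 0 + z 1) / 2) ((z 1 - z 0) / 2) := by
  rw [h.isSchwartz_eq_rep hφ hx, h.Psi_eq (h.inv_mem_level hx)]

/-- Each orbit contributes its value times its volume; the index is inverted because the kernel is
evaluated at $x^{-1}$. -/
theorem IsDatum.sphTransformXY_eq {φ : HermSpace u ϖ → ℂ} (hφ : IsSchwartz φ)
    {T : Finset OrbitIndex} (hT : ∀ τ ∉ T, φ (h.rep τ) = 0) :
    sphTransformXY φ = fun x y => ∑ τ ∈ T, (φ (h.rep τ) * (τ.vol (rq k) : ℂ)) *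
      psiFun (resCard k) τ.inv x y := by
  funext x y
  rw [sphTransformXY, sphTransform, h.integral_of_orbit (h.mul_Psi_inv hφ ![x - y, x + y])
    (T := T) fun τ hτ => by rw [hT τ hτ, zero_mul]]
  refine Finset.sum_congr rfl fun τ _ => ?_
  have e1 : (![x - y, x + y] 0 + ![x - y, x + y] 1) / 2 = x := by simp
  have e2 : (![x - y, x + y] 1 - ![x - y, x + y] 0) / 2 = y := by simp
  rw [e1, e2]
  ring

end QuatHerm

theorem theorem5p7 {k : Type*} [NontriviallyNormedField k] [IsUltrametricDist k] [ProperSpace k]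
    [MeasurableSpace k] [BorelSpace k] (hodd : ringChar 𝓀[k] ≠ 2)
    (u ϖ : 𝒪[k]) (hu : IsUnit u) (husq : ¬ IsSquare (u : k)) (hϖ : Irreducible ϖ)
    (hnorm : ‖(ϖ : k)‖ = (resCard k : ℝ)⁻¹)
    (U : ℝ → ℂ) (hU : IsDeformedContour (resCard k) U) :
    invMeasure u ϖ (HermSpace.orbitK 1) = 1 ∧
    (∀ x : HermSpace u ϖ, IsNormalizedSpherical x (Psi x)) ∧
    (∀ φ : HermSpace u ϖ → ℂ, IsSchwartz φ →
      ∀ z, Integrable (fun x => φ x * Psi x⁻¹ z) (invMeasure u ϖ)) ∧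
    ∀ φ ψ : HermSpace u ϖ → ℂ, IsSchwartz φ → IsSchwartz ψ →
      Integrable (fun x => φ x * conj (ψ x)) (invMeasure u ϖ) ∧
      ∫ x, φ x * conj (ψ x) ∂(invMeasure u ϖ) =
        pairing (resCard k) U (sphTransformXY φ) (sphTransformXY ψ) := by
  classical
  have h : IsDatum u ϖ := ⟨hodd, hu, husq, hϖ, hnorm⟩
  have hq : 1 < resCard k := by
    have : (1 : ℝ) < rq k := one_lt_rq
    exact_mod_cast this
  refine ⟨?_, h.isNormalizedSpherical_Psi, fun φ hφ z => ?_, fun φ ψ hφ hψ => ?_⟩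
  · rw [h.orbitK_one, h.invMeasure_level]
    simp [OrbitIndex.vol]
  · obtain ⟨T, hT⟩ := h.isSchwartz_finite hφ
    exact h.integrable_of_orbit (h.mul_Psi_inv hφ z) (T := T) fun τ hτ => by rw [hT τ hτ, zero_mul]
  · obtain ⟨T₁, hT₁⟩ := h.isSchwartz_finite hφ
    obtain ⟨T₂, hT₂⟩ := h.isSchwartz_finite hψ
    have h1 : ∀ τ ∉ T₁ ∪ T₂, φ (h.rep τ) = 0 := fun τ hτ =>
      hT₁ τ fun hm => hτ (Finset.mem_union_left _ hm)
    have h2 : ∀ τ ∉ T₁ ∪ T₂, ψ (h.rep τ) = 0 := fun τ hτ =>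
      hT₂ τ fun hm => hτ (Finset.mem_union_right _ hm)
    have hg : ∀ τ, ∀ x ∈ level u ϖ τ,
        φ x * conj (ψ x) = φ (h.rep τ) * conj (ψ (h.rep τ)) := fun τ x hx => by
      rw [h.isSchwartz_eq_rep hφ hx, h.isSchwartz_eq_rep hψ hx]
    have h0 : ∀ τ ∉ T₁ ∪ T₂, φ (h.rep τ) * conj (ψ (h.rep τ)) = 0 := fun τ hτ => by
      rw [h1 τ hτ, zero_mul]
    refine ⟨h.integrable_of_orbit hg h0, ?_⟩
    rw [h.integral_of_orbit hg h0, h.sphTransformXY_eq hφ h1, h.sphTransformXY_eq hψ h2,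
      hU.pairing_sum hq _ _ OrbitIndex.inv_injective]
    -- Each transform carries a factor of volume and the pairing an inverse volume of the inverted
    -- orbit, which is the same number. One factor of volume remains, as in the integral over $X$.
    refine Finset.sum_congr rfl fun τ _ => ?_
    have hv : ((τ.vol (rq k) : ℝ) : ℂ) ≠ 0 := by exact_mod_cast (h.vol_pos τ).ne'
    rw [OrbitIndex.vol_inv, map_mul, Complex.conj_ofReal]
    field_simp
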